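/- Let $L,T,\kappa,a_0,a_1>0$ and $w\in AC([0,T];H^1(\mathbb R))$, with time derivative $\dot w(s)=\text{w-}\lim_{r\to s}\frac{w(r)-w(s)}{r-s}$ in $H^1(\mathbb R)$ for a.e. $s$. For $\varepsilon>0$ with $\varepsilon a_0<a_1$, a quasi-static brittle damage evolution is a triple of weakly-* measurable maps $\Theta_\varepsilon:[0,T]\to L^\infty((0,L);[0,1])$, $u_\varepsilon:[0,T]\to H^1((0,L))$, $a_\varepsilon=\big(\frac{1-\Theta_\varepsilon}{\varepsilon a_0}+\frac{\Theta_\varepsilon}{a_1}\big)^{-1}:[0,T]\to L^\infty((0,L))$ such that: (1) $u_\varepsilon(t)\in w(t)+H^1_0((0,L))$ for all $t\in[0,T]$; (2) for all $v\in w(0)+H^1_0((0,L))$ and $\theta\in L^\infty((0,L);[0,1])$, $$\int_0^L\Big(\tfrac12a_\varepsilon(0)|u_\varepsilon'(0)|^2+\tfrac\kappa\varepsilon(1-\Theta_\varepsilon(0))\Big)dx\le\int_0^L\Big(\tfrac12\tfrac{\varepsilon a_0a_1}{\theta a_1+(1-\theta)\varepsilon a_0}|v'|^2+\tfrac\kappa\varepsilon\theta\Big)dx;$$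 (3) $a_\varepsilon(t)\le a_\varepsilon(s)$ and $\Theta_\varepsilon(t)\le\Theta_\varepsilon(s)$ a.e. in $(0,L)$ for $0\le s\le t\le T$; (4) for all $t\in[0,T]$, $v\in w(t)+H^1_0((0,L))$ and $\theta\in L^\infty((0,L);[0,1])$, $$\tfrac12\int_0^La_\varepsilon(t)|u_\varepsilon'(t)|^2dx\le\tfrac12\int_0^L\tfrac{\varepsilon a_0a_\varepsilon(t)}{\theta a_\varepsilon(t)+(1-\theta)\varepsilon a_0}|v'|^2dx+\tfrac\kappa\varepsilon\int_0^L\theta\,\Theta_\varepsilon(t)\,dx;$$ (5) for all $t\in[0,T]$, the energy $\mathcal E_\varepsilon(t)=\frac12\int_0^La_\varepsilon(t)|u_\varepsilon'(t)|^2dx+\frac\kappa\varepsilon\int_0^L(1-\Theta_\varepsilon(t))dx$ satisfies $\mathcal E_\varepsilon(t)=\mathcal E_\varepsilon(0)+\int_0^t\int_0^La_\varepsilon(s)u_\varepsilon'(s)\dot w'(s)\,dx\,ds$. Let $\varepsilon=\varepsilon_n\to0$ (with $0<\varepsilon_n$, $\varepsilon_na_0<a_1$) be a sequence of parameters with such evolutions,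 and let $\mu(t)$ be non-negative Radon measures on $[0,L]$ such that $\mu_\varepsilon(t):=\frac{1-\Theta_\varepsilon(t)}{\varepsilon}\mathcal L^1\llcorner(0,L)\rightharpoonup\mu(t)$ weakly-* in $\mathcal M([0,L])$ for every $t\in[0,T]$. Put $K=[-\sqrt{2\kappa a_0},\sqrt{2\kappa a_0}]$. Then, for every $t\in[0,T]$, the stresses $\sigma_\varepsilon(t)=a_\varepsilon(t)u_\varepsilon'(t)$ are constant in space, and along the whole sequence the following limits exist: $$\sigma_\varepsilon(t)\to\sigma(t)=\frac{w(t)(L)-w(t)(0)}{l(t)/a_0+L/a_1}\in K,\qquad l(t):=\mu(t)([0,L])\ge0,$$ $$\tfrac{\sigma_\varepsilon(t)}{a_1}\Theta_\varepsilon(t)\to e(t):=\tfrac{\sigma(t)}{a_1}\ \text{ in }L^2((0,L)),\qquad \tfrac{\sigma_\varepsilon(t)}{a_0}\mu_\varepsilon(t)\rightharpoonup p(t):=\tfrac{\sigma(t)}{a_0}\mu(t)\ \text{ weakly-* in }\mathcal M([0,L]),$$ $$u_\varepsilon(t)\rightharpoonup u(t)\ \text{ weakly-* in }BV((0,L)).$$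 Moreover the mapping $$(\sigma,e,l,\mu,p,u):[0,T]\to K\times\mathbb R\times\mathbb R^+\times\mathcal M([0,L])\times\mathcal M([0,L])\times BV((0,L))$$ is absolutely continuous, where $\mathcal M([0,L])$ carries the total variation norm and $BV((0,L))$ the norm $\|u\|_{L^1}+|Du|((0,L))$. -/

import Mathlib

open MeasureTheory Set Filter Topology
open scoped ENNReal NNReal InnerProductSpace ContDiff

noncomputable section

namespace BrittleDamage

/-! ### Test functions and the Sobolev space `H¹` on a subset of the line -/

/-- `φ ∈ C_c^∞(Ω)`. -/
structure IsTestFunction (Ω : Set ℝ) (φ : ℝ → ℝ) : Prop where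
  smooth : ContDiff ℝ ∞ φ
  compact : HasCompactSupport φ
  supp : tsupport φ ⊆ Ω

theorem IsTestFunction.memLp {Ω : Set ℝ} {φ : ℝ → ℝ} (h : IsTestFunction Ω φ)
    (p : ℝ≥0∞) (ν : Measure ℝ) [IsFiniteMeasureOnCompacts ν] : MemLp φ p ν :=
  h.smooth.continuous.memLp_of_hasCompactSupport h.compact

theorem IsTestFunction.continuous_deriv {Ω : Set ℝ} {φ : ℝ → ℝ} (h : IsTestFunction Ω φ) :
    Continuous (deriv φ) :=
  h.smooth.continuous_deriv (by norm_num)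

theorem IsTestFunction.memLp_deriv {Ω : Set ℝ} {φ : ℝ → ℝ} (h : IsTestFunction Ω φ)
    (p : ℝ≥0∞) (ν : Measure ℝ) [IsFiniteMeasureOnCompacts ν] : MemLp (deriv φ) p ν :=
  h.continuous_deriv.memLp_of_hasCompactSupport h.compact.deriv

/-- `L²(Ω)`. -/
abbrev L2 (Ω : Set ℝ) : Type := Lp ℝ 2 (volume.restrict Ω)

theorem integrable_mul_of_L2 {Ω : Set ℝ} (f : L2 Ω) {φ : ℝ → ℝ}
    (h : MemLp φ 2 (volume.restrict Ω)) :
    Integrable (fun x => f x * φ x) (volume.restrict Ω) :=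
  (Lp.memLp f).integrable_mul h

/-- The Sobolev space `H¹(Ω)`, realised as the space of all pairs `(f, g)` in `L²(Ω) × L²(Ω)` such
that `g` is the weak derivative of `f`; the norm is `(‖f‖² + ‖g‖²)^(1/2)`. -/
def H1 (Ω : Set ℝ) : Submodule ℝ (WithLp 2 (L2 Ω × L2 Ω)) where
  carrier := {z | ∀ φ : ℝ → ℝ, IsTestFunction Ω φ →
    ∫ x in Ω, z.fst x * deriv φ x = - ∫ x in Ω, z.snd x * φ x}
  zero_mem' := by
    intro φ _
    have h0 : (0 : L2 Ω) =ᵐ[volume.restrict Ω] (0 : ℝ → ℝ) := Lp.coeFn_zero _ _ _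
    have e1 : ∫ x in Ω, (0 : L2 Ω) x * deriv φ x = 0 :=
      integral_eq_zero_of_ae (h0.mono fun x hx => by
        change _ * _ = (0 : ℝ)
        rw [hx, Pi.zero_apply, zero_mul])
    have e2 : ∫ x in Ω, (0 : L2 Ω) x * φ x = 0 :=
      integral_eq_zero_of_ae (h0.mono fun x hx => by
        change _ * _ = (0 : ℝ)
        rw [hx, Pi.zero_apply, zero_mul])
    simp only [WithLp.zero_fst, WithLp.zero_snd]
    rw [e1, e2, neg_zero]
  add_mem' := by
    intro y z hy hz φ hφ
    have e (f g : L2 Ω) {ψ : ℝ → ℝ} (hψ : MemLp ψ 2 (volume.restrict Ω)) :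
        ∫ x in Ω, (f + g : L2 Ω) x * ψ x = (∫ x in Ω, f x * ψ x) + ∫ x in Ω, g x * ψ x := by
      rw [← integral_add (integrable_mul_of_L2 f hψ) (integrable_mul_of_L2 g hψ)]
      exact integral_congr_ae ((Lp.coeFn_add f g).mono fun x hx => by
        simp only [hx, Pi.add_apply]; ring)
    simp only [WithLp.add_fst, WithLp.add_snd]
    rw [e _ _ (hφ.memLp_deriv 2 _), e _ _ (hφ.memLp 2 _), hy φ hφ, hz φ hφ]
    ring
  smul_mem' := by
    intro c z hz φ hφ
    have e (f : L2 Ω) (ψ : ℝ → ℝ) :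
        ∫ x in Ω, (c • f : L2 Ω) x * ψ x = c * ∫ x in Ω, f x * ψ x := by
      rw [← integral_const_mul]
      exact integral_congr_ae ((Lp.coeFn_smul c f).mono fun x hx => by
        simp only [hx, Pi.smul_apply, smul_eq_mul]; ring)
    simp only [WithLp.smul_fst, WithLp.smul_snd]
    rw [e, e, hz φ hφ]
    ring

/-- The function underlying an element of `H¹(Ω)` (a representative of its class). -/
def H1.fn {Ω : Set ℝ} (f : H1 Ω) : ℝ → ℝ := (f : WithLp 2 (L2 Ω × L2 Ω)).fst

/-- The weak derivative of an element of `H¹(Ω)` (a representative of its class). -/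
def H1.weakDeriv {Ω : Set ℝ} (f : H1 Ω) : ℝ → ℝ := (f : WithLp 2 (L2 Ω × L2 Ω)).snd

/-- `H¹₀(Ω)`, the closure of `C_c^∞(Ω)` in `H¹(Ω)`. -/
def H10 (Ω : Set ℝ) : Set (H1 Ω) :=
  closure {z | ∃ φ : ℝ → ℝ, IsTestFunction Ω φ ∧ H1.fn z =ᵐ[volume.restrict Ω] φ}

/-- `v ∈ w + H¹₀((0,L))`, for `v ∈ H¹((0,L))` and `w ∈ H¹(ℝ)`. -/
def HasBoundaryDatum (L : ℝ) (w : H1 univ) (v : H1 (Ioo 0 L)) : Prop :=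
  ∃ z ∈ H10 (Ioo 0 L), H1.fn v =ᵐ[volume.restrict (Ioo 0 L)] fun x => H1.fn w x + H1.fn z x

/-! ### The time derivative of a curve in `H¹(ℝ)` -/

/-- `g` is the weak limit in `H¹(ℝ)` of `(w(r) - w(s)) / (r - s)` as `r → s`. -/
def IsTimeDeriv (w : ℝ → H1 univ) (s : ℝ) (g : H1 univ) : Prop :=
  ∀ ψ : H1 univ, Tendsto (fun r => ⟪ψ, (r - s)⁻¹ • (w r - w s)⟫_ℝ) (𝓝[≠] s) (𝓝 ⟪ψ, g⟫_ℝ)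

open Classical in
/-- The time derivative `ẇ(s) ∈ H¹(ℝ)`; it exists for almost every `s` in `[0,T]` when `w` is
absolutely continuous on `[0,T]` (elsewhere it is `0` by convention). -/
def timeDeriv (w : ℝ → H1 univ) (s : ℝ) : H1 univ :=
  if h : ∃ g, IsTimeDeriv w s g then h.choose else 0

/-! ### Bounded Radon measures -/

/-- The Lebesgue measure on a Borel subset `S` of the line. -/
def lebesgueOn (S : Set ℝ) : Measure S := Measure.comap ((↑) : S → ℝ) volume

/-- `M(X)`, the space of real-valued bounded Borel measures, with the total variation norm. -/
instance instNormedAddCommGroupSignedMeasure {X : Type*} [MeasurableSpace X] :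
    NormedAddCommGroup (SignedMeasure X) :=
  AddGroupNorm.toNormedAddCommGroup
    { toFun := fun m => (m.totalVariation univ).toReal
      map_zero' := by simp [SignedMeasure.totalVariation_zero]
      add_le' := by
        intro m m'
        rw [← ENNReal.toReal_add (measure_ne_top _ _) (measure_ne_top _ _)]
        refine ENNReal.toReal_mono (by finiteness) ?_
        simp only [SignedMeasure.totalVariation_eq_variation]
        exact VectorMeasure.variation_add_le univ
      neg' := by intro m; simp [SignedMeasure.totalVariation_neg]
      eq_zero_of_map_eq_zero' := by
        intro m hm
        have h : m.totalVariation univ = 0 :=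
          ((ENNReal.toReal_eq_zero_iff _).1 hm).resolve_right (measure_ne_top _ _)
        ext i _
        exact SignedMeasure.null_of_totalVariation_zero m (measure_mono_null (subset_univ i) h) }

theorem norm_signedMeasure_def {X : Type*} [MeasurableSpace X] (m : SignedMeasure X) :
    ‖m‖ = (m.totalVariation univ).toReal := rfl

theorem integrable_signedMeasure {X : Type*} [MeasurableSpace X] (m : SignedMeasure X) {φ : X → ℝ}
    (hφ : Measurable φ) {C : ℝ} (hC : ∀ x, ‖φ x‖ ≤ C) : m.Integrable φ := by
  have : IsFiniteMeasure m.variation := by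
    rw [← SignedMeasure.totalVariation_eq_variation]; infer_instance
  exact Integrable.of_bound hφ.aestronglyMeasurable C (Eventually.of_forall hC)

/-- Weak-* convergence in `M([0,L])`, tested against `C([0,L])`, of the measures
`f n 𝓛¹ ⌞ (0,L)` to `m`. -/
def TendstoWeakStar (L : ℝ) (f : ℕ → ℝ → ℝ) (m : SignedMeasure (Icc (0 : ℝ) L)) : Prop :=
  ∀ φ : C(Icc (0 : ℝ) L, ℝ),
    Tendsto (fun n => ∫ x, φ x * f n x ∂lebesgueOn (Icc (0 : ℝ) L)) atTop (𝓝 (∫ᵛ x, φ x ∂•m))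

/-! ### Functions of bounded variation on `(0,L)` -/

/-- `L¹((0,L))`. -/
abbrev L1 (L : ℝ) : Type := Lp ℝ 1 (volume.restrict (Ioo (0 : ℝ) L))

/-- The space `BV((0,L))`, realised as the space of all pairs `(u, m)` in `L¹((0,L)) × M((0,L))`
such that `m = Du` is the distributional derivative of `u`;
the norm is `‖u‖_{L¹} + |Du|((0,L))`. -/
def BV (L : ℝ) : Submodule ℝ (WithLp 1 (L1 L × SignedMeasure (Ioo (0 : ℝ) L))) where
  carrier := {z | ∀ φ : ℝ → ℝ, IsTestFunction (Ioo 0 L) φ →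
    ∫ x in Ioo 0 L, z.fst x * deriv φ x = - ∫ᵛ x : Ioo (0 : ℝ) L, φ x ∂•z.snd}
  zero_mem' := by
    intro φ _
    have h0 : (0 : L1 L) =ᵐ[volume.restrict (Ioo 0 L)] (0 : ℝ → ℝ) := Lp.coeFn_zero _ _ _
    have e1 : ∫ x in Ioo 0 L, (0 : L1 L) x * deriv φ x = 0 :=
      integral_eq_zero_of_ae (h0.mono fun x hx => by
        change _ * _ = (0 : ℝ)
        rw [hx, Pi.zero_apply, zero_mul])
    simp only [WithLp.zero_fst, WithLp.zero_snd]
    rw [e1, VectorMeasure.integral_zero_vectorMeasure, neg_zero]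
  add_mem' := by
    intro y z hy hz φ hφ
    obtain ⟨C, hC⟩ := hφ.smooth.continuous.bounded_above_of_compact_support hφ.compact
    have hi (m : SignedMeasure (Ioo (0 : ℝ) L)) : m.Integrable (fun x : Ioo (0 : ℝ) L => φ x) :=
      integrable_signedMeasure m (hφ.smooth.continuous.measurable.comp measurable_subtype_coe)
        (fun x => hC x)
    have hj (f : L1 L) : Integrable (fun x => f x * deriv φ x) (volume.restrict (Ioo 0 L)) :=
      (Lp.memLp f).integrable_mul (hφ.memLp_deriv ∞ _)
    have e : ∫ x in Ioo 0 L, (y.fst + z.fst : L1 L) x * deriv φ x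
        = (∫ x in Ioo 0 L, y.fst x * deriv φ x) + ∫ x in Ioo 0 L, z.fst x * deriv φ x := by
      rw [← integral_add (hj _) (hj _)]
      exact integral_congr_ae ((Lp.coeFn_add y.fst z.fst).mono fun x hx => by
        simp only [hx, Pi.add_apply]; ring)
    simp only [WithLp.add_fst, WithLp.add_snd]
    rw [e, VectorMeasure.integral_add_vectorMeasure (hi _) (hi _), hy φ hφ, hz φ hφ]
    ring
  smul_mem' := by
    intro c z hz φ hφ
    have e : ∫ x in Ioo 0 L, (c • z.fst : L1 L) x * deriv φ x
        = c * ∫ x in Ioo 0 L, z.fst x * deriv φ x := by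
      rw [← integral_const_mul]
      exact integral_congr_ae ((Lp.coeFn_smul c z.fst).mono fun x hx => by
        simp only [hx, Pi.smul_apply, smul_eq_mul]; ring)
    simp only [WithLp.smul_fst, WithLp.smul_snd]
    rw [e, VectorMeasure.integral_smul_vectorMeasure, hz φ hφ]
    simp

/-- Weak-* convergence in `BV((0,L))` of elements `u n` of `H¹((0,L))` to `v`: strong convergence
in `L¹((0,L))`, together with weak-* convergence in `M((0,L))` (the dual of `C₀((0,L))`)
of the derivatives `u n' 𝓛¹` to `Dv`. -/
def TendstoWeakStarBV (L : ℝ) (u : ℕ → H1 (Ioo (0 : ℝ) L)) (v : BV L) : Prop :=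
  Tendsto (fun n => eLpNorm
      (fun x => H1.fn (u n) x - (v : WithLp 1 (L1 L × SignedMeasure (Ioo (0 : ℝ) L))).fst x)
      1 (volume.restrict (Ioo 0 L))) atTop (𝓝 0) ∧
  ∀ φ : ZeroAtInftyContinuousMap (Ioo (0 : ℝ) L) ℝ,
    Tendsto (fun n => ∫ x, φ x * H1.weakDeriv (u n) x ∂lebesgueOn (Ioo (0 : ℝ) L)) atTop
      (𝓝 (∫ᵛ x, φ x ∂•(v : WithLp 1 (L1 L × SignedMeasure (Ioo (0 : ℝ) L))).snd))

/-! ### Quasi-static evolutions of the homogenised brittle damage model -/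

/-- The homogenised stiffness of a mixture of the sound phase, of stiffness `a₁` and volume
fraction `θ`, and of the damaged phase, of stiffness `ε a₀`. -/
def stiffness (a₀ a₁ ε θ : ℝ) : ℝ := ((1 - θ) / (ε * a₀) + θ / a₁)⁻¹

/-- The total energy of a state with displacement `u` and volume fraction `Θ` of sound phase. -/
def energy (L κ a₀ a₁ ε : ℝ) (Θ : ℝ → ℝ) (u : H1 (Ioo (0 : ℝ) L)) : ℝ :=
  1 / 2 * (∫ x in Ioo 0 L, stiffness a₀ a₁ ε (Θ x) * H1.weakDeriv u x ^ 2)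
    + κ / ε * ∫ x in Ioo 0 L, (1 - Θ x)

/-- `θ ∈ L^∞((0,L); [0,1])`. -/
def IsVolumeFraction (L : ℝ) (θ : ℝ → ℝ) : Prop :=
  AEMeasurable θ (volume.restrict (Ioo 0 L)) ∧
    ∀ᵐ x ∂volume.restrict (Ioo 0 L), θ x ∈ Icc (0 : ℝ) 1

/-- `(u, Θ, a)`, with `a = stiffness a₀ a₁ ε Θ`, is a quasi-static evolution on `[0,T]` of the
homogenised brittle damage model on `(0,L)`, with sound stiffness `a₁`, damaged stiffness `ε a₀`,
toughness `κ / ε` and prescribed boundary displacement `w`. -/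
structure IsDamageEvolution (L T κ a₀ a₁ : ℝ) (w : ℝ → H1 univ) (ε : ℝ)
    (Θ : ℝ → ℝ → ℝ) (u : ℝ → H1 (Ioo (0 : ℝ) L)) : Prop where
  volumeFraction : ∀ t ∈ Icc 0 T, IsVolumeFraction L (Θ t)
  measurable_density : ∀ φ : ℝ → ℝ, IntegrableOn φ (Ioo 0 L) →
    AEMeasurable (fun t => ∫ x in Ioo 0 L, φ x * Θ t x) (volume.restrict (Icc 0 T))
  measurable_stiffness : ∀ φ : ℝ → ℝ, IntegrableOn φ (Ioo 0 L) →
    AEMeasurable (fun t => ∫ x in Ioo 0 L, φ x * stiffness a₀ a₁ ε (Θ t x))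
      (volume.restrict (Icc 0 T))
  measurable_displacement : ∀ ψ : H1 (Ioo (0 : ℝ) L),
    AEMeasurable (fun t => ⟪ψ, u t⟫_ℝ) (volume.restrict (Icc 0 T))
  dirichlet : ∀ t ∈ Icc 0 T, HasBoundaryDatum L (w t) (u t)
  initial_minimality : ∀ (v : H1 (Ioo (0 : ℝ) L)) (θ : ℝ → ℝ),
    HasBoundaryDatum L (w 0) v → IsVolumeFraction L θ →
    ∫ x in Ioo 0 L, (1 / 2 * stiffness a₀ a₁ ε (Θ 0 x) * H1.weakDeriv (u 0) x ^ 2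
        + κ / ε * (1 - Θ 0 x))
      ≤ ∫ x in Ioo 0 L, (1 / 2 * (ε * a₀ * a₁ / (θ x * a₁ + (1 - θ x) * (ε * a₀)))
          * H1.weakDeriv v x ^ 2 + κ / ε * θ x)
  monotone_stiffness : ∀ s t, 0 ≤ s → s ≤ t → t ≤ T →
    ∀ᵐ x ∂volume.restrict (Ioo 0 L), stiffness a₀ a₁ ε (Θ t x) ≤ stiffness a₀ a₁ ε (Θ s x)
  monotone_density : ∀ s t, 0 ≤ s → s ≤ t → t ≤ T →
    ∀ᵐ x ∂volume.restrict (Ioo 0 L), Θ t x ≤ Θ s x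
  one_sided_minimality : ∀ t ∈ Icc 0 T, ∀ (v : H1 (Ioo (0 : ℝ) L)) (θ : ℝ → ℝ),
    HasBoundaryDatum L (w t) v → IsVolumeFraction L θ →
    1 / 2 * (∫ x in Ioo 0 L, stiffness a₀ a₁ ε (Θ t x) * H1.weakDeriv (u t) x ^ 2)
      ≤ 1 / 2 * (∫ x in Ioo 0 L, ε * a₀ * stiffness a₀ a₁ ε (Θ t x)
            / (θ x * stiffness a₀ a₁ ε (Θ t x) + (1 - θ x) * (ε * a₀)) * H1.weakDeriv v x ^ 2)
        + κ / ε * ∫ x in Ioo 0 L, θ x * Θ t x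
  energy_balance : ∀ t ∈ Icc 0 T,
    energy L κ a₀ a₁ ε (Θ t) (u t) = energy L κ a₀ a₁ ε (Θ 0) (u 0)
      + ∫ s in (0 : ℝ)..t, ∫ x in Ioo 0 L,
          stiffness a₀ a₁ ε (Θ s x) * H1.weakDeriv (u s) x * H1.weakDeriv (timeDeriv w s) x

/-- The closed convex set of plasticity `K = [-√(2 κ a₀), √(2 κ a₀)]`. -/
abbrev elasticityDomain (κ a₀ : ℝ) : Set ℝ :=
  Icc (-Real.sqrt (2 * κ * a₀)) (Real.sqrt (2 * κ * a₀))

end BrittleDamage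

end

open BrittleDamage

namespace BrittleDamage

/-! ### Test functions on an interval -/

/-! For fixed `ε` everything reduces to two scalars: the elongation `Δ(t) = w(t)(L) - w(t)(0)` and
the total compliance `D(t) = ∫ 1/a`, which is affine in `∫ (1 - Θ)`. One-sided minimality with `θ =
0` makes `u` the elastic minimiser, so the stress is the constant `Δ / D` and `u' = (Δ / D) / a`
(`weakDeriv_eq`, `stress_eq`). Minimality against a small uniform `θ = δ`, divided by `δ`, gives as
`δ → 0` the yield bound `Δ² ≤ 2 f D²`, where `f = κ / (ε k)` and `k` is the compliance gap between
the phases (`sq_jump_le`). The energy becomes `Δ² / (2 D) + f (D - L / a₁)`.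

The key estimate is `compliance_growth_of_energy_balance`. Since `D` is nondecreasing, the factor `1
/ D` in the power `∫ Δ Δ' / D` over `[s, t]` lies between `1 / D t` and `1 / D s`, and the energy
balance yields `f (D t - D s) ≤ (1 / D s - 1 / D t) (Δ s² / 2 + ∫ |Δ Δ'|)`. Dividing by `D t - D s`
and inserting the yield bound leaves `f D s (D t - D s) ≤ ∫ |Δ Δ'|`, an estimate that survives `ε →
0`.

In the limit `D → l / a₀ + L / a₁` and `f → κ a₀`. Hence the stress converges, the yield bound
becomes `σ ∈ K`, and the growth estimate makes `l` absolutely continuous. Irreversibility passes to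
the limit as `μ s ≤ μ t`, so the total variation of `μ t - μ s` is just `l t - l s`. All other
components are explicit in `Δ`, `μ` and the value of `w` at `0`; their increments are controlled by
those of `w` and of `V t = ∫₀ᵗ |Δ Δ'|`. The displacements are primitives involving the distribution
functions of the damage, which converge almost everywhere (`tendsto_distribution`); with a uniform
bound this gives convergence in `L¹`. Damage concentrated at an endpoint enters `p` but not `Du`. -/

theorem IsTestFunction.eq_zero_of_notMem {Ω : Set ℝ} {φ : ℝ → ℝ} (h : IsTestFunction Ω φ) {x : ℝ}
    (hx : x ∉ Ω) : φ x = 0 :=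
  image_eq_zero_of_notMem_tsupport fun h' => hx (h.supp h')

theorem IsTestFunction.deriv {Ω : Set ℝ} {φ : ℝ → ℝ} (h : IsTestFunction Ω φ) :
    IsTestFunction Ω (deriv φ) where
  smooth := (contDiff_infty_iff_deriv.1 h.smooth).2
  compact := h.compact.deriv
  supp := (closure_minimal (support_deriv_subset) (isClosed_tsupport φ)).trans h.supp

theorem IsTestFunction.hasDerivAt {Ω : Set ℝ} {φ : ℝ → ℝ} (h : IsTestFunction Ω φ) (x : ℝ) :
    HasDerivAt φ (_root_.deriv φ x) x :=
  ((contDiff_infty_iff_deriv.1 h.smooth).1 x).hasDerivAt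

theorem IsTestFunction.mono {Ω Ω' : Set ℝ} {φ : ℝ → ℝ} (h : IsTestFunction Ω φ) (hΩ : Ω ⊆ Ω') :
    IsTestFunction Ω' φ :=
  ⟨h.smooth, h.compact, h.supp.trans hΩ⟩

theorem IsTestFunction.add {Ω : Set ℝ} {φ ψ : ℝ → ℝ} (hφ : IsTestFunction Ω φ)
    (hψ : IsTestFunction Ω ψ) : IsTestFunction Ω (fun x => φ x + ψ x) where
  smooth := hφ.smooth.add hψ.smooth
  compact := hφ.compact.add hψ.compact
  supp := (tsupport_add φ ψ).trans (union_subset hφ.supp hψ.supp)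

theorem IsTestFunction.const_mul {Ω : Set ℝ} {φ : ℝ → ℝ} (hφ : IsTestFunction Ω φ) (c : ℝ) :
    IsTestFunction Ω (fun x => c * φ x) where
  smooth := contDiff_const.mul hφ.smooth
  compact := hφ.compact.mul_left
  supp := (tsupport_mul_subset_right).trans hφ.supp

theorem IsTestFunction.zero (Ω : Set ℝ) : IsTestFunction Ω (fun _ => 0) where
  smooth := contDiff_const
  compact := HasCompactSupport.zero
  supp := by simp [tsupport]

theorem IsTestFunction.setIntegral_mul {Ω Ω' : Set ℝ} {φ : ℝ → ℝ} (h : IsTestFunction Ω φ)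
    (hΩ' : MeasurableSet Ω') (hΩ : Ω ⊆ Ω') (f : ℝ → ℝ) :
    ∫ x in Ω', f x * φ x = ∫ x in Ω, f x * φ x :=
  setIntegral_eq_of_subset_of_forall_sdiff_eq_zero hΩ' hΩ fun x hx => by
    rw [h.eq_zero_of_notMem hx.2, mul_zero]

theorem IsTestFunction.integral_mul_deriv {Ω : Set ℝ} {φ ψ : ℝ → ℝ}
    (hφ : IsTestFunction Ω φ) (hψ : IsTestFunction Ω ψ) :
    ∫ x in Ω, φ x * _root_.deriv ψ x = - ∫ x in Ω, _root_.deriv φ x * ψ x := by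
  rw [← hψ.deriv.setIntegral_mul MeasurableSet.univ (subset_univ Ω),
    ← hψ.setIntegral_mul MeasurableSet.univ (subset_univ Ω), Measure.restrict_univ]
  have hc := hφ.smooth.continuous
  have hc' := hψ.smooth.continuous
  refine integral_mul_deriv_eq_deriv_mul_of_integrable (fun x _ => hφ.hasDerivAt x)
    (fun x _ => hψ.hasDerivAt x) ?_ ?_ ?_
  · exact (hc.mul hψ.continuous_deriv).integrable_of_hasCompactSupport hφ.compact.mul_right
  · exact (hφ.continuous_deriv.mul hc').integrable_of_hasCompactSupport hψ.compact.mul_left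
  · exact (hc.mul hc').integrable_of_hasCompactSupport hφ.compact.mul_right

theorem exists_Icc_of_isCompact {L : ℝ} (hL : 0 < L) {K : Set ℝ} (hK : IsCompact K)
    (h : K ⊆ Ioo 0 L) : ∃ a b, 0 < a ∧ a ≤ b ∧ b < L ∧ K ⊆ Icc a b := by
  rcases K.eq_empty_or_nonempty with rfl | hne
  · exact ⟨L / 2, L / 2, by linarith, le_rfl, by linarith, empty_subset _⟩
  · obtain ⟨a, ha⟩ := hK.exists_isLeast hne
    obtain ⟨b, hb⟩ := hK.exists_isGreatest hne
    exact ⟨a, b, (h ha.1).1, ha.2 hb.1, (h hb.1).2, fun x hx => ⟨ha.2 hx, hb.2 hx⟩⟩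

theorem exists_testFunction_integral_eq_one {L : ℝ} (hL : 0 < L) :
    ∃ η, IsTestFunction (Ioo 0 L) η ∧ ∫ x in Ioo 0 L, η x = 1 := by
  let f : ContDiffBump (L / 2) := ⟨L / 8, L / 4, by linarith, by linarith⟩
  have h : IsTestFunction (Ioo 0 L) (f.normed volume) := by
    refine ⟨f.contDiff_normed, f.hasCompactSupport_normed, ?_⟩
    rw [f.tsupport_normed_eq, Real.closedBall_eq_Icc]
    exact fun x hx => ⟨by have : f.rOut = L / 4 := rfl
                          linarith [hx.1], by have : f.rOut = L / 4 := rfl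
                                              linarith [hx.2]⟩
  refine ⟨_, h, ?_⟩
  have := h.setIntegral_mul MeasurableSet.univ (subset_univ _) (fun _ => 1)
  simp only [one_mul, Measure.restrict_univ] at this
  rw [← this, f.integral_normed]

/-- The primitive vanishing at `0` is zero to the left of the support of `ψ`; the zero mean makes it
vanish to the right as well. -/
theorem exists_testFunction_deriv_eq {L : ℝ} (hL : 0 < L) {ψ : ℝ → ℝ}
    (hψ : IsTestFunction (Ioo 0 L) ψ) (h0 : ∫ x in Ioo 0 L, ψ x = 0) :
    ∃ Ψ, IsTestFunction (Ioo 0 L) Ψ ∧ deriv Ψ = ψ := by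
  obtain ⟨a, b, ha, hab, hb, hK⟩ := exists_Icc_of_isCompact hL hψ.compact hψ.supp
  have hc := hψ.smooth.continuous
  have hd (x : ℝ) : HasDerivAt (fun x => ∫ y in (0 : ℝ)..x, ψ y) (ψ x) x :=
    intervalIntegral.integral_hasDerivAt_right (hc.intervalIntegrable _ _)
      (hc.stronglyMeasurableAtFilter _ _) hc.continuousAt
  have hder : deriv (fun x => ∫ y in (0 : ℝ)..x, ψ y) = ψ := funext fun x => (hd x).deriv
  have hz {x : ℝ} (hx : x ∉ Icc a b) : ψ x = 0 :=
    image_eq_zero_of_notMem_tsupport fun h => hx (hK h)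
  have hL0 : ∫ y in (0 : ℝ)..L, ψ y = 0 := by
    rw [intervalIntegral.integral_of_le hL.le, integral_Ioc_eq_integral_Ioo, h0]
  have hsupp : tsupport (fun x => ∫ y in (0 : ℝ)..x, ψ y) ⊆ Icc a b := by
    refine closure_minimal (fun x hx => ?_) isClosed_Icc
    by_contra hx'
    refine hx ?_
    rcases lt_or_ge x a with h | h
    · refine intervalIntegral.integral_zero_ae (Eventually.of_forall fun y hy => hz fun hy' => ?_)
      rw [mem_uIoc] at hy
      rcases hy with hy | hy <;> linarith [hy'.1]
    · have hbx : b < x := not_le.1 fun h' => hx' ⟨h, h'⟩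
      have : ∫ y in L..x, ψ y = 0 := by
        refine intervalIntegral.integral_zero_ae (Eventually.of_forall fun y hy => hz fun hy' => ?_)
        rw [mem_uIoc] at hy
        rcases hy with hy | hy <;> linarith [hy'.2]
      show ∫ y in (0 : ℝ)..x, ψ y = 0
      rw [← intervalIntegral.integral_add_adjacent_intervals (hc.intervalIntegrable 0 L)
        (hc.intervalIntegrable L x), hL0, this, add_zero]
  refine ⟨_, ⟨?_, ?_, ?_⟩, hder⟩
  · refine contDiff_infty_iff_deriv.2 ⟨fun x => (hd x).differentiableAt, ?_⟩
    rw [hder]; exact hψ.smooth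
  · exact isCompact_Icc.of_isClosed_subset (isClosed_tsupport _) hsupp
  · exact hsupp.trans fun x hx => ⟨ha.trans_le hx.1, hx.2.trans_lt hb⟩

/-- The lemma of du Bois-Reymond. -/
theorem exists_const_of_integral_mul_deriv_eq_zero {L : ℝ} (hL : 0 < L) {k : ℝ → ℝ}
    (hk : IntegrableOn k (Ioo 0 L))
    (h : ∀ φ, IsTestFunction (Ioo 0 L) φ → ∫ x in Ioo 0 L, k x * deriv φ x = 0) :
    ∃ c : ℝ, ∀ᵐ x ∂volume.restrict (Ioo 0 L), k x = c := by
  obtain ⟨η, hη, hη1⟩ := exists_testFunction_integral_eq_one hL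
  have hbd {φ : ℝ → ℝ} (hφ : IsTestFunction (Ioo 0 L) φ) :
      Integrable (fun x => k x * φ x) (volume.restrict (Ioo 0 L)) := by
    obtain ⟨C, hC⟩ := hφ.smooth.continuous.bounded_above_of_compact_support hφ.compact
    exact hk.mul_bdd hφ.smooth.continuous.aestronglyMeasurable (ae_of_all _ hC)
  have hi {φ : ℝ → ℝ} (hφ : IsTestFunction (Ioo 0 L) φ) :
      Integrable φ (volume.restrict (Ioo 0 L)) :=
    memLp_one_iff_integrable.1 (hφ.memLp 1 _)
  refine ⟨∫ x in Ioo 0 L, k x * η x, ?_⟩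
  set c := ∫ x in Ioo 0 L, k x * η x with hc
  rw [ae_restrict_iff' measurableSet_Ioo]
  have key := isOpen_Ioo.ae_eq_zero_of_integral_contDiff_smul_eq_zero (μ := volume)
    (f := fun x => k x - c) (U := Ioo 0 L)
    (IntegrableOn.locallyIntegrableOn (Integrable.sub hk (integrable_const c))) ?_
  · filter_upwards [key] with x hx hxI
    linarith [hx hxI]
  · intro φ h1 h2 h3
    have hφ : IsTestFunction (Ioo 0 L) φ := ⟨h1, h2, h3⟩
    have e := hφ.setIntegral_mul MeasurableSet.univ (subset_univ _) (fun x => k x - c)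
    rw [Measure.restrict_univ] at e
    simp only [smul_eq_mul]
    rw [integral_congr_ae (Eventually.of_forall fun x => mul_comm (φ x) (k x - c)), e]
    -- Subtracting `m η` leaves a test function of mean zero, hence the derivative of a test
    -- function.
    set m := ∫ x in Ioo 0 L, φ x with hm
    have hψ := hφ.add (hη.const_mul (-m))
    obtain ⟨Ψ, hΨ, hΨ'⟩ := exists_testFunction_deriv_eq hL hψ (by
      rw [integral_add (hi hφ) ((hi hη).const_mul _), integral_const_mul, hη1]; ring)
    have h0 := h Ψ hΨ
    rw [hΨ'] at h0
    have e1 : ∫ x in Ioo 0 L, k x * (φ x + -m * η x)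
        = (∫ x in Ioo 0 L, k x * φ x) - m * c := by
      rw [hc, ← integral_const_mul, ← integral_sub (hbd hφ) ((hbd hη).const_mul m)]
      exact integral_congr_ae (ae_of_all _ fun x => by ring)
    have e2 : ∫ x in Ioo 0 L, (k x - c) * φ x = (∫ x in Ioo 0 L, k x * φ x) - c * m := by
      rw [hm, ← integral_const_mul, ← integral_sub (hbd hφ) ((hi hφ).const_mul c)]
      exact integral_congr_ae (ae_of_all _ fun x => by ring)
    rw [e2]; rw [e1] at h0; linarith

/-- A function with integrable weak derivative `g` is a primitive of `g`. -/
theorem exists_eq_const_add_integral {L : ℝ} (hL : 0 < L) {f g : ℝ → ℝ}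
    (hf : IntegrableOn f (Ioo 0 L)) (hg : IntegrableOn g (Ioo 0 L))
    (h : ∀ φ, IsTestFunction (Ioo 0 L) φ →
      ∫ x in Ioo 0 L, f x * deriv φ x = - ∫ x in Ioo 0 L, g x * φ x) :
    ∃ c : ℝ, ∀ᵐ x ∂volume.restrict (Ioo 0 L), f x = c + ∫ y in (0 : ℝ)..x, g y := by
  have hgi : IntervalIntegrable g volume 0 L := by
    rwa [intervalIntegrable_iff_integrableOn_Ioo_of_le hL.le]
  have hac := hgi.absolutelyContinuousOnInterval_intervalIntegral left_mem_uIcc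
  have hFc : ContinuousOn (fun x => ∫ y in (0 : ℝ)..x, g y) (Icc 0 L) := by
    have := hac.continuousOn
    rwa [uIcc_of_le hL.le] at this
  have hF : IntegrableOn (fun x => ∫ y in (0 : ℝ)..x, g y) (Ioo 0 L) :=
    (hFc.integrableOn_compact isCompact_Icc).mono_set Ioo_subset_Icc_self
  -- `f` minus the primitive of `g` has zero weak derivative: integrate the primitive by parts; the
  -- boundary terms vanish.
  obtain ⟨c, hc⟩ := exists_const_of_integral_mul_deriv_eq_zero hL (hf.sub hF) (fun φ hφ => by
    have hparts := hac.integral_mul_deriv_eq_deriv_mul (g := φ)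
      ((hφ.smooth.of_le (by norm_num)).contDiffOn.absolutelyContinuousOnInterval)
    rw [hφ.eq_zero_of_notMem (x := L) (by simp), hφ.eq_zero_of_notMem (x := 0) (by simp),
      intervalIntegral.integral_of_le hL.le, integral_Ioc_eq_integral_Ioo] at hparts
    have e : ∫ x in (0 : ℝ)..L, deriv (fun x => ∫ y in (0 : ℝ)..x, g y) x * φ x
        = ∫ x in Ioo 0 L, g x * φ x := by
      rw [← integral_Ioc_eq_integral_Ioo, ← intervalIntegral.integral_of_le hL.le]
      refine intervalIntegral.integral_congr_ae ?_
      filter_upwards [hgi.ae_hasDerivAt_integral] with x hx hxI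
      rw [(hx (uIoc_subset_uIcc hxI) 0 left_mem_uIcc).deriv]
    have hb {u : ℝ → ℝ} (hu : IntegrableOn u (Ioo 0 L)) :
        Integrable (fun x => u x * deriv φ x) (volume.restrict (Ioo 0 L)) := by
      obtain ⟨C, hC⟩ := hφ.deriv.smooth.continuous.bounded_above_of_compact_support hφ.deriv.compact
      exact hu.mul_bdd hφ.deriv.smooth.continuous.aestronglyMeasurable (ae_of_all _ hC)
    rw [e] at hparts
    calc ∫ x in Ioo 0 L, (f - fun x => ∫ y in (0 : ℝ)..x, g y) x * deriv φ x
        = (∫ x in Ioo 0 L, f x * deriv φ x)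
          - ∫ x in Ioo 0 L, (∫ y in (0 : ℝ)..x, g y) * deriv φ x := by
          rw [← integral_sub (hb hf) (hb hF)]
          exact integral_congr_ae (ae_of_all _ fun x => by simp only [Pi.sub_apply]; ring)
      _ = 0 := by rw [h φ hφ, hparts]; ring)
  refine ⟨c, hc.mono fun x hx => ?_⟩
  simp only [Pi.sub_apply] at hx
  linarith

/-- Two continuous primitives that agree almost everywhere have the same data at the endpoints. -/
theorem primitive_data_unique {L : ℝ} (hL : 0 < L) {W g : ℝ → ℝ} {c : ℝ}
    (hW : ContinuousOn W (Icc 0 L)) (hg : IntegrableOn g (Ioo 0 L))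
    (h : ∀ᵐ x ∂volume.restrict (Ioo 0 L), W x = c + ∫ y in (0 : ℝ)..x, g y) :
    W 0 = c ∧ W L = c + ∫ x in Ioo 0 L, g x := by
  have hgi : IntervalIntegrable g volume 0 L := by
    rwa [intervalIntegrable_iff_integrableOn_Ioo_of_le hL.le]
  have hFc : ContinuousOn (fun x => c + ∫ y in (0 : ℝ)..x, g y) (Icc 0 L) := by
    have := (hgi.absolutelyContinuousOnInterval_intervalIntegral left_mem_uIcc).continuousOn
    rw [uIcc_of_le hL.le] at this
    exact continuousOn_const.add this
  have h1 : EqOn W (fun x => c + ∫ y in (0 : ℝ)..x, g y) (Ioo 0 L) :=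
    Measure.eqOn_open_of_ae_eq h isOpen_Ioo (hW.mono Ioo_subset_Icc_self)
      (hFc.mono Ioo_subset_Icc_self)
  have h2 : EqOn W (fun x => c + ∫ y in (0 : ℝ)..x, g y) (Icc 0 L) :=
    h1.of_subset_closure hW hFc Ioo_subset_Icc_self (by rw [closure_Ioo hL.ne])
  refine ⟨by simpa using h2 (left_mem_Icc.2 hL.le), ?_⟩
  rw [h2 (right_mem_Icc.2 hL.le)]
  simp only
  rw [intervalIntegral.integral_of_le hL.le, integral_Ioc_eq_integral_Ioo]


/-! ### The Sobolev space `H¹` on the line and on an interval -/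

/-- The inclusion of `H¹(Ω)` into `L²(Ω)`. -/
noncomputable def H1.fstL (Ω : Set ℝ) : H1 Ω →L[ℝ] L2 Ω :=
  (WithLp.fstL 2 ℝ (L2 Ω) (L2 Ω)).comp (H1 Ω).subtypeL

/-- The weak derivative, as an operator from `H¹(Ω)` to `L²(Ω)`. -/
noncomputable def H1.sndL (Ω : Set ℝ) : H1 Ω →L[ℝ] L2 Ω :=
  (WithLp.sndL 2 ℝ (L2 Ω) (L2 Ω)).comp (H1 Ω).subtypeL

theorem H1.fn_eq {Ω : Set ℝ} (z : H1 Ω) : H1.fn z = H1.fstL Ω z := rfl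

theorem H1.weakDeriv_eq {Ω : Set ℝ} (z : H1 Ω) : H1.weakDeriv z = H1.sndL Ω z := rfl

theorem H1.norm_fstL_le {Ω : Set ℝ} (z : H1 Ω) : ‖H1.fstL Ω z‖ ≤ ‖z‖ :=
  WithLp.norm_fst_le _ (z : WithLp 2 (L2 Ω × L2 Ω))

theorem H1.norm_sndL_le {Ω : Set ℝ} (z : H1 Ω) : ‖H1.sndL Ω z‖ ≤ ‖z‖ :=
  WithLp.norm_snd_le _ (z : WithLp 2 (L2 Ω × L2 Ω))

theorem H1.norm_le {Ω : Set ℝ} (z : H1 Ω) : ‖z‖ ≤ ‖H1.fstL Ω z‖ + ‖H1.sndL Ω z‖ := by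
  have h : ‖z‖ ^ 2 = ‖H1.fstL Ω z‖ ^ 2 + ‖H1.sndL Ω z‖ ^ 2 :=
    WithLp.prod_norm_sq_eq_of_L2 (z : WithLp 2 (L2 Ω × L2 Ω))
  have h1 := norm_nonneg (H1.fstL Ω z)
  have h2 := norm_nonneg (H1.sndL Ω z)
  nlinarith [norm_nonneg z, mul_nonneg h1 h2]

theorem inner_toLp {Ω : Set ℝ} {φ : ℝ → ℝ} (hφ : MemLp φ 2 (volume.restrict Ω)) (f : L2 Ω) :
    ⟪hφ.toLp φ, f⟫_ℝ = ∫ x in Ω, f x * φ x := by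
  rw [L2.inner_def]
  refine integral_congr_ae (hφ.coeFn_toLp.mono fun x hx => ?_)
  simp [hx]

/-- Each test function imposes one closed linear condition. The resulting completeness is needed for
weak limits of difference quotients and for the closed range argument. -/
theorem isClosed_H1 (Ω : Set ℝ) : IsClosed (H1 Ω : Set (WithLp 2 (L2 Ω × L2 Ω))) := by
  have : (H1 Ω : Set (WithLp 2 (L2 Ω × L2 Ω))) =
      ⋂ (φ : ℝ → ℝ) (hφ : IsTestFunction Ω φ),
        {z | ⟪(hφ.memLp_deriv 2 (volume.restrict Ω)).toLp _, z.fst⟫_ℝ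
          = -⟪(hφ.memLp 2 (volume.restrict Ω)).toLp _, z.snd⟫_ℝ} := by
    ext z
    simp only [mem_iInter, mem_ofPred_eq, inner_toLp]
    rfl
  rw [this]
  refine isClosed_iInter fun φ => isClosed_iInter fun hφ => isClosed_eq ?_ ?_
  · exact continuous_const.inner (WithLp.fstL 2 ℝ (L2 Ω) (L2 Ω)).continuous
  · exact (continuous_const.inner (WithLp.sndL 2 ℝ (L2 Ω) (L2 Ω)).continuous).neg

instance instCompleteSpaceH1 (Ω : Set ℝ) : CompleteSpace (H1 Ω) :=
  (isClosed_H1 Ω).completeSpace_coe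

theorem restrict_restrict_Ioo {L : ℝ} {Ω : Set ℝ} (h : Ioo 0 L ⊆ Ω) :
    (volume.restrict Ω).restrict (Ioo 0 L) = volume.restrict (Ioo 0 L) :=
  Measure.restrict_restrict_of_subset h

theorem memLp_Ioo {L : ℝ} {Ω : Set ℝ} (h : Ioo 0 L ⊆ Ω) (f : L2 Ω) :
    MemLp f 2 (volume.restrict (Ioo 0 L)) :=
  (Lp.memLp f).mono_measure (Measure.restrict_mono h le_rfl)

theorem integrableOn_Ioo {L : ℝ} {Ω : Set ℝ} (h : Ioo 0 L ⊆ Ω) (f : L2 Ω) :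
    IntegrableOn f (Ioo 0 L) :=
  (memLp_Ioo h f).integrable one_le_two

theorem H1.integrableOn_fn {L : ℝ} {Ω : Set ℝ} (h : Ioo 0 L ⊆ Ω) (z : H1 Ω) :
    IntegrableOn (H1.fn z) (Ioo 0 L) :=
  integrableOn_Ioo h (H1.fstL Ω z)

theorem H1.integrableOn_weakDeriv {L : ℝ} {Ω : Set ℝ} (h : Ioo 0 L ⊆ Ω) (z : H1 Ω) :
    IntegrableOn (H1.weakDeriv z) (Ioo 0 L) :=
  integrableOn_Ioo h (H1.sndL Ω z)

/-! ### Elongation and trace as continuous quantities -/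

/-- The functional `z ↦ ∫₀ᴸ z'`. -/
noncomputable def H1.jump (L : ℝ) (Ω : Set ℝ) : H1 Ω →L[ℝ] ℝ :=
  (innerSL ℝ (indicatorConstLp 2 (μ := volume.restrict Ω) (measurableSet_Ioo (a := 0) (b := L))
    ((Measure.restrict_apply_le _ _).trans_lt (by simp)).ne (1 : ℝ))).comp (H1.sndL Ω)

theorem H1.jump_apply {L : ℝ} {Ω : Set ℝ} (h : Ioo 0 L ⊆ Ω) (z : H1 Ω) :
    H1.jump L Ω z = ∫ x in Ioo 0 L, H1.weakDeriv z x := by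
  rw [H1.jump, ContinuousLinearMap.comp_apply, innerSL_apply_apply, L2.inner_indicatorConstLp_one,
    restrict_restrict_Ioo h]
  rfl

/-- Cauchy–Schwarz against the indicator of `(0,L)`. -/
theorem exists_integral_abs_le {L : ℝ} {Ω : Set ℝ} (h : Ioo 0 L ⊆ Ω) :
    ∃ C, 0 ≤ C ∧ ∀ f : L2 Ω, ∫ x in Ioo 0 L, |f x| ≤ C * ‖f‖ := by
  let i : L2 Ω := indicatorConstLp 2 (μ := volume.restrict Ω)
    (measurableSet_Ioo (a := 0) (b := L))
    ((Measure.restrict_apply_le _ _).trans_lt (by simp)).ne (1 : ℝ)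
  refine ⟨‖i‖, norm_nonneg _, fun f => ?_⟩
  have h1 : ⟪i, |f|⟫_ℝ = ∫ x in Ioo 0 L, |f x| := by
    rw [L2.inner_indicatorConstLp_one, restrict_restrict_Ioo h]
    exact integral_congr_ae (ae_restrict_of_ae_restrict_of_subset h (Lp.coeFn_abs f))
  rw [← h1, ← norm_abs_eq_norm f]
  exact real_inner_le_norm _ _

/-- `c` is the value at `0` of the continuous representative of `z` on `[0,L]`. -/
def H1.HasTrace (L : ℝ) {Ω : Set ℝ} (z : H1 Ω) (c : ℝ) : Prop :=
  ∀ᵐ x ∂volume.restrict (Ioo 0 L), H1.fn z x = c + ∫ y in (0 : ℝ)..x, H1.weakDeriv z y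

theorem H1.exists_hasTrace {L : ℝ} (hL : 0 < L) {Ω : Set ℝ} (hΩ : MeasurableSet Ω)
    (h : Ioo 0 L ⊆ Ω) (z : H1 Ω) : ∃ c, H1.HasTrace L z c := by
  refine exists_eq_const_add_integral hL (integrableOn_Ioo h (H1.fstL Ω z))
    (integrableOn_Ioo h (H1.sndL Ω z)) fun φ hφ => ?_
  have := z.2 φ (hφ.mono h)
  rwa [hφ.setIntegral_mul hΩ h, hφ.deriv.setIntegral_mul hΩ h] at this

theorem integral_congr_Ioo {L x : ℝ} (hx : x ∈ Ioo 0 L) {f g : ℝ → ℝ}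
    (h : ∀ᵐ y ∂volume.restrict (Ioo 0 L), f y = g y) :
    ∫ y in (0 : ℝ)..x, f y = ∫ y in (0 : ℝ)..x, g y := by
  rw [intervalIntegral.integral_of_le hx.1.le, intervalIntegral.integral_of_le hx.1.le]
  have hs : Ioc 0 x ⊆ Ioo 0 L := fun y hy => ⟨hy.1, hy.2.trans_lt hx.2⟩
  exact integral_congr_ae (ae_restrict_of_ae_restrict_of_subset hs h)

theorem intervalIntegrable_of_Ioo {L x : ℝ} (hx : x ∈ Ioo 0 L) {f : ℝ → ℝ}
    (hf : IntegrableOn f (Ioo 0 L)) : IntervalIntegrable f volume 0 x := by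
  rw [intervalIntegrable_iff_integrableOn_Ioo_of_le hx.1.le]
  exact hf.mono_set fun y hy => ⟨hy.1, hy.2.trans hx.2⟩

theorem H1.HasTrace.sub {L : ℝ} {Ω : Set ℝ} (h : Ioo 0 L ⊆ Ω) {y z : H1 Ω} {c d : ℝ}
    (hy : H1.HasTrace L y c) (hz : H1.HasTrace L z d) : H1.HasTrace L (y - z) (c - d) := by
  have e1 : ∀ᵐ x ∂volume.restrict (Ioo 0 L), H1.fn (y - z) x = H1.fn y x - H1.fn z x := by
    simp only [H1.fn_eq, map_sub]
    exact ae_restrict_of_ae_restrict_of_subset h (Lp.coeFn_sub _ _)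
  have e2 : ∀ᵐ x ∂volume.restrict (Ioo 0 L),
      H1.weakDeriv (y - z) x = H1.weakDeriv y x - H1.weakDeriv z x := by
    simp only [H1.weakDeriv_eq, map_sub]
    exact ae_restrict_of_ae_restrict_of_subset h (Lp.coeFn_sub _ _)
  filter_upwards [hy, hz, e1, ae_restrict_mem measurableSet_Ioo] with x h1 h2 h3 hx
  rw [h3, h1, h2, integral_congr_Ioo hx e2, intervalIntegral.integral_sub
    (intervalIntegrable_of_Ioo hx (H1.integrableOn_weakDeriv h y))
    (intervalIntegrable_of_Ioo hx (H1.integrableOn_weakDeriv h z))]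
  ring

theorem abs_integral_le_Ioo {L x : ℝ} (hx : x ∈ Ioo 0 L) {f : ℝ → ℝ}
    (hf : IntegrableOn f (Ioo 0 L)) :
    |∫ y in (0 : ℝ)..x, f y| ≤ ∫ y in Ioo 0 L, |f y| := by
  rw [intervalIntegral.integral_of_le hx.1.le]
  refine (abs_integral_le_integral_abs).trans ?_
  exact setIntegral_mono_set hf.abs (ae_of_all _ fun y => abs_nonneg _)
    (LE.le.eventuallyLE fun y hy => ⟨hy.1, hy.2.trans_lt hx.2⟩)

/-- Average `c = z(x) - ∫₀ˣ z'` over `(0,L)`: the first term contributes `C / L`, the second `C`. -/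
theorem H1.exists_trace_bound {L : ℝ} (hL : 0 < L) {Ω : Set ℝ} (h : Ioo 0 L ⊆ Ω) :
    ∃ C, 0 ≤ C ∧ ∀ (z : H1 Ω) (c : ℝ), H1.HasTrace L z c → |c| ≤ C * ‖z‖ := by
  obtain ⟨C, hC0, hC⟩ := exists_integral_abs_le h
  refine ⟨C / L + C, by positivity, fun z c hc => ?_⟩
  have hf := H1.integrableOn_fn h z
  have hg := H1.integrableOn_weakDeriv h z
  have h1 : ∫ _ in Ioo 0 L, |c| ≤ ∫ x in Ioo 0 L,
      (|H1.fn z x| + ∫ y in Ioo 0 L, |H1.weakDeriv z y|) := by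
    refine integral_mono_ae (integrable_const _) (hf.abs.add (integrable_const _)) ?_
    filter_upwards [hc, ae_restrict_mem measurableSet_Ioo] with x h1 hx
    have h2 := abs_integral_le_Ioo hx hg
    have h3 : c = H1.fn z x - ∫ y in (0 : ℝ)..x, H1.weakDeriv z y := by rw [h1]; ring
    have h4 := abs_sub (H1.fn z x) (∫ y in (0 : ℝ)..x, H1.weakDeriv z y)
    rw [← h3] at h4
    exact h4.trans (by gcongr)
  rw [integral_add hf.abs (integrable_const _)] at h1
  simp only [integral_const, measureReal_restrict_apply MeasurableSet.univ, univ_inter,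
    Real.volume_real_Ioo, sub_zero, max_eq_left hL.le, smul_eq_mul] at h1
  have h2 := (hC (H1.fstL Ω z)).trans (mul_le_mul_of_nonneg_left (H1.norm_fstL_le z) hC0)
  have h3 := (hC (H1.sndL Ω z)).trans (mul_le_mul_of_nonneg_left (H1.norm_sndL_le z) hC0)
  have h4 : L * |c| ≤ C * ‖z‖ + L * (C * ‖z‖) :=
    h1.trans (add_le_add h2 (mul_le_mul_of_nonneg_left h3 hL.le))
  have : (C / L + C) * ‖z‖ = (C * ‖z‖ + L * (C * ‖z‖)) / L := by field_simp
  rw [this, le_div_iff₀ hL]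
  linarith

/-! ### The space `H¹₀` and boundary data -/

/-- A test function as an element of `H¹(Ω)`. -/
noncomputable def H1.ofTest {Ω : Set ℝ} {φ : ℝ → ℝ} (hφ : IsTestFunction Ω φ) : H1 Ω :=
  ⟨WithLp.toLp 2 ((hφ.memLp 2 _).toLp φ, (hφ.memLp_deriv 2 _).toLp (deriv φ)), by
    intro ψ hψ
    have h1 := (hφ.memLp 2 (volume.restrict Ω)).coeFn_toLp
    have h2 := (hφ.memLp_deriv 2 (volume.restrict Ω)).coeFn_toLp
    have e1 : ∫ x in Ω, (hφ.memLp 2 (volume.restrict Ω)).toLp φ x * deriv ψ x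
        = ∫ x in Ω, φ x * deriv ψ x :=
      integral_congr_ae (h1.mono fun x hx => by simp only [hx])
    have e2 : ∫ x in Ω, (hφ.memLp_deriv 2 (volume.restrict Ω)).toLp (deriv φ) x * ψ x
        = ∫ x in Ω, deriv φ x * ψ x :=
      integral_congr_ae (h2.mono fun x hx => by simp only [hx])
    exact e1.trans ((hφ.integral_mul_deriv hψ).trans (congrArg Neg.neg e2.symm))⟩

/-- The subspace `C_c^∞(Ω)` of `H¹(Ω)`. -/
def H1.testSubmodule (Ω : Set ℝ) : Submodule ℝ (H1 Ω) where
  carrier := {z | ∃ φ : ℝ → ℝ, IsTestFunction Ω φ ∧ H1.fn z =ᵐ[volume.restrict Ω] φ}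
  zero_mem' := ⟨_, IsTestFunction.zero Ω, Lp.coeFn_zero _ _ _⟩
  add_mem' := by
    rintro y z ⟨φ, hφ, hy⟩ ⟨ψ, hψ, hz⟩
    refine ⟨_, hφ.add hψ, ?_⟩
    rw [H1.fn_eq, map_add]
    filter_upwards [Lp.coeFn_add (H1.fstL Ω y) (H1.fstL Ω z), hy, hz] with x h1 h2 h3
    rw [h1, Pi.add_apply, ← H1.fn_eq, ← H1.fn_eq, h2, h3]
  smul_mem' := by
    rintro c z ⟨φ, hφ, hz⟩
    refine ⟨_, hφ.const_mul c, ?_⟩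
    rw [H1.fn_eq, map_smul]
    filter_upwards [Lp.coeFn_smul c (H1.fstL Ω z), hz] with x h1 h2
    rw [h1, Pi.smul_apply, ← H1.fn_eq, h2, smul_eq_mul]

theorem H1.fn_ofTest {Ω : Set ℝ} {φ : ℝ → ℝ} (hφ : IsTestFunction Ω φ) :
    H1.fn (H1.ofTest hφ) =ᵐ[volume.restrict Ω] φ :=
  (hφ.memLp 2 (volume.restrict Ω)).coeFn_toLp

theorem H10_eq (Ω : Set ℝ) : H10 Ω = (H1.testSubmodule Ω).topologicalClosure := rfl

/-- Both endpoint conditions hold for test functions and pass to the closure: the trace by its norm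
bound, the elongation by continuity. -/
theorem H1.hasTrace_zero_of_mem_H10 {L : ℝ} (hL : 0 < L) {z : H1 (Ioo 0 L)}
    (hz : z ∈ H10 (Ioo 0 L)) : H1.HasTrace L z 0 ∧ H1.jump L (Ioo 0 L) z = 0 := by
  have key : ∀ y ∈ H1.testSubmodule (Ioo 0 L),
      H1.HasTrace L y 0 ∧ H1.jump L (Ioo 0 L) y = 0 := by
    rintro y ⟨φ, hφ, hy⟩
    obtain ⟨c, hc⟩ := H1.exists_hasTrace hL measurableSet_Ioo subset_rfl y
    have hd := primitive_data_unique hL hφ.smooth.continuous.continuousOn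
      (integrableOn_Ioo subset_rfl (H1.sndL _ y)) (c := c) (by
        filter_upwards [hc, hy] with x h1 h2
        rw [← h2, h1]; rfl)
    rw [hφ.eq_zero_of_notMem (x := L) (by simp), hφ.eq_zero_of_notMem (x := 0) (by simp)] at hd
    obtain ⟨rfl, hd⟩ := hd
    refine ⟨hc, ?_⟩
    rw [H1.jump_apply subset_rfl, H1.weakDeriv_eq]
    linarith
  constructor
  · obtain ⟨c, hc⟩ := H1.exists_hasTrace hL measurableSet_Ioo subset_rfl z
    obtain ⟨C, hC0, hC⟩ := H1.exists_trace_bound hL (subset_refl (Ioo 0 L))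
    have : |c| ≤ 0 := by
      refine le_of_forall_pos_le_add fun δ hδ => ?_
      obtain ⟨y, hy, hzy⟩ := Metric.mem_closure_iff.1 hz (δ / (C + 1)) (by positivity)
      have h1 := hC _ _ (hc.sub subset_rfl (key y hy).1)
      rw [sub_zero, ← dist_eq_norm] at h1
      have h2 : C * dist z y ≤ C * (δ / (C + 1)) := mul_le_mul_of_nonneg_left hzy.le hC0
      have h3 : C * (δ / (C + 1)) ≤ δ := by
        rw [mul_div_assoc', div_le_iff₀ (by positivity)]; nlinarith
      linarith
    have h0 : c = 0 := abs_eq_zero.1 (le_antisymm this (abs_nonneg c))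
    rwa [h0] at hc
  · have hcl : IsClosed {y : H1 (Ioo 0 L) | H1.jump L (Ioo 0 L) y = 0} :=
      isClosed_eq (H1.jump L (Ioo 0 L)).continuous continuous_const
    exact closure_minimal (fun y hy => (key y hy).2) hcl hz

/-- The boundary datum enters the problem only through these two numbers: the value at `0` and the
elongation. -/
theorem HasBoundaryDatum.trace_eq {L : ℝ} (hL : 0 < L) {w : H1 univ} {v : H1 (Ioo 0 L)}
    (h : HasBoundaryDatum L w v) {c : ℝ} (hc : H1.HasTrace L w c) :
    H1.HasTrace L v c ∧ H1.jump L (Ioo 0 L) v = H1.jump L univ w := by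
  obtain ⟨z, hz, hvz⟩ := h
  obtain ⟨hz0, hzj⟩ := H1.hasTrace_zero_of_mem_H10 hL hz
  obtain ⟨d, hd⟩ := H1.exists_hasTrace hL measurableSet_Ioo subset_rfl v
  have hw' := integrableOn_Ioo (subset_univ (Ioo 0 L)) (H1.sndL _ w)
  have hv' := integrableOn_Ioo (subset_refl (Ioo 0 L)) (H1.sndL _ v)
  have hz' := integrableOn_Ioo (subset_refl (Ioo 0 L)) (H1.sndL _ z)
  have hi : IntervalIntegrable (H1.sndL _ v : ℝ → ℝ) volume 0 L := by
    rwa [intervalIntegrable_iff_integrableOn_Ioo_of_le hL.le]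
  have hcont : ContinuousOn (fun x => d + ∫ y in (0 : ℝ)..x, H1.sndL _ v y) (Icc 0 L) := by
    have := (hi.absolutelyContinuousOnInterval_intervalIntegral left_mem_uIcc).continuousOn
    rw [uIcc_of_le hL.le] at this
    exact continuousOn_const.add this
  have hu := primitive_data_unique hL hcont (hw'.add hz') (c := c) (by
    filter_upwards [hd, hc, hz0, hvz, ae_restrict_mem measurableSet_Ioo] with x h1 h2 h3 h4 hx
    have e : ∫ y in (0 : ℝ)..x, ((H1.sndL _ w : ℝ → ℝ) + (H1.sndL _ z : ℝ → ℝ)) y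
        = (∫ y in (0 : ℝ)..x, H1.weakDeriv w y) + ∫ y in (0 : ℝ)..x, H1.weakDeriv z y :=
      intervalIntegral.integral_add (intervalIntegrable_of_Ioo hx hw')
        (intervalIntegrable_of_Ioo hx hz')
    rw [e]
    rw [← H1.weakDeriv_eq, ← h1, h4, h2, h3]
    ring)
  simp only [intervalIntegral.integral_same, add_zero] at hu
  obtain ⟨rfl, hu⟩ := hu
  refine ⟨hd, ?_⟩
  rw [intervalIntegral.integral_of_le hL.le, integral_Ioc_eq_integral_Ioo,
    integral_add' hw' hz'] at hu
  rw [H1.jump_apply subset_rfl] at hzj ⊢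
  rw [H1.jump_apply (subset_univ _), H1.weakDeriv_eq, H1.weakDeriv_eq]
  rw [H1.weakDeriv_eq] at hzj
  linarith

theorem H1.exists_poincare {L : ℝ} (hL : 0 < L) :
    ∃ C : ℝ≥0, ∀ z ∈ H10 (Ioo 0 L), ‖z‖ ≤ C * ‖H1.sndL (Ioo 0 L) z‖ := by
  obtain ⟨C, hC0, hC⟩ := exists_integral_abs_le (subset_refl (Ioo 0 L))
  set m : ℝ := (measureUnivNNReal (volume.restrict (Ioo 0 L)) : ℝ) ^ (2 : ℝ≥0∞).toReal⁻¹ with hm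
  have hm0 : 0 ≤ m := by positivity
  refine ⟨⟨m * C + 1, by positivity⟩, fun z hz => ?_⟩
  have h1 : ‖H1.fstL (Ioo 0 L) z‖ ≤ m * (C * ‖H1.sndL (Ioo 0 L) z‖) := by
    refine Lp.norm_le_of_ae_bound (by positivity) ?_
    filter_upwards [(H1.hasTrace_zero_of_mem_H10 hL hz).1, ae_restrict_mem measurableSet_Ioo]
      with x h1 hx
    rw [← H1.fn_eq, h1, zero_add, Real.norm_eq_abs]
    exact (abs_integral_le_Ioo hx (integrableOn_Ioo subset_rfl (H1.sndL _ z))).trans (hC _)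
  calc ‖z‖ ≤ _ := H1.norm_le z
    _ ≤ m * (C * ‖H1.sndL (Ioo 0 L) z‖) + ‖H1.sndL (Ioo 0 L) z‖ := by gcongr
    _ = (m * C + 1) * ‖H1.sndL (Ioo 0 L) z‖ := by ring

/-- The derivatives of `H¹₀` form a closed subspace of `L²` by Poincaré; its orthogonal complement
consists of constants by du Bois-Reymond, and `h` is orthogonal to constants. -/
theorem exists_mem_H10_of_integral_eq_zero {L : ℝ} (hL : 0 < L) (h : L2 (Ioo 0 L))
    (h0 : ∫ x in Ioo 0 L, h x = 0) : ∃ z ∈ H10 (Ioo 0 L), H1.sndL (Ioo 0 L) z = h := by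
  obtain ⟨C, hC⟩ := H1.exists_poincare hL
  set K := (H1.testSubmodule (Ioo 0 L)).topologicalClosure with hK
  set R := K.map (H1.sndL (Ioo 0 L) : H1 (Ioo 0 L) →ₗ[ℝ] L2 (Ioo 0 L)) with hR
  have hKc : IsClosed (K : Set (H1 (Ioo 0 L))) := Submodule.isClosed_topologicalClosure _
  have : CompleteSpace K := hKc.completeSpace_coe
  have hRc : IsClosed (R : Set (L2 (Ioo 0 L))) := by
    let f : K →L[ℝ] L2 (Ioo 0 L) := (H1.sndL (Ioo 0 L)).comp K.subtypeL
    have hf : AntilipschitzWith C f := f.antilipschitz_of_bound fun z => hC z z.2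
    have := hf.isClosed_range f.uniformContinuous
    convert this using 1
    ext y
    simp [hR, f]
  have hmem : h ∈ R := by
    rw [← hRc.submodule_topologicalClosure_eq, ← Submodule.orthogonal_orthogonal_eq_closure,
      Submodule.mem_orthogonal]
    intro k hk
    rw [Submodule.mem_orthogonal] at hk
    obtain ⟨c, hc⟩ := exists_const_of_integral_mul_deriv_eq_zero hL
      (integrableOn_Ioo subset_rfl k) (fun φ hφ => by
        have := hk (H1.sndL _ (H1.ofTest hφ)) ⟨_, subset_closure
          ⟨φ, hφ, H1.fn_ofTest hφ⟩, rfl⟩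
        rw [← inner_toLp (hφ.memLp_deriv 2 _)]
        exact this)
    rw [L2.inner_def]
    have : ∫ x in Ioo 0 L, ⟪k x, h x⟫_ℝ = ∫ x in Ioo 0 L, c * h x :=
      integral_congr_ae (hc.mono fun x hx => by simp [hx, mul_comm])
    rw [this, integral_const_mul, h0, mul_zero]
  obtain ⟨z, hz, rfl⟩ := hmem
  exact ⟨z, hz, rfl⟩

/-- Every square-integrable function with the right mean is the derivative of a competitor. -/
theorem HasBoundaryDatum.exists_weakDeriv_eq {L : ℝ} (hL : 0 < L) {w : H1 univ}
    {u : H1 (Ioo 0 L)} (hu : HasBoundaryDatum L w u) {g : ℝ → ℝ}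
    (hg : MemLp g 2 (volume.restrict (Ioo 0 L)))
    (hgw : ∫ x in Ioo 0 L, g x = H1.jump L univ w) :
    ∃ v, HasBoundaryDatum L w v ∧ H1.weakDeriv v =ᵐ[volume.restrict (Ioo 0 L)] g := by
  obtain ⟨c, hc⟩ := H1.exists_hasTrace hL MeasurableSet.univ (subset_univ (Ioo 0 L)) w
  have hj := (hu.trace_eq hL hc).2
  have hsub := Lp.coeFn_sub (hg.toLp g) (H1.sndL _ u)
  -- The correction `g - u'` has mean zero because both terms integrate to the elongation of `w`.
  obtain ⟨z, hz, hzg⟩ := exists_mem_H10_of_integral_eq_zero hL (hg.toLp g - H1.sndL _ u) (by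
    rw [integral_congr_ae hsub]
    simp only [Pi.sub_apply]
    rw [integral_sub (integrableOn_Ioo subset_rfl _) (integrableOn_Ioo subset_rfl _),
      integral_congr_ae hg.coeFn_toLp, hgw, ← hj, H1.jump_apply subset_rfl, H1.weakDeriv_eq,
      sub_self])
  obtain ⟨z0, hz0, huz⟩ := hu
  refine ⟨u + z, ⟨z0 + z, ?_, ?_⟩, ?_⟩
  · rw [H10_eq] at *
    exact Submodule.add_mem _ hz0 hz
  · rw [H1.fn_eq, H1.fn_eq (z0 + z), map_add, map_add]
    filter_upwards [Lp.coeFn_add (H1.fstL _ u) (H1.fstL _ z),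
      Lp.coeFn_add (H1.fstL _ z0) (H1.fstL _ z), huz] with x h1 h2 h3
    rw [h1, h2, Pi.add_apply, Pi.add_apply, ← H1.fn_eq, h3, ← H1.fn_eq z0]
    ring
  · rw [H1.weakDeriv_eq, map_add, hzg, add_sub_cancel]
    exact hg.coeFn_toLp


/-! ### Absolutely continuous curves -/

/-- Reduces every absolute continuity claim to a bound on increments by those of two known curves.
-/
theorem absolutelyContinuousOnInterval_of_dist_le {X Y Z : Type*} [PseudoMetricSpace X]
    [PseudoMetricSpace Y] [PseudoMetricSpace Z] {F : ℝ → X} {G : ℝ → Y} {H : ℝ → Z} {a b : ℝ}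
    (hG : AbsolutelyContinuousOnInterval G a b) (hH : AbsolutelyContinuousOnInterval H a b)
    (C : ℝ) (h : ∀ s ∈ uIcc a b, ∀ t ∈ uIcc a b,
      dist (F s) (F t) ≤ C * (dist (G s) (G t) + dist (H s) (H t))) :
    AbsolutelyContinuousOnInterval F a b := by
  have h1 : Tendsto (fun E : ℕ × (ℕ → ℝ × ℝ) =>
      C * (∑ i ∈ Finset.range E.1, dist (G (E.2 i).1) (G (E.2 i).2)
        + ∑ i ∈ Finset.range E.1, dist (H (E.2 i).1) (H (E.2 i).2)))
      (AbsolutelyContinuousOnInterval.totalLengthFilter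
        ⊓ 𝓟 (AbsolutelyContinuousOnInterval.disjWithin a b)) (𝓝 0) := by
    simpa using (Tendsto.add hG hH).const_mul C
  refine squeeze_zero' (Eventually.of_forall fun E => Finset.sum_nonneg fun _ _ => dist_nonneg)
    ?_ h1
  refine eventually_inf_principal.2 (Eventually.of_forall fun E hE => ?_)
  rw [← Finset.sum_add_distrib, Finset.mul_sum]
  exact Finset.sum_le_sum fun i hi => h _ (hE.1 i hi).1 _ (hE.1 i hi).2

theorem absolutelyContinuousOnInterval_clm {E F : Type*} [NormedAddCommGroup E] [NormedSpace ℝ E]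
    [NormedAddCommGroup F] [NormedSpace ℝ F] {w : ℝ → E} {a b : ℝ}
    (hw : AbsolutelyContinuousOnInterval w a b) (f : E →L[ℝ] F) :
    AbsolutelyContinuousOnInterval (fun t => f (w t)) a b := by
  refine absolutelyContinuousOnInterval_of_dist_le hw hw ‖f‖ fun s _ t _ => ?_
  have h1 : dist (f (w s)) (f (w t)) ≤ ‖f‖ * dist (w s) (w t) := by
    rw [dist_eq_norm, dist_eq_norm, ← map_sub]; exact f.le_opNorm _
  have h2 : 0 ≤ ‖f‖ * dist (w s) (w t) := by positivity
  linarith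

/-- A curve that is absolutely continuous has bounded difference quotients almost everywhere. -/
theorem ae_eventually_norm_slope_le {E : Type*} [NormedAddCommGroup E] [NormedSpace ℝ E]
    {w : ℝ → E} {a b : ℝ} (hab : a ≤ b) (hw : AbsolutelyContinuousOnInterval w a b) :
    ∀ᵐ s, s ∈ Ioo a b → ∃ M : ℝ, ∀ᶠ r in 𝓝[≠] s, ‖(r - s)⁻¹ • (w r - w s)‖ ≤ M := by
  have hbv := hw.boundedVariationOn
  rw [uIcc_of_le hab] at hbv
  have hlb := hbv.locallyBoundedVariationOn
  have ha : a ∈ Icc a b := left_mem_Icc.2 hab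
  have hmono := variationOnFromTo.monotoneOn hlb ha
  -- The variation function is monotone, hence differentiable almost everywhere, and its increments
  -- dominate those of `w`.
  have hd := hmono.ae_differentiableWithinAt_of_mem
  filter_upwards [hd] with s hs hsI
  have hn : Icc a b ∈ 𝓝 s := Icc_mem_nhds hsI.1 hsI.2
  have hda := ((hs (Ioo_subset_Icc_self hsI)).differentiableAt hn).hasDerivAt
  set V := variationOnFromTo w (Icc a b) a
  have ht := (hasDerivAt_iff_tendsto_slope.1 hda).norm
  refine ⟨‖deriv V s‖ + 1, ?_⟩
  filter_upwards [ht.eventually (gt_mem_nhds (lt_add_one _)),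
    nhdsWithin_le_nhds hn, self_mem_nhdsWithin] with r h1 h2 h3
  refine le_trans ?_ h1.le
  rw [slope_def_module, norm_smul, norm_smul]
  refine mul_le_mul_of_nonneg_left ?_ (norm_nonneg _)
  have key {x y : ℝ} (hx : x ∈ Icc a b) (hy : y ∈ Icc a b) (hxy : x ≤ y) :
      dist (w x) (w y) ≤ ‖V y - V x‖ := by
    have h4 := variationOnFromTo.add hlb ha hx hy
    have h5 : V y - V x = variationOnFromTo w (Icc a b) x y := by simp only [V]; linarith
    rw [h5, variationOnFromTo.eq_of_le _ _ hxy, Real.norm_of_nonneg ENNReal.toReal_nonneg,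
      dist_edist]
    exact ENNReal.toReal_mono (hlb x y hx hy) (eVariationOn.edist_le w ⟨hx, left_mem_Icc.2 hxy⟩
      ⟨hy, right_mem_Icc.2 hxy⟩)
  rcases le_total r s with h | h
  · have := key h2 (Ioo_subset_Icc_self hsI) h
    rwa [dist_eq_norm, norm_sub_rev (V s)] at this
  · have := key (Ioo_subset_Icc_self hsI) h2 h
    rwa [dist_comm, dist_eq_norm] at this

/-- A bounded family that converges weakly against a dense set converges weakly. -/
theorem exists_weak_limit {ι E : Type*} [NormedAddCommGroup E] [InnerProductSpace ℝ E]
    [CompleteSpace E] {l : Filter ι} [l.NeBot] {q : ι → E} {M : ℝ} (hM : ∀ᶠ i in l, ‖q i‖ ≤ M)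
    {S : Set E} (hS : Dense S) (h : ∀ ψ ∈ S, ∃ y, Tendsto (fun i => ⟪ψ, q i⟫_ℝ) l (𝓝 y)) :
    ∃ g, ∀ ψ, Tendsto (fun i => ⟪ψ, q i⟫_ℝ) l (𝓝 ⟪ψ, g⟫_ℝ) := by
  have hM0 : 0 ≤ M := by
    obtain ⟨i, hi⟩ := hM.exists
    exact (norm_nonneg _).trans hi
  have hall : ∀ ψ, ∃ y, Tendsto (fun i => ⟪ψ, q i⟫_ℝ) l (𝓝 y) := by
    intro ψ
    rw [← cauchy_map_iff_exists_tendsto, Metric.cauchy_iff]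
    refine ⟨inferInstance, fun δ hδ => ?_⟩
    -- Replacing `ψ` by `χ` costs at most `M ‖ψ - χ‖ ≤ δ / 4` uniformly along the filter, so the
    -- pairings with `ψ` are Cauchy.
    obtain ⟨χ, hχS, hχ⟩ := Metric.mem_closure_iff.1 (hS ψ) (δ / (4 * (M + 1))) (by positivity)
    obtain ⟨y, hy⟩ := h χ hχS
    refine ⟨_, image_mem_map (inter_mem hM (hy (Metric.ball_mem_nhds y
      (show (0 : ℝ) < δ / 4 by positivity)))), ?_⟩
    have hb : ∀ i, ‖q i‖ ≤ M → dist ⟪χ, q i⟫_ℝ y < δ / 4 → dist ⟪ψ, q i⟫_ℝ y < δ / 2 := by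
      intro i h1 h2
      have h3 : dist ⟪ψ, q i⟫_ℝ ⟪χ, q i⟫_ℝ ≤ δ / 4 := by
        rw [dist_eq_norm, ← inner_sub_left]
        refine (norm_inner_le_norm _ _).trans ?_
        rw [dist_eq_norm] at hχ
        calc ‖ψ - χ‖ * ‖q i‖ ≤ (δ / (4 * (M + 1))) * (M + 1) := by
              gcongr; linarith
          _ = δ / 4 := by field_simp
      linarith [dist_triangle ⟪ψ, q i⟫_ℝ ⟪χ, q i⟫_ℝ y]
    rintro _ ⟨i, ⟨h1, h2⟩, rfl⟩ _ ⟨j, ⟨h3, h4⟩, rfl⟩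
    have := dist_triangle_right ⟪ψ, q i⟫_ℝ ⟪ψ, q j⟫_ℝ y
    linarith [hb i h1 h2, hb j h3 h4]
  choose Λ hΛ using hall
  let f : E →ₗ[ℝ] ℝ :=
    { toFun := Λ
      map_add' := fun x y => tendsto_nhds_unique (hΛ (x + y)) (by
        simpa only [inner_add_left] using (hΛ x).add (hΛ y))
      map_smul' := fun c x => tendsto_nhds_unique (hΛ (c • x)) (by
        simpa only [real_inner_smul_left, RingHom.id_apply, smul_eq_mul] using (hΛ x).const_mul c) }
  -- The limiting pairing is a functional of norm at most `M`; Riesz represents it by the weak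
  -- limit.
  let f' : E →L[ℝ] ℝ := f.mkContinuous M fun x => by
    refine le_of_tendsto (hΛ x).norm (hM.mono fun i hi => ?_)
    rw [mul_comm]
    exact (norm_inner_le_norm _ _).trans (mul_le_mul_of_nonneg_left hi (norm_nonneg _))
  refine ⟨(InnerProductSpace.toDual ℝ E).symm f', fun ψ => ?_⟩
  rw [real_inner_comm, InnerProductSpace.toDual_symm_apply]
  exact hΛ ψ

/-- Pairings with a countable dense family are differentiable off a common null set; bounded
difference quotients extend the convergence to all `ψ`. -/
theorem ae_exists_weak_derivative {E : Type*} [NormedAddCommGroup E] [InnerProductSpace ℝ E]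
    [CompleteSpace E] [TopologicalSpace.SeparableSpace E] {w : ℝ → E} {a b : ℝ} (hab : a ≤ b)
    (hw : AbsolutelyContinuousOnInterval w a b) :
    ∀ᵐ s, s ∈ Ioo a b → ∃ g, ∀ ψ : E,
      Tendsto (fun r => ⟪ψ, (r - s)⁻¹ • (w r - w s)⟫_ℝ) (𝓝[≠] s) (𝓝 ⟪ψ, g⟫_ℝ) := by
  have h2 : ∀ᵐ s, ∀ k : ℕ, s ∈ uIcc a b →
      DifferentiableAt ℝ (fun t => ⟪TopologicalSpace.denseSeq E k, w t⟫_ℝ) s :=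
    ae_all_iff.2 fun k => (absolutelyContinuousOnInterval_clm hw
      (innerSL ℝ (TopologicalSpace.denseSeq E k))).ae_differentiableAt
  filter_upwards [ae_eventually_norm_slope_le hab hw, h2] with s h1 h2 hs
  obtain ⟨M, hM⟩ := h1 hs
  refine exists_weak_limit hM (TopologicalSpace.denseRange_denseSeq E) ?_
  rintro _ ⟨k, rfl⟩
  have h3 := (h2 k (by rw [uIcc_of_le hab]; exact Ioo_subset_Icc_self hs)).hasDerivAt
  rw [hasDerivAt_iff_tendsto_slope] at h3
  refine ⟨_, h3.congr fun r => ?_⟩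
  rw [slope_def_module, ← inner_sub_right, real_inner_smul_right, smul_eq_mul]

instance instSeparableSpaceH1 (Ω : Set ℝ) : TopologicalSpace.SeparableSpace (H1 Ω) := by
  have : Fact ((2 : ℝ≥0∞) ≠ ⊤) := ⟨by norm_num⟩
  have : SecondCountableTopology (L2 Ω) := Lp.SecondCountableTopology
  have h : SecondCountableTopology (WithLp 2 (L2 Ω × L2 Ω)) :=
    (WithLp.homeomorphProd 2 (L2 Ω) (L2 Ω)).secondCountableTopology
  have : SecondCountableTopology (H1 Ω) := TopologicalSpace.Subtype.secondCountableTopology _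
  infer_instance

/-- A continuous functional of an absolutely continuous curve `w` in `H¹(ℝ)` has derivative given
by the time derivative of `w`. -/
theorem ae_hasDerivAt_clm_timeDeriv {T : ℝ} (hT : 0 ≤ T) {w : ℝ → H1 univ}
    (hw : AbsolutelyContinuousOnInterval w 0 T) (f : H1 univ →L[ℝ] ℝ) :
    ∀ᵐ s, s ∈ Ioo 0 T → HasDerivAt (fun t => f (w t)) (f (timeDeriv w s)) s := by
  filter_upwards [ae_exists_weak_derivative hT hw] with s h hs
  have hg : IsTimeDeriv w s (timeDeriv w s) := by
    have : ∃ g, IsTimeDeriv w s g := h hs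
    rw [timeDeriv, dif_pos this]
    exact this.choose_spec
  have h1 := hg ((InnerProductSpace.toDual ℝ (H1 univ)).symm f)
  simp only [InnerProductSpace.toDual_symm_apply] at h1
  rw [hasDerivAt_iff_tendsto_slope]
  refine h1.congr fun r => ?_
  rw [slope_def_module, map_smul, map_sub]


/-! ### One-sided minimal states -/

/-- A state satisfying the Dirichlet condition and the one-sided minimality condition. -/
structure IsOneSidedMinimal (L κ a₀ a₁ : ℝ) (w : H1 univ) (ε : ℝ) (Θ : ℝ → ℝ)
    (u : H1 (Ioo (0 : ℝ) L)) : Prop where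
  volumeFraction : IsVolumeFraction L Θ
  dirichlet : HasBoundaryDatum L w u
  minimal : ∀ (v : H1 (Ioo (0 : ℝ) L)) (θ : ℝ → ℝ),
    HasBoundaryDatum L w v → IsVolumeFraction L θ →
    1 / 2 * (∫ x in Ioo 0 L, stiffness a₀ a₁ ε (Θ x) * H1.weakDeriv u x ^ 2)
      ≤ 1 / 2 * (∫ x in Ioo 0 L, ε * a₀ * stiffness a₀ a₁ ε (Θ x)
            / (θ x * stiffness a₀ a₁ ε (Θ x) + (1 - θ x) * (ε * a₀)) * H1.weakDeriv v x ^ 2)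
        + κ / ε * ∫ x in Ioo 0 L, θ x * Θ x

theorem IsDamageEvolution.isOneSidedMinimal {L T κ a₀ a₁ : ℝ} {w : ℝ → H1 univ} {ε : ℝ}
    {Θ : ℝ → ℝ → ℝ} {u : ℝ → H1 (Ioo (0 : ℝ) L)} (h : IsDamageEvolution L T κ a₀ a₁ w ε Θ u)
    {t : ℝ} (ht : t ∈ Icc 0 T) : IsOneSidedMinimal L κ a₀ a₁ (w t) ε (Θ t) (u t) :=
  ⟨h.volumeFraction t ht, h.dirichlet t ht, h.one_sided_minimality t ht⟩

/-- The difference between the compliances of the damaged and of the sound phase. -/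
noncomputable def complianceGap (a₀ a₁ ε : ℝ) : ℝ := 1 / (ε * a₀) - 1 / a₁

theorem complianceGap_pos {a₀ a₁ ε : ℝ} (h0 : 0 < ε * a₀) (h1 : ε * a₀ < a₁) :
    0 < complianceGap a₀ a₁ ε :=
  sub_pos.2 (one_div_lt_one_div_of_lt h0 h1)

/-- The compliance is affine in the volume fraction; this is why the whole state is governed by `∫
(1 - Θ)`. -/
theorem inv_stiffness (a₀ a₁ ε θ : ℝ) :
    (stiffness a₀ a₁ ε θ)⁻¹ = complianceGap a₀ a₁ ε * (1 - θ) + 1 / a₁ := by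
  rw [stiffness, inv_inv, complianceGap]
  ring

/-- The total compliance `∫ 1 / a`. -/
noncomputable def compliance (L a₀ a₁ ε : ℝ) (Θ : ℝ → ℝ) : ℝ :=
  complianceGap a₀ a₁ ε * (∫ x in Ioo 0 L, (1 - Θ x)) + L / a₁

theorem IsVolumeFraction.integrable {L : ℝ} {Θ : ℝ → ℝ} (h : IsVolumeFraction L Θ) :
    IntegrableOn Θ (Ioo 0 L) :=
  Integrable.of_bound h.1.aestronglyMeasurable 1 (h.2.mono fun x hx => by
    rw [Real.norm_eq_abs, abs_of_nonneg hx.1]; exact hx.2)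

theorem IsVolumeFraction.integral_one_sub_nonneg {L : ℝ} {Θ : ℝ → ℝ} (h : IsVolumeFraction L Θ) :
    0 ≤ ∫ x in Ioo 0 L, (1 - Θ x) :=
  integral_nonneg_of_ae (h.2.mono fun _ hx => sub_nonneg.2 hx.2)

theorem IsVolumeFraction.integral_one_sub {L : ℝ} (hL : 0 < L) {Θ : ℝ → ℝ}
    (h : IsVolumeFraction L Θ) :
    ∫ x in Ioo 0 L, (1 - Θ x) = L - ∫ x in Ioo 0 L, Θ x := by
  rw [integral_sub (integrable_const _) h.integrable]
  simp [hL.le]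

theorem div_le_compliance {L a₀ a₁ ε : ℝ} (h0 : 0 < ε * a₀) (h1 : ε * a₀ < a₁)
    {Θ : ℝ → ℝ} (h : IsVolumeFraction L Θ) : L / a₁ ≤ compliance L a₀ a₁ ε Θ :=
  le_add_of_nonneg_left (mul_nonneg (complianceGap_pos h0 h1).le h.integral_one_sub_nonneg)

theorem compliance_pos {L a₀ a₁ ε : ℝ} (hL : 0 < L) (h0 : 0 < ε * a₀) (h1 : ε * a₀ < a₁)
    {Θ : ℝ → ℝ} (h : IsVolumeFraction L Θ) : 0 < compliance L a₀ a₁ ε Θ :=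
  (div_pos hL (h0.trans h1)).trans_le (div_le_compliance h0 h1 h)

/-- Damaging a further fraction `δ` of the remaining sound phase adds `δ k θ` to the pointwise
compliance, `k` being `complianceGap`. -/
theorem mixture_eq {a₀ a₁ ε θ δ : ℝ} (h0 : 0 < ε * a₀) (h1 : ε * a₀ < a₁) (hθ : θ ∈ Icc (0 : ℝ) 1) :
    ε * a₀ * stiffness a₀ a₁ ε θ / (δ * stiffness a₀ a₁ ε θ + (1 - δ) * (ε * a₀))
      = (complianceGap a₀ a₁ ε * (1 - θ) + 1 / a₁ + δ * (complianceGap a₀ a₁ ε * θ))⁻¹ := by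
  have hk := complianceGap_pos h0 h1
  have ha₁ := h0.trans h1
  have hs : 0 < complianceGap a₀ a₁ ε * (1 - θ) + 1 / a₁ :=
    add_pos_of_nonneg_of_pos (mul_nonneg hk.le (sub_nonneg.2 hθ.2)) (by positivity)
  set s := complianceGap a₀ a₁ ε * (1 - θ) + 1 / a₁ with hsdef
  have hst : stiffness a₀ a₁ ε θ = s⁻¹ := by rw [← inv_inv (stiffness a₀ a₁ ε θ), inv_stiffness]
  have e : s + δ * (complianceGap a₀ a₁ ε * θ) = (δ + (1 - δ) * (ε * a₀) * s) / (ε * a₀) := by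
    rw [eq_div_iff h0.ne']
    have : complianceGap a₀ a₁ ε * θ = 1 / (ε * a₀) - s := by
      rw [hsdef, complianceGap]; ring
    rw [this]
    generalize ε * a₀ = m at *
    field_simp
    ring
  have e2 : δ * s⁻¹ + (1 - δ) * (ε * a₀) = (δ + (1 - δ) * (ε * a₀) * s) * s⁻¹ := by
    field_simp
  rw [hst, e, inv_div, e2, mul_div_mul_right _ _ (inv_ne_zero hs.ne')]

/-! ### Consequences of one-sided minimality -/

namespace IsOneSidedMinimal

variable {L κ a₀ a₁ : ℝ} {w : H1 univ} {ε : ℝ} {Θ : ℝ → ℝ} {u : H1 (Ioo (0 : ℝ) L)}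

/-- The competitor uses `θ = δ` and the strain that makes the stress of the mixture constant, which
is the optimal one: its elastic energy is half the squared elongation over the total compliance. -/
theorem integral_energy_le (h : IsOneSidedMinimal L κ a₀ a₁ w ε Θ u) (hL : 0 < L)
    (h0 : 0 < ε * a₀) (h1 : ε * a₀ < a₁) {δ : ℝ} (hδ : δ ∈ Icc (0 : ℝ) 1) :
    1 / 2 * (∫ x in Ioo 0 L, stiffness a₀ a₁ ε (Θ x) * H1.weakDeriv u x ^ 2)
      ≤ 1 / 2 * (H1.jump L univ w ^ 2
          / (compliance L a₀ a₁ ε Θ + δ * (complianceGap a₀ a₁ ε * ∫ x in Ioo 0 L, Θ x)))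
        + κ / ε * (δ * ∫ x in Ioo 0 L, Θ x) := by
  have hk := complianceGap_pos h0 h1
  have ha₁ := h0.trans h1
  set k := complianceGap a₀ a₁ ε with hkdef
  set r : ℝ → ℝ := fun x => k * (1 - Θ x) + 1 / a₁ + δ * (k * Θ x) with hr
  have hrb : ∀ᵐ x ∂volume.restrict (Ioo 0 L), 0 < r x ∧ r x ≤ k + 1 / a₁ := by
    filter_upwards [h.volumeFraction.2] with x hx
    have hp : 0 < 1 / a₁ := by positivity
    have h2 : 0 ≤ k * (1 - Θ x) := mul_nonneg hk.le (sub_nonneg.2 hx.2)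
    have h3 : 0 ≤ k * Θ x := mul_nonneg hk.le hx.1
    have h4 : 0 ≤ δ * (k * Θ x) := mul_nonneg hδ.1 h3
    have h5 : δ * (k * Θ x) ≤ k * Θ x := mul_le_of_le_one_left h3 hδ.2
    simp only [hr]
    constructor <;> linarith
  have hΘi := h.volumeFraction.integrable
  have h1Θ : Integrable (fun x => 1 - Θ x) (volume.restrict (Ioo 0 L)) :=
    (integrable_const 1).sub hΘi
  have hri : Integrable r (volume.restrict (Ioo 0 L)) :=
    ((h1Θ.const_mul k).add (integrable_const _)).add ((hΘi.const_mul k).const_mul δ)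
  have hrint : ∫ x in Ioo 0 L, r x
      = compliance L a₀ a₁ ε Θ + δ * (k * ∫ x in Ioo 0 L, Θ x) := by
    simp only [hr]
    have hs : Integrable (fun x => k * (1 - Θ x) + 1 / a₁) (volume.restrict (Ioo 0 L)) :=
      (h1Θ.const_mul k).add (integrable_const _)
    rw [integral_add hs ((hΘi.const_mul k).const_mul δ),
      integral_add (h1Θ.const_mul k) (integrable_const _), integral_const_mul, integral_const_mul,
      integral_const_mul, compliance, ← hkdef]
    simp [hL.le, div_eq_mul_inv]
  have hM : 0 ≤ ∫ x in Ioo 0 L, Θ x :=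
    integral_nonneg_of_ae (h.volumeFraction.2.mono fun _ hx => hx.1)
  have hD : 0 < compliance L a₀ a₁ ε Θ + δ * (k * ∫ x in Ioo 0 L, Θ x) :=
    add_pos_of_pos_of_nonneg (compliance_pos hL h0 h1 h.volumeFraction)
      (mul_nonneg hδ.1 (mul_nonneg hk.le hM))
  rw [← hrint] at hD ⊢
  set R := ∫ x in Ioo 0 L, r x with hR
  set Δ := H1.jump L univ w with hΔ
  -- `r` is the compliance of the mixture and `R` its integral, so this strain has stress `Δ / R`
  -- and total elongation `Δ`.
  have hg : MemLp (fun x => Δ / R * r x) 2 (volume.restrict (Ioo 0 L)) :=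
    (MemLp.of_bound hri.aestronglyMeasurable (k + 1 / a₁) (hrb.mono fun x hx => by
      rw [Real.norm_eq_abs, abs_of_pos hx.1]; exact hx.2)).const_mul _
  obtain ⟨v, hv, hvg⟩ := h.dirichlet.exists_weakDeriv_eq hL hg (by
    rw [integral_const_mul, ← hR, div_mul_cancel₀ _ hD.ne'])
  have hmin := h.minimal v (fun _ => δ) hv ⟨aemeasurable_const, ae_of_all _ fun _ => hδ⟩
  have e : ∫ x in Ioo 0 L, ε * a₀ * stiffness a₀ a₁ ε (Θ x)
      / (δ * stiffness a₀ a₁ ε (Θ x) + (1 - δ) * (ε * a₀)) * H1.weakDeriv v x ^ 2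
      = Δ ^ 2 / R := by
    have : ∫ x in Ioo 0 L, (Δ / R) ^ 2 * r x = Δ ^ 2 / R := by
      rw [integral_const_mul, ← hR]
      field_simp
    rw [← this]
    refine integral_congr_ae ?_
    filter_upwards [hrb, hvg, h.volumeFraction.2] with x hx1 hx2 hx3
    rw [hx2, mixture_eq h0 h1 hx3, ← hkdef]
    change (r x)⁻¹ * (Δ / R * r x) ^ 2 = (Δ / R) ^ 2 * r x
    have := hx1.1.ne'
    field_simp
  rw [e, integral_const_mul] at hmin
  exact hmin

/-- With `δ = 0` the energy of `u` is at most `Δ² / (2 D)`, whereas completing the square shows that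
the excess over this value is a weighted `L²` distance to the claimed strain. -/
theorem weakDeriv_eq (h : IsOneSidedMinimal L κ a₀ a₁ w ε Θ u) (hL : 0 < L)
    (h0 : 0 < ε * a₀) (h1 : ε * a₀ < a₁) :
    ∀ᵐ x ∂volume.restrict (Ioo 0 L), H1.weakDeriv u x
      = H1.jump L univ w / compliance L a₀ a₁ ε Θ
        * (complianceGap a₀ a₁ ε * (1 - Θ x) + 1 / a₁) := by
  have hle := h.integral_energy_le hL h0 h1 (δ := 0) ⟨le_rfl, zero_le_one⟩
  simp only [zero_mul, add_zero, mul_zero] at hle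
  have hk := complianceGap_pos h0 h1
  have ha₁ := h0.trans h1
  have hD := compliance_pos hL h0 h1 h.volumeFraction
  obtain ⟨c, hc⟩ := H1.exists_hasTrace hL MeasurableSet.univ (subset_univ (Ioo 0 L)) w
  have hj := (h.dirichlet.trace_eq hL hc).2
  set k := complianceGap a₀ a₁ ε with hkdef
  set D := compliance L a₀ a₁ ε Θ with hDdef
  set Δ := H1.jump L univ w with hΔ
  set s : ℝ → ℝ := fun x => k * (1 - Θ x) + 1 / a₁ with hs
  have hpos : ∀ᵐ x ∂volume.restrict (Ioo 0 L), 1 / a₁ ≤ s x := by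
    filter_upwards [h.volumeFraction.2] with x hx
    exact le_add_of_nonneg_left (mul_nonneg hk.le (sub_nonneg.2 hx.2))
  have hp : 0 < 1 / a₁ := by positivity
  have hΘi := h.volumeFraction.integrable
  have h1Θ : Integrable (fun x => 1 - Θ x) (volume.restrict (Ioo 0 L)) :=
    (integrable_const 1).sub hΘi
  have hsi : Integrable s (volume.restrict (Ioo 0 L)) :=
    (h1Θ.const_mul k).add (integrable_const _)
  have hsint : ∫ x in Ioo 0 L, s x = D := by
    simp only [hs]
    rw [integral_add (h1Θ.const_mul k) (integrable_const _), integral_const_mul, hDdef, compliance,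
      ← hkdef]
    simp [hL.le, div_eq_mul_inv]
  have hst : ∀ x, stiffness a₀ a₁ ε (Θ x) = (s x)⁻¹ := fun x => by
    rw [← inv_inv (stiffness a₀ a₁ ε (Θ x)), inv_stiffness]
  have hui : Integrable (H1.weakDeriv u) (volume.restrict (Ioo 0 L)) :=
    H1.integrableOn_weakDeriv subset_rfl u
  have hu2 : Integrable (fun x => H1.weakDeriv u x ^ 2) (volume.restrict (Ioo 0 L)) :=
    (Lp.memLp (H1.sndL _ u)).integrable_sq
  have hau : Integrable (fun x => (s x)⁻¹ * H1.weakDeriv u x ^ 2) (volume.restrict (Ioo 0 L)) := by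
    refine hu2.bdd_mul hsi.aemeasurable.inv.aestronglyMeasurable (c := a₁) (hpos.mono fun x hx => ?_)
    rw [Real.norm_eq_abs, abs_of_pos (inv_pos.2 (hp.trans_le hx))]
    exact (inv_anti₀ hp hx).trans_eq (by rw [one_div, inv_inv])
  have hsq : ∀ᵐ x ∂volume.restrict (Ioo 0 L),
      (s x)⁻¹ * (H1.weakDeriv u x - Δ / D * s x) ^ 2
        = (s x)⁻¹ * H1.weakDeriv u x ^ 2 - 2 * (Δ / D) * H1.weakDeriv u x
          + (Δ / D) ^ 2 * s x := by
    filter_upwards [hpos] with x hx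
    have := (hp.trans_le hx).ne'
    field_simp
    ring
  have hnn : 0 ≤ᵐ[volume.restrict (Ioo 0 L)]
      fun x => (s x)⁻¹ * (H1.weakDeriv u x - Δ / D * s x) ^ 2 := by
    filter_upwards [hpos] with x hx
    exact mul_nonneg (inv_nonneg.2 (hp.trans_le hx).le) (sq_nonneg _)
  have hint : Integrable (fun x => (s x)⁻¹ * (H1.weakDeriv u x - Δ / D * s x) ^ 2)
      (volume.restrict (Ioo 0 L)) :=
    (((hau.sub (hui.const_mul _)).add (hsi.const_mul _)).congr (hsq.mono fun x hx => hx.symm))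
  have hzero : ∫ x in Ioo 0 L, (s x)⁻¹ * (H1.weakDeriv u x - Δ / D * s x) ^ 2 = 0 := by
    refine le_antisymm ?_ (integral_nonneg_of_ae hnn)
    have hd : Integrable (fun x => (s x)⁻¹ * H1.weakDeriv u x ^ 2
        - 2 * (Δ / D) * H1.weakDeriv u x) (volume.restrict (Ioo 0 L)) :=
      hau.sub (hui.const_mul _)
    rw [integral_congr_ae hsq, integral_add hd (hsi.const_mul _),
      integral_sub hau (hui.const_mul _), integral_const_mul, integral_const_mul, hsint,
      ← H1.jump_apply subset_rfl, hj]
    simp only [hst] at hle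
    have : -(2 * (Δ / D) * Δ) + (Δ / D) ^ 2 * D = - (Δ ^ 2 / D) := by field_simp; ring
    linarith
  filter_upwards [(integral_eq_zero_iff_of_nonneg_ae hnn hint).1 hzero, hpos] with x hx1 hx2
  have h3 : (s x)⁻¹ ≠ 0 := (inv_pos.2 (hp.trans_le hx2)).ne'
  have h4 : (H1.weakDeriv u x - Δ / D * s x) ^ 2 = 0 := (mul_eq_zero.1 hx1).resolve_left h3
  exact sub_eq_zero.1 (pow_eq_zero_iff two_ne_zero |>.1 h4)

/-- The stress is constant in space. -/
theorem stress_eq (h : IsOneSidedMinimal L κ a₀ a₁ w ε Θ u) (hL : 0 < L)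
    (h0 : 0 < ε * a₀) (h1 : ε * a₀ < a₁) :
    ∀ᵐ x ∂volume.restrict (Ioo 0 L), stiffness a₀ a₁ ε (Θ x) * H1.weakDeriv u x
      = H1.jump L univ w / compliance L a₀ a₁ ε Θ := by
  filter_upwards [h.weakDeriv_eq hL h0 h1, h.volumeFraction.2] with x hx hx2
  have hk := complianceGap_pos h0 h1
  have ha₁ := h0.trans h1
  have hs : 0 < complianceGap a₀ a₁ ε * (1 - Θ x) + 1 / a₁ :=
    add_pos_of_nonneg_of_pos (mul_nonneg hk.le (sub_nonneg.2 hx2.2)) (by positivity)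
  rw [hx, ← inv_inv (stiffness a₀ a₁ ε (Θ x)), inv_stiffness, mul_left_comm,
    inv_mul_cancel₀ hs.ne', mul_one]

theorem integral_energy_eq (h : IsOneSidedMinimal L κ a₀ a₁ w ε Θ u) (hL : 0 < L)
    (h0 : 0 < ε * a₀) (h1 : ε * a₀ < a₁) :
    ∫ x in Ioo 0 L, stiffness a₀ a₁ ε (Θ x) * H1.weakDeriv u x ^ 2
      = H1.jump L univ w ^ 2 / compliance L a₀ a₁ ε Θ := by
  obtain ⟨c, hc⟩ := H1.exists_hasTrace hL MeasurableSet.univ (subset_univ (Ioo 0 L)) w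
  have hj := (h.dirichlet.trace_eq hL hc).2
  have : ∫ x in Ioo 0 L, stiffness a₀ a₁ ε (Θ x) * H1.weakDeriv u x ^ 2
      = ∫ x in Ioo 0 L, H1.jump L univ w / compliance L a₀ a₁ ε Θ * H1.weakDeriv u x :=
    integral_congr_ae ((h.stress_eq hL h0 h1).mono fun x hx => by
      simp only [← hx]; ring)
  rw [this, integral_const_mul, ← H1.jump_apply subset_rfl, hj]
  ring

/-- Damage cost is rewritten in terms of compliance, so that the energy depends only on `Δ` and `D`.
-/
theorem energy_eq (h : IsOneSidedMinimal L κ a₀ a₁ w ε Θ u) (hL : 0 < L)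
    (h0 : 0 < ε * a₀) (h1 : ε * a₀ < a₁) :
    energy L κ a₀ a₁ ε Θ u = 1 / 2 * (H1.jump L univ w ^ 2 / compliance L a₀ a₁ ε Θ)
      + κ / (ε * complianceGap a₀ a₁ ε) * (compliance L a₀ a₁ ε Θ - L / a₁) := by
  have hk := (complianceGap_pos h0 h1).ne'
  rw [energy, h.integral_energy_eq hL h0 h1, compliance, add_sub_cancel_right]
  have : κ / (ε * complianceGap a₀ a₁ ε) * (complianceGap a₀ a₁ ε * ∫ x in Ioo 0 L, (1 - Θ x))
      = κ / ε * ∫ x in Ioo 0 L, (1 - Θ x) := by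
    rw [← mul_assoc, ← div_div, div_mul_cancel₀ _ hk]
  rw [this]

/-- The stress does not exceed the yield stress, unless the material is totally damaged. -/
theorem sq_jump_le (h : IsOneSidedMinimal L κ a₀ a₁ w ε Θ u) (hL : 0 < L)
    (h0 : 0 < ε * a₀) (h1 : ε * a₀ < a₁) (hM : 0 < ∫ x in Ioo 0 L, Θ x) :
    H1.jump L univ w ^ 2
      ≤ 2 * (κ / (ε * complianceGap a₀ a₁ ε)) * compliance L a₀ a₁ ε Θ ^ 2 := by
  have hk := complianceGap_pos h0 h1
  have hD := compliance_pos hL h0 h1 h.volumeFraction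
  have hε : ε ≠ 0 := fun h' => by simp [h'] at h0
  have hall : ∀ δ ∈ Ioo (0 : ℝ) 1, H1.jump L univ w ^ 2
      ≤ 2 * (κ / (ε * complianceGap a₀ a₁ ε)) * (compliance L a₀ a₁ ε Θ *
        (compliance L a₀ a₁ ε Θ + δ * (complianceGap a₀ a₁ ε * ∫ x in Ioo 0 L, Θ x))) := by
    intro δ hδ
    have hle := h.integral_energy_le hL h0 h1 (δ := δ) (Ioo_subset_Icc_self hδ)
    rw [h.integral_energy_eq hL h0 h1] at hle
    set k := complianceGap a₀ a₁ ε
    set D := compliance L a₀ a₁ ε Θ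
    set M := ∫ x in Ioo 0 L, Θ x
    set Δ := H1.jump L univ w
    have hδ0 := hδ.1
    have hD' : 0 < D + δ * (k * M) := by positivity
    -- The energy released and the damage cost share the factor `δ k M`, which is positive and can
    -- be cancelled before `δ → 0`.
    have e1 : 1 / 2 * (Δ ^ 2 / D) - 1 / 2 * (Δ ^ 2 / (D + δ * (k * M)))
        = δ * k * M * Δ ^ 2 / (2 * (D * (D + δ * (k * M)))) := by
      field_simp
      ring
    have e2 : κ / ε * (δ * M) = δ * k * M * (κ / (ε * k)) := by
      field_simp
    have h5 : δ * k * M * (Δ ^ 2 / (2 * (D * (D + δ * (k * M))))) ≤ δ * k * M * (κ / (ε * k)) := by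
      rw [← e2, ← mul_div_assoc, ← e1]; linarith
    have h6 := le_of_mul_le_mul_left h5 (by positivity)
    rw [div_le_iff₀ (by positivity)] at h6
    linarith
  have ht : Tendsto (fun δ : ℝ => 2 * (κ / (ε * complianceGap a₀ a₁ ε)) * (compliance L a₀ a₁ ε Θ *
        (compliance L a₀ a₁ ε Θ + δ * (complianceGap a₀ a₁ ε * ∫ x in Ioo 0 L, Θ x))))
      (𝓝[>] 0) (𝓝 (2 * (κ / (ε * complianceGap a₀ a₁ ε)) * (compliance L a₀ a₁ ε Θ *
        (compliance L a₀ a₁ ε Θ + 0 * (complianceGap a₀ a₁ ε * ∫ x in Ioo 0 L, Θ x))))) := by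
    refine Tendsto.mono_left (Continuous.tendsto ?_ 0) nhdsWithin_le_nhds
    fun_prop
  refine (ge_of_tendsto ht ?_).trans_eq (by ring)
  filter_upwards [Ioo_mem_nhdsGT (zero_lt_one (α := ℝ))] with δ hδ using hall δ hδ

end IsOneSidedMinimal


/-! ### Growth of the compliance along an evolution -/

/-- No derivative of `D` appears: monotonicity alone freezes `1 / D` at the ends of `[s, t]`. The
case `D t = D s` is a separate alternative because a totally damaged state may violate the yield
bound. -/
theorem compliance_growth_of_energy_balance {T f c : ℝ} {Δ D : ℝ → ℝ} (hT : 0 ≤ T)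
    (hΔ : AbsolutelyContinuousOnInterval Δ 0 T) (hD : MonotoneOn D (Icc 0 T))
    (hDpos : ∀ t ∈ Icc 0 T, 0 < D t)
    (hbal : ∀ t ∈ Icc 0 T, 1 / 2 * (Δ t ^ 2 / D t) + f * D t
      = c + ∫ q in (0 : ℝ)..t, Δ q / D q * deriv Δ q)
    {s t : ℝ} (hs : 0 ≤ s) (hst : s ≤ t) (ht : t ≤ T)
    (hy : Δ s ^ 2 ≤ 2 * f * D s ^ 2 ∨ D t = D s) :
    f * D s * (D t - D s) ≤ ∫ q in s..t, |Δ q * deriv Δ q| := by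
  have hsI : s ∈ Icc 0 T := ⟨hs, hst.trans ht⟩
  have htI : t ∈ Icc 0 T := ⟨hs.trans hst, ht⟩
  have h0I : (0 : ℝ) ∈ Icc 0 T := ⟨le_rfl, hT⟩
  have hv : 0 ≤ ∫ q in s..t, |Δ q * deriv Δ q| :=
    intervalIntegral.integral_nonneg hst fun _ _ => abs_nonneg _
  have hDs := hDpos s hsI
  have hDt := hDpos t htI
  rcases (hD hsI htI hst).eq_or_lt with he | hlt
  · rw [← he]; simpa using hv
  replace hy := hy.resolve_right hlt.ne'
  have hsubst : uIcc s t ⊆ uIcc 0 T := by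
    rw [uIcc_of_le hst, uIcc_of_le hT]; exact Icc_subset_Icc hs ht
  have hΔc : ContinuousOn Δ (uIcc 0 T) := hΔ.continuousOn
  have hφ : IntervalIntegrable (fun q => Δ q * deriv Δ q) volume 0 T :=
    hΔ.intervalIntegrable_deriv.continuousOn_mul hΔc
  have hg : IntervalIntegrable (fun q => Δ q / D q * deriv Δ q) volume 0 T := by
    rw [intervalIntegrable_iff_integrableOn_Icc_of_le hT] at hφ ⊢
    have hm : AEMeasurable (fun q => (D q)⁻¹) (volume.restrict (Icc 0 T)) :=
      (aemeasurable_restrict_of_monotoneOn measurableSet_Icc hD).inv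
    -- `D` is smallest at time `0`, which bounds `1 / D` on the whole interval.
    have := hφ.bdd_mul hm.aestronglyMeasurable (c := (D 0)⁻¹) (by
      filter_upwards [ae_restrict_mem measurableSet_Icc] with q hq
      rw [Real.norm_eq_abs, abs_of_pos (inv_pos.2 (hDpos q hq))]
      exact inv_anti₀ (hDpos 0 h0I) (hD h0I hq hq.1))
    exact this.congr (ae_of_all _ fun q => by simp only; ring)
  have hφ' := hφ.mono_set hsubst
  have hg' := hg.mono_set hsubst
  have hpow : ∫ q in s..t, Δ q * deriv Δ q = 1 / 2 * (Δ t ^ 2 - Δ s ^ 2) := by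
    have hΔ' := hΔ.mono hsubst
    have h1 := hΔ'.integral_deriv_mul_eq_sub hΔ'
    have h2 : ∫ q in s..t, (deriv Δ q * Δ q + Δ q * deriv Δ q)
        = 2 * ∫ q in s..t, Δ q * deriv Δ q := by
      rw [← intervalIntegral.integral_const_mul]
      exact intervalIntegral.integral_congr fun q _ => by ring
    rw [h2] at h1
    linarith
  have hdiff : 1 / 2 * (Δ t ^ 2 / D t) + f * D t - (1 / 2 * (Δ s ^ 2 / D s) + f * D s)
      = ∫ q in s..t, Δ q / D q * deriv Δ q := by
    have hsub {r : ℝ} (hr : r ∈ Icc 0 T) : uIcc 0 r ⊆ uIcc 0 T := by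
      rw [uIcc_of_le hr.1, uIcc_of_le hT]; exact Icc_subset_Icc le_rfl hr.2
    rw [hbal t htI, hbal s hsI, ← intervalIntegral.integral_interval_sub_left
      (hg.mono_set (hsub htI)) (hg.mono_set (hsub hsI))]
    ring
  -- Write `1 / D q = 1 / D t + (1 / D q - 1 / D t)`: the first part integrates exactly, the second
  -- lies in `[0, 1 / D s - 1 / D t]`.
  have hle : ∫ q in s..t, Δ q / D q * deriv Δ q
      ≤ ∫ q in s..t, ((D t)⁻¹ * (Δ q * deriv Δ q)
        + ((D s)⁻¹ - (D t)⁻¹) * |Δ q * deriv Δ q|) := by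
    refine intervalIntegral.integral_mono_on hst hg'
      ((hφ'.const_mul _).add (hφ'.abs.const_mul _)) fun q hq => ?_
    have hqI : q ∈ Icc 0 T := ⟨hs.trans hq.1, hq.2.trans ht⟩
    have h1 : (D t)⁻¹ ≤ (D q)⁻¹ := inv_anti₀ (hDpos q hqI) (hD hqI htI hq.2)
    have h2 : (D q)⁻¹ ≤ (D s)⁻¹ := inv_anti₀ hDs (hD hsI hqI hq.1)
    have h3 : ((D q)⁻¹ - (D t)⁻¹) * (Δ q * deriv Δ q)
        ≤ ((D s)⁻¹ - (D t)⁻¹) * |Δ q * deriv Δ q| :=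
      (mul_le_mul_of_nonneg_left (le_abs_self _) (sub_nonneg.2 h1)).trans
        (mul_le_mul_of_nonneg_right (by linarith) (abs_nonneg _))
    have h4 : Δ q / D q * deriv Δ q = (D t)⁻¹ * (Δ q * deriv Δ q)
        + ((D q)⁻¹ - (D t)⁻¹) * (Δ q * deriv Δ q) := by ring
    rw [h4]
    linarith
  rw [intervalIntegral.integral_add (hφ'.const_mul _) (hφ'.abs.const_mul _),
    intervalIntegral.integral_const_mul, intervalIntegral.integral_const_mul, hpow, ← hdiff] at hle
  set v := ∫ q in s..t, |Δ q * deriv Δ q|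
  -- The terms in `Δ t ^ 2` cancel.
  have h1 : f * (D t - D s) ≤ ((D s)⁻¹ - (D t)⁻¹) * (1 / 2 * Δ s ^ 2 + v) := by
    rw [div_eq_mul_inv (Δ t ^ 2), div_eq_mul_inv (Δ s ^ 2)] at hle
    linarith
  have h2 : (D s)⁻¹ - (D t)⁻¹ = (D t - D s) / (D s * D t) := by
    field_simp
  have hpos : 0 < D t - D s := sub_pos.2 hlt
  -- The common factor `D t - D s` drops out and leaves `f D s D t ≤ Δ s² / 2 + v`, to which the
  -- yield bound applies.
  rw [h2, div_mul_eq_mul_div, le_div_iff₀ (by positivity)] at h1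
  have h3 : f * (D s * D t) ≤ 1 / 2 * Δ s ^ 2 + v :=
    le_of_mul_le_mul_left (by linarith) hpos
  linarith

theorem IsDamageEvolution.compliance_growth {L T κ a₀ a₁ : ℝ} (hL : 0 < L) (hT : 0 ≤ T)
    {w : ℝ → H1 univ} (hw : AbsolutelyContinuousOnInterval w 0 T) {ε : ℝ}
    {Θ : ℝ → ℝ → ℝ} {u : ℝ → H1 (Ioo (0 : ℝ) L)} (h : IsDamageEvolution L T κ a₀ a₁ w ε Θ u)
    (h0 : 0 < ε * a₀) (h1 : ε * a₀ < a₁) {s t : ℝ} (hs : 0 ≤ s) (hst : s ≤ t) (ht : t ≤ T) :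
    κ / (ε * complianceGap a₀ a₁ ε) * compliance L a₀ a₁ ε (Θ s)
        * (compliance L a₀ a₁ ε (Θ t) - compliance L a₀ a₁ ε (Θ s))
      ≤ ∫ q in s..t, |H1.jump L univ (w q) * deriv (fun r => H1.jump L univ (w r)) q| := by
  have hk := complianceGap_pos h0 h1
  have hmono : MonotoneOn (fun t => compliance L a₀ a₁ ε (Θ t)) (Icc 0 T) := by
    intro s hs t ht hst
    refine add_le_add_left (mul_le_mul_of_nonneg_left ?_ hk.le) _
    refine integral_mono_ae ((integrable_const 1).sub (h.volumeFraction s hs).integrable)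
      ((integrable_const 1).sub (h.volumeFraction t ht).integrable) ?_
    filter_upwards [h.monotone_density s t hs.1 hst ht.2] with x hx
    linarith
  refine compliance_growth_of_energy_balance (Δ := fun t => H1.jump L univ (w t))
    (D := fun t => compliance L a₀ a₁ ε (Θ t)) (f := κ / (ε * complianceGap a₀ a₁ ε))
    (c := energy L κ a₀ a₁ ε (Θ 0) (u 0) + κ / (ε * complianceGap a₀ a₁ ε) * (L / a₁)) hT
    (absolutelyContinuousOnInterval_clm hw _) hmono
    (fun t ht => compliance_pos hL h0 h1 (h.volumeFraction t ht)) ?_ hs hst ht ?_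
  · intro t ht
    have hb := h.energy_balance t ht
    rw [(h.isOneSidedMinimal ht).energy_eq hL h0 h1] at hb
    have e : ∫ s in (0 : ℝ)..t, ∫ x in Ioo 0 L,
          stiffness a₀ a₁ ε (Θ s x) * H1.weakDeriv (u s) x * H1.weakDeriv (timeDeriv w s) x
        = ∫ q in (0 : ℝ)..t, H1.jump L univ (w q) / compliance L a₀ a₁ ε (Θ q)
          * deriv (fun r => H1.jump L univ (w r)) q := by
      refine intervalIntegral.integral_congr_ae ?_
      -- The derivative of the elongation is identified only on the open interval, so the point `T`
      -- is discarded.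
      filter_upwards [ae_hasDerivAt_clm_timeDeriv hT hw (H1.jump L univ),
        (measure_singleton T : volume {T} = 0) |> compl_mem_ae_iff.2] with q hq hqT hqI
      rw [uIoc_of_le ht.1] at hqI
      have hqI' : q ∈ Icc 0 T := ⟨hqI.1.le, hqI.2.trans ht.2⟩
      have hqT' : q < T := lt_of_le_of_ne hqI'.2 hqT
      rw [(hq ⟨hqI.1, hqT'⟩).deriv, H1.jump_apply (subset_univ _) (timeDeriv w q),
        ← integral_const_mul]
      refine integral_congr_ae ?_
      filter_upwards [(h.isOneSidedMinimal hqI').stress_eq hL h0 h1] with x hx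
      rw [hx]
    rw [e] at hb
    linarith
  · have hsI : s ∈ Icc 0 T := ⟨hs, hst.trans ht⟩
    have htI : t ∈ Icc 0 T := ⟨hs.trans hst, ht⟩
    have hnn : 0 ≤ᵐ[volume.restrict (Ioo 0 L)] Θ s :=
      (h.volumeFraction s hsI).2.mono fun _ hx => hx.1
    -- If no sound phase is left at time `s`, irreversibility freezes the compliance; otherwise the
    -- yield bound holds.
    rcases (integral_nonneg_of_ae hnn).eq_or_lt with hM | hM
    · right
      have hz := (integral_eq_zero_iff_of_nonneg_ae hnn (h.volumeFraction s hsI).integrable).1 hM.symm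
      have : ∀ᵐ x ∂volume.restrict (Ioo 0 L), 1 - Θ t x = 1 - Θ s x := by
        filter_upwards [hz, h.monotone_density s t hs hst ht, (h.volumeFraction t htI).2]
          with x h3 h4 h5
        simp only [Pi.zero_apply] at h3
        linarith [h5.1]
      simp only [compliance]
      rw [integral_congr_ae this]
    · left
      exact (h.isOneSidedMinimal hsI).sq_jump_le hL h0 h1 hM


/-! ### Measures: order, total variation, distribution functions -/

/-- Thickened indicators give the inequality on closed sets, and inner regularity extends it to
Borel sets. -/
theorem measure_le_of_forall_integral_le {X : Type*} [PseudoMetricSpace X] [MeasurableSpace X]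
    [BorelSpace X] {μ ν : Measure X} [IsFiniteMeasure μ] [IsFiniteMeasure ν]
    (h : ∀ φ : C(X, ℝ), (∀ x, 0 ≤ φ x) → ∫ x, φ x ∂μ ≤ ∫ x, φ x ∂ν) : μ ≤ ν := by
  have hcl : ∀ F : Set X, IsClosed F → μ F ≤ ν F := by
    intro F hF
    obtain ⟨δ, -, hδ, hδ0⟩ := exists_seq_strictAnti_tendsto (0 : ℝ)
    refine le_of_tendsto_of_tendsto' (tendsto_const_nhds)
      (tendsto_lintegral_thickenedIndicator_of_isClosed ν hF hδ hδ0) fun n => ?_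
    refine (measure_le_lintegral_thickenedIndicator μ hF.measurableSet (hδ n)).trans ?_
    have h1 := h ⟨fun x => (thickenedIndicator (hδ n) F x : ℝ), by fun_prop⟩
      fun x => NNReal.coe_nonneg _
    simp only [ContinuousMap.coe_mk] at h1
    rw [← BoundedContinuousFunction.toReal_lintegral_coe_eq_integral,
      ← BoundedContinuousFunction.toReal_lintegral_coe_eq_integral] at h1
    exact (ENNReal.toReal_le_toReal
      (BoundedContinuousFunction.lintegral_lt_top_of_nnreal μ _).ne
      (BoundedContinuousFunction.lintegral_lt_top_of_nnreal ν _).ne).1 h1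
  refine Measure.le_iff.2 fun A hA => ?_
  rw [hA.measure_eq_iSup_isClosed_of_ne_top (measure_ne_top μ A)]
  exact iSup₂_le fun F hF => iSup_le fun hFc => (hcl F hFc).trans (measure_mono hF)

theorem norm_smul_toSignedMeasure {X : Type*} [MeasurableSpace X] (c : ℝ) (μ : Measure X)
    [IsFiniteMeasure μ] : ‖c • μ.toSignedMeasure‖ = |c| * μ.real univ := by
  rw [norm_signedMeasure_def, SignedMeasure.totalVariation_eq_variation,
    VectorMeasure.variation_smul, Measure.variation_toSignedMeasure]
  simp [Measure.real]

/-- Split `c ν - d μ = c (ν - μ) + (c - d) μ`; as `ν - μ` is a positive measure, its norm is the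
difference of the masses. -/
theorem norm_smul_sub_smul_toSignedMeasure_le {X : Type*} [MeasurableSpace X] (c d : ℝ)
    {μ ν : Measure X} [IsFiniteMeasure μ] [IsFiniteMeasure ν] (h : μ ≤ ν) :
    ‖c • ν.toSignedMeasure - d • μ.toSignedMeasure‖
      ≤ |c| * (ν.real univ - μ.real univ) + |c - d| * μ.real univ := by
  have h1 : ν.toSignedMeasure = (ν - μ).toSignedMeasure + μ.toSignedMeasure := by
    rw [← Measure.toSignedMeasure_add]
    exact Measure.toSignedMeasure_congr (Measure.sub_add_cancel_of_le h).symm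
  have h2 : c • ν.toSignedMeasure - d • μ.toSignedMeasure
      = c • (ν - μ).toSignedMeasure + (c - d) • μ.toSignedMeasure := by
    rw [h1]; module
  have h3 : (ν - μ).real univ = ν.real univ - μ.real univ := by
    rw [measureReal_def, Measure.sub_apply MeasurableSet.univ h,
      ENNReal.toReal_sub_of_le (h univ) (measure_ne_top _ _)]
    rfl
  rw [h2, ← h3, ← norm_smul_toSignedMeasure, ← norm_smul_toSignedMeasure]
  exact norm_add_le _ _

instance instIsFiniteMeasureLebesgueOnIoo (L : ℝ) : IsFiniteMeasure (lebesgueOn (Ioo 0 L)) := by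
  refine ⟨?_⟩
  rw [lebesgueOn, comap_subtype_coe_apply measurableSet_Ioo, image_univ, Subtype.range_coe]
  simp

theorem lebesgueOn_Ioo_real_univ {L : ℝ} (hL : 0 < L) :
    (lebesgueOn (Ioo 0 L)).real univ = L := by
  rw [measureReal_def, lebesgueOn, comap_subtype_coe_apply measurableSet_Ioo, image_univ,
    Subtype.range_coe]
  simp [hL.le]

theorem integral_lebesgueOn_Ioo (L : ℝ) (g : ℝ → ℝ) :
    ∫ x, g x ∂lebesgueOn (Ioo (0 : ℝ) L) = ∫ x in Ioo 0 L, g x :=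
  integral_subtype_comap measurableSet_Ioo g

theorem integral_lebesgueOn_Icc (L : ℝ) (g : ℝ → ℝ) :
    ∫ x, g x ∂lebesgueOn (Icc (0 : ℝ) L) = ∫ x in Ioo 0 L, g x := by
  rw [lebesgueOn, integral_subtype_comap measurableSet_Icc g, integral_Icc_eq_integral_Ioo]

/-! ### Distribution functions -/

/-- The piecewise affine function equal to `1` on `(-∞, x]` and to `0` on `[x + h, ∞)`. -/
noncomputable def cutoff (x h y : ℝ) : ℝ := max 0 (min 1 ((x + h - y) / h))

theorem continuous_cutoff (x h : ℝ) : Continuous (cutoff x h) := by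
  unfold cutoff; fun_prop

theorem cutoff_nonneg (x h y : ℝ) : 0 ≤ cutoff x h y := le_max_left _ _

theorem cutoff_le_one (x h y : ℝ) : cutoff x h y ≤ 1 := max_le zero_le_one (min_le_left _ _)

theorem cutoff_of_le {x h y : ℝ} (hh : 0 < h) (hy : y ≤ x) : cutoff x h y = 1 := by
  have : 1 ≤ (x + h - y) / h := by rw [le_div_iff₀ hh]; linarith
  rw [cutoff, min_eq_left this, max_eq_right zero_le_one]

theorem cutoff_of_ge {x h y : ℝ} (hh : 0 < h) (hy : x + h ≤ y) : cutoff x h y = 0 :=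
  max_eq_left ((min_le_right _ _).trans (div_nonpos_of_nonpos_of_nonneg (by linarith) hh.le))

/-- The distribution function of a measure on `[0,L]`. -/
noncomputable def distribution {L : ℝ} (ρ : Measure (Icc (0 : ℝ) L)) (x : ℝ) : ℝ :=
  ρ.real {y | (y : ℝ) ≤ x}

theorem distribution_mono {L : ℝ} (ρ : Measure (Icc (0 : ℝ) L)) [IsFiniteMeasure ρ] :
    Monotone (distribution ρ) :=
  fun _ _ h => measureReal_mono fun _ hy => le_trans hy h

theorem distribution_nonneg {L : ℝ} (ρ : Measure (Icc (0 : ℝ) L)) (x : ℝ) :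
    0 ≤ distribution ρ x := measureReal_nonneg

theorem distribution_le {L : ℝ} (ρ : Measure (Icc (0 : ℝ) L)) [IsFiniteMeasure ρ] (x : ℝ) :
    distribution ρ x ≤ ρ.real univ := measureReal_mono (subset_univ _)

theorem measurableSet_coe_le (L x : ℝ) : MeasurableSet {y : Icc (0 : ℝ) L | (y : ℝ) ≤ x} :=
  measurableSet_le measurable_subtype_coe measurable_const

theorem measureReal_sub_mem_of_le {X : Type*} [MeasurableSpace X] {μ ν : Measure X}
    [IsFiniteMeasure μ] [IsFiniteMeasure ν] (h : μ ≤ ν) {A : Set X} (hA : MeasurableSet A) :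
    ν.real A - μ.real A ∈ Icc 0 (ν.real univ - μ.real univ) := by
  have h0 (B : Set X) : μ.real B ≤ ν.real B := ENNReal.toReal_mono (measure_ne_top _ _) (h _)
  have h1 := measureReal_add_measureReal_compl (μ := μ) hA
  have h2 := measureReal_add_measureReal_compl (μ := ν) hA
  exact ⟨sub_nonneg.2 (h0 A), by linarith [h0 Aᶜ]⟩

theorem abs_distribution_sub_le {L : ℝ} {μ ν : Measure (Icc (0 : ℝ) L)} [IsFiniteMeasure μ]
    [IsFiniteMeasure ν] (h : μ ≤ ν) (x : ℝ) :
    |distribution ν x - distribution μ x| ≤ ν.real univ - μ.real univ := by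
  have hm := measureReal_sub_mem_of_le h (measurableSet_coe_le L x)
  rw [distribution, distribution, abs_of_nonneg hm.1]
  exact hm.2

theorem distribution_le_integral_cutoff {L : ℝ} (ρ : Measure (Icc (0 : ℝ) L)) [IsFiniteMeasure ρ]
    {x h : ℝ} (hh : 0 < h) :
    distribution ρ x ≤ ∫ y, cutoff x h y ∂ρ ∧ ∫ y, cutoff x h y ∂ρ ≤ distribution ρ (x + h) := by
  have hi : Integrable (fun y : Icc (0 : ℝ) L => cutoff x h y) ρ :=
    Integrable.of_bound ((continuous_cutoff x h).comp continuous_subtype_val).aestronglyMeasurable 1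
      (ae_of_all _ fun y => by
        rw [Real.norm_eq_abs, abs_of_nonneg (cutoff_nonneg _ _ _)]; exact cutoff_le_one _ _ _)
  have hd (z : ℝ) : distribution ρ z = ∫ y, {y : Icc (0 : ℝ) L | (y : ℝ) ≤ z}.indicator (fun _ => (1 : ℝ)) y ∂ρ := by
    rw [integral_indicator_const _ (measurableSet_coe_le L z), smul_eq_mul, mul_one]; rfl
  have hii (z : ℝ) : Integrable ({y : Icc (0 : ℝ) L | (y : ℝ) ≤ z}.indicator (fun _ => (1 : ℝ))) ρ :=
    (integrable_const (1 : ℝ)).indicator (measurableSet_coe_le L z)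
  rw [hd, hd]
  refine ⟨integral_mono (hii _) hi fun y => ?_, integral_mono hi (hii _) fun y => ?_⟩
  · by_cases hy : (y : ℝ) ≤ x
    · simp [hy, cutoff_of_le hh hy]
    · simp [hy, cutoff_nonneg]
  · by_cases hy : (y : ℝ) ≤ x + h
    · simp [hy, cutoff_le_one]
    · simp [hy, cutoff_of_ge hh (not_le.1 hy).le]

/-- Weak-* convergence implies convergence of the distribution functions almost everywhere. -/
theorem tendsto_distribution {L : ℝ} {f : ℕ → ℝ → ℝ} {ρ : Measure (Icc (0 : ℝ) L)}
    [IsFiniteMeasure ρ] (hf : ∀ n, IntegrableOn (f n) (Ioo 0 L))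
    (hf0 : ∀ n, ∀ᵐ x ∂volume.restrict (Ioo 0 L), 0 ≤ f n x)
    (h : ∀ ψ : ℝ → ℝ, Continuous ψ →
      Tendsto (fun n => ∫ x in Ioo 0 L, ψ x * f n x) atTop (𝓝 (∫ x, ψ x ∂ρ))) :
    ∀ᵐ x ∂volume.restrict (Ioo 0 L),
      Tendsto (fun n => ∫ y in (0 : ℝ)..x, f n y) atTop (𝓝 (distribution ρ x)) := by
  -- A monotone function has only countably many discontinuities.
  have hc : ∀ᵐ x ∂volume.restrict (Ioo 0 L), ContinuousAt (distribution ρ) x :=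
    ae_restrict_of_ae (measure_eq_zero_iff_ae_notMem.1
      ((distribution_mono ρ).countable_not_continuousAt.measure_zero volume) |>.mono
        fun _ hx => not_not.1 hx)
  filter_upwards [hc, ae_restrict_mem measurableSet_Ioo] with x hx hxI
  have hint (n : ℕ) : ∫ y in (0 : ℝ)..x, f n y = ∫ y in Ioo 0 L, (Iic x).indicator (f n) y := by
    rw [integral_indicator measurableSet_Iic, Measure.restrict_restrict measurableSet_Iic,
      intervalIntegral.integral_of_le hxI.1.le]
    congr 2
    ext y
    simp only [mem_Ioc, mem_inter_iff, mem_Iic, mem_Ioo]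
    exact ⟨fun hy => ⟨hy.2, hy.1, hy.2.trans_lt hxI.2⟩, fun hy => ⟨hy.2.1, hy.1⟩⟩
  have hci (n : ℕ) (z δ : ℝ) : Integrable (fun y => cutoff z δ y * f n y)
      (volume.restrict (Ioo 0 L)) :=
    (hf n).bdd_mul (continuous_cutoff z δ).aestronglyMeasurable (c := 1) (ae_of_all _ fun y => by
      rw [Real.norm_eq_abs, abs_of_nonneg (cutoff_nonneg _ _ _)]; exact cutoff_le_one _ _ _)
  have hup (n : ℕ) {δ : ℝ} (hδ : 0 < δ) :
      ∫ y in (0 : ℝ)..x, f n y ≤ ∫ y in Ioo 0 L, cutoff x δ y * f n y := by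
    rw [hint]
    refine integral_mono_ae ((hf n).indicator measurableSet_Iic) (hci n x δ) ?_
    filter_upwards [hf0 n] with y hy
    by_cases hyx : y ≤ x
    · simp [hyx, cutoff_of_le hδ hyx]
    · simpa [hyx] using mul_nonneg (cutoff_nonneg x δ y) hy
  have hlo (n : ℕ) {δ : ℝ} (hδ : 0 < δ) :
      ∫ y in Ioo 0 L, cutoff (x - δ) δ y * f n y ≤ ∫ y in (0 : ℝ)..x, f n y := by
    rw [hint]
    refine integral_mono_ae (hci n (x - δ) δ) ((hf n).indicator measurableSet_Iic) ?_
    filter_upwards [hf0 n] with y hy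
    by_cases hyx : y ≤ x
    · simpa [hyx] using mul_le_of_le_one_left hy (cutoff_le_one (x - δ) δ y)
    · simp [hyx, cutoff_of_ge (x := x - δ) hδ (by linarith [not_le.1 hyx] : x - δ + δ ≤ y)]
  refine tendsto_order.2 ⟨fun a ha => ?_, fun b hb => ?_⟩
  -- A cutoff descending on `[x - r/2, x]` bounds the integral up to `x` from below; continuity at
  -- `x` makes its limit exceed `a`. The upper bound uses a cutoff on `[x, x + r/2]`.
  · obtain ⟨r, hr, hr'⟩ := Metric.eventually_nhds_iff.1 (hx.eventually (lt_mem_nhds ha))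
    have h1 : a < distribution ρ (x - r / 2) := hr' (by
      rw [Real.dist_eq, show x - r / 2 - x = -(r / 2) by ring, abs_neg, abs_of_pos (half_pos hr)]
      linarith)
    have h2 := (distribution_le_integral_cutoff ρ (x := x - r / 2) (half_pos hr)).1
    filter_upwards [(h _ (continuous_cutoff (x - r / 2) (r / 2))).eventually
      (lt_mem_nhds (h1.trans_le h2))] with n hn
    exact hn.trans_le (hlo n (half_pos hr))
  · obtain ⟨r, hr, hr'⟩ := Metric.eventually_nhds_iff.1 (hx.eventually (gt_mem_nhds hb))
    have h1 : distribution ρ (x + r / 2) < b := hr' (by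
      rw [Real.dist_eq, show x + r / 2 - x = r / 2 by ring, abs_of_pos (half_pos hr)]
      linarith)
    have h2 := (distribution_le_integral_cutoff ρ (x := x) (half_pos hr)).2
    filter_upwards [(h _ (continuous_cutoff x (r / 2))).eventually
      (gt_mem_nhds (h2.trans_lt h1))] with n hn
    exact (hup n (half_pos hr)).trans_lt hn

/-! ### Removing the atoms at the endpoints -/

/-- The restriction to `(0,L)` of a measure on `[0,L]`. -/
noncomputable def interiorMeasure {L : ℝ} (μ : Measure (Icc (0 : ℝ) L)) : Measure (Ioo (0 : ℝ) L) :=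
  μ.comap (inclusion Ioo_subset_Icc_self)

theorem measurableEmbedding_inclusion_Ioo_Icc (L : ℝ) :
    MeasurableEmbedding (inclusion (Ioo_subset_Icc_self (a := (0 : ℝ)) (b := L))) := by
  refine (Topology.IsEmbedding.inclusion Ioo_subset_Icc_self).measurableEmbedding ?_
  rw [range_inclusion]
  exact measurable_subtype_coe measurableSet_Ioo

theorem interiorMeasure_univ {L : ℝ} (μ : Measure (Icc (0 : ℝ) L)) :
    interiorMeasure μ univ = μ {y | (y : ℝ) ∈ Ioo 0 L} := by
  rw [interiorMeasure, (measurableEmbedding_inclusion_Ioo_Icc L).comap_apply, image_univ,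
    range_inclusion]

instance instIsFiniteMeasureInteriorMeasure {L : ℝ} (μ : Measure (Icc (0 : ℝ) L))
    [IsFiniteMeasure μ] : IsFiniteMeasure (interiorMeasure μ) :=
  ⟨by rw [interiorMeasure_univ]; exact measure_lt_top _ _⟩

theorem interiorMeasure_mono {L : ℝ} {μ ν : Measure (Icc (0 : ℝ) L)} (h : μ ≤ ν) :
    interiorMeasure μ ≤ interiorMeasure ν := fun A => by
  rw [interiorMeasure, interiorMeasure, (measurableEmbedding_inclusion_Ioo_Icc L).comap_apply,
    (measurableEmbedding_inclusion_Ioo_Icc L).comap_apply]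
  exact h _

theorem interiorMeasure_real_sub_le {L : ℝ} {μ ν : Measure (Icc (0 : ℝ) L)} [IsFiniteMeasure μ]
    [IsFiniteMeasure ν] (h : μ ≤ ν) :
    (interiorMeasure ν).real univ - (interiorMeasure μ).real univ
      ≤ ν.real univ - μ.real univ := by
  rw [measureReal_def, measureReal_def, interiorMeasure_univ, interiorMeasure_univ]
  exact (measureReal_sub_mem_of_le h (measurable_subtype_coe measurableSet_Ioo)).2

theorem interiorMeasure_real_le {L : ℝ} (μ : Measure (Icc (0 : ℝ) L)) [IsFiniteMeasure μ] :
    (interiorMeasure μ).real univ ≤ μ.real univ := by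
  rw [measureReal_def, interiorMeasure_univ]
  exact measureReal_mono (subset_univ _)

theorem integral_interiorMeasure {L : ℝ} (μ : Measure (Icc (0 : ℝ) L)) {ψ : ℝ → ℝ}
    (hψ : ∀ x, x ∉ Ioo 0 L → ψ x = 0) :
    ∫ x, ψ x ∂interiorMeasure μ = ∫ x, ψ x ∂μ := by
  have he := measurableEmbedding_inclusion_Ioo_Icc L
  have h1 := he.integral_map (μ := interiorMeasure μ) (fun x : Icc (0 : ℝ) L => ψ x)
  rw [interiorMeasure, he.map_comap, range_inclusion] at h1
  have h2 : ∫ x in {x : Icc (0 : ℝ) L | (x : ℝ) ∈ Ioo 0 L}, ψ x ∂μ = ∫ x, ψ x ∂μ :=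
    setIntegral_eq_integral_of_forall_compl_eq_zero fun x hx => hψ x hx
  exact h1.symm.trans h2


/-! ### The limit of a sequence of one-sided minimal states -/

/-- A sequence of one-sided minimal states whose damage converges to the measure `μ`. -/
structure IsDamageLimit (L κ a₀ a₁ : ℝ) (w : H1 univ) (ε : ℕ → ℝ) (Θ : ℕ → ℝ → ℝ)
    (u : ℕ → H1 (Ioo (0 : ℝ) L)) (μ : Measure (Icc (0 : ℝ) L)) : Prop where
  length_pos : 0 < L
  damaged_pos : 0 < a₀
  sound_pos : 0 < a₁
  param : ∀ n, 0 < ε n ∧ ε n * a₀ < a₁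
  param_tendsto : Tendsto ε atTop (𝓝 0)
  state : ∀ n, IsOneSidedMinimal L κ a₀ a₁ w (ε n) (Θ n) (u n)
  damage : ∀ φ : C(Icc (0 : ℝ) L, ℝ),
    Tendsto (fun n => ∫ x, φ x * ((1 - Θ n x) / ε n) ∂lebesgueOn (Icc (0 : ℝ) L)) atTop
      (𝓝 (∫ x, φ x ∂μ))

/-- The stress of the limit state with boundary jump `Δ` and damage `μ`. -/
noncomputable def limitStress (L a₀ a₁ Δ : ℝ) (μ : Measure (Icc (0 : ℝ) L)) : ℝ :=
  Δ / (μ.real univ / a₀ + L / a₁)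

/-- The displacement of the limit state with boundary value `c` at `0`, stress `σ`, damage `μ`. -/
noncomputable def limitDisplacement {L : ℝ} (a₀ a₁ c σ : ℝ) (μ : Measure (Icc (0 : ℝ) L))
    (x : ℝ) : ℝ :=
  c + σ * (distribution μ x / a₀ + x / a₁)

/-- The derivative of the displacement of the limit state. -/
noncomputable def limitStrain {L : ℝ} (a₀ a₁ σ : ℝ) (μ : Measure (Icc (0 : ℝ) L))
    [IsFiniteMeasure μ] : SignedMeasure (Ioo (0 : ℝ) L) :=
  (σ / a₀) • (interiorMeasure μ).toSignedMeasure
    + (σ / a₁) • (lebesgueOn (Ioo 0 L)).toSignedMeasure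

theorem integrable_limitDisplacement {L : ℝ} (a₀ a₁ c σ : ℝ) (μ : Measure (Icc (0 : ℝ) L))
    [IsFiniteMeasure μ] :
    Integrable (limitDisplacement a₀ a₁ c σ μ) (volume.restrict (Ioo 0 L)) := by
  have h1 : IntegrableOn (distribution μ) (Ioo 0 L) :=
    ((distribution_mono μ).monotoneOn _).integrableOn_isCompact isCompact_Icc |>.mono_set
      Ioo_subset_Icc_self
  have h2 : IntegrableOn (fun x : ℝ => x) (Ioo 0 L) :=
    continuous_id.integrableOn_Icc.mono_set Ioo_subset_Icc_self
  exact (integrable_const c).add (((h1.div_const a₀).add (h2.div_const a₁)).const_mul σ)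

/-- The displacement of the limit state and its derivative. -/
noncomputable def limitPair {L : ℝ} (a₀ a₁ c σ : ℝ) (μ : Measure (Icc (0 : ℝ) L))
    [IsFiniteMeasure μ] : WithLp 1 (L1 L × SignedMeasure (Ioo (0 : ℝ) L)) :=
  WithLp.toLp 1 ((memLp_one_iff_integrable.2
    (integrable_limitDisplacement a₀ a₁ c σ μ)).toLp _, limitStrain a₀ a₁ σ μ)

theorem limitPair_fst {L : ℝ} (a₀ a₁ c σ : ℝ) (μ : Measure (Icc (0 : ℝ) L))
    [IsFiniteMeasure μ] :
    (limitPair a₀ a₁ c σ μ).fst =ᵐ[volume.restrict (Ioo 0 L)] limitDisplacement a₀ a₁ c σ μ :=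
  (memLp_one_iff_integrable.2 (integrable_limitDisplacement a₀ a₁ c σ μ)).coeFn_toLp

theorem integral_smul_toSignedMeasure {X : Type*} [MeasurableSpace X] (c : ℝ) (μ : Measure X)
    [IsFiniteMeasure μ] (φ : X → ℝ) :
    ∫ᵛ x, φ x ∂•(c • μ.toSignedMeasure) = c * ∫ x, φ x ∂μ := by
  have h : (ContinuousLinearMap.lsmul ℝ ℝ : ℝ →L[ℝ] ℝ →L[ℝ] ℝ)
      = (ContinuousLinearMap.lsmul ℝ ℝ).flip := by ext; simp
  rw [VectorMeasure.integral_smul_vectorMeasure, smul_eq_mul, h,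
    VectorMeasure.integral_toSignedMeasure]

theorem integral_limitStrain {L : ℝ} (a₀ a₁ σ : ℝ) (μ : Measure (Icc (0 : ℝ) L))
    [IsFiniteMeasure μ] {ψ : ℝ → ℝ} (hψ : Continuous ψ) (hψ0 : ∀ x, x ∉ Ioo 0 L → ψ x = 0) :
    ∫ᵛ x : Ioo (0 : ℝ) L, ψ x ∂•(limitStrain a₀ a₁ σ μ)
      = σ / a₀ * (∫ x, ψ x ∂μ) + σ / a₁ * ∫ x in Ioo 0 L, ψ x := by
  obtain ⟨C, hC⟩ := isCompact_Icc.exists_bound_of_continuousOn (hψ.continuousOn (s := Icc 0 L))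
  have hi (m : SignedMeasure (Ioo (0 : ℝ) L)) : m.Integrable (fun x : Ioo (0 : ℝ) L => ψ x) :=
    integrable_signedMeasure m (hψ.measurable.comp measurable_subtype_coe)
      (fun x => hC x (Ioo_subset_Icc_self x.2))
  rw [limitStrain, VectorMeasure.integral_add_vectorMeasure (hi _) (hi _),
    integral_smul_toSignedMeasure, integral_smul_toSignedMeasure, integral_interiorMeasure μ hψ0,
    integral_lebesgueOn_Ioo]

/-- Extension by zero of a function vanishing at infinity on an interval. -/
theorem exists_continuous_extension_zero {L : ℝ} (φ : ZeroAtInftyContinuousMap (Ioo (0 : ℝ) L) ℝ) :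
    ∃ ψ : ℝ → ℝ, Continuous ψ ∧ (∀ x, x ∉ Ioo 0 L → ψ x = 0) ∧ ∀ x : Ioo (0 : ℝ) L, ψ x = φ x := by
  classical
  let ψ : ℝ → ℝ := fun x => if h : x ∈ Ioo 0 L then φ ⟨x, h⟩ else 0
  have h1 (x : Ioo (0 : ℝ) L) : ψ x = φ x := dif_pos x.2
  have h0 (x : ℝ) (hx : x ∉ Ioo 0 L) : ψ x = 0 := dif_neg hx
  refine ⟨ψ, continuous_iff_continuousAt.2 fun x => ?_, h0, h1⟩
  by_cases hx : x ∈ Ioo 0 L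
  · have ho : Topology.IsOpenEmbedding ((↑) : Ioo (0 : ℝ) L → ℝ) := isOpen_Ioo.isOpenEmbedding_subtypeVal
    have h2 : ContinuousAt (ψ ∘ ((↑) : Ioo (0 : ℝ) L → ℝ)) ⟨x, hx⟩ := by
      rw [show ψ ∘ ((↑) : Ioo (0 : ℝ) L → ℝ) = φ from funext h1]
      exact φ.continuous.continuousAt
    exact (ho.continuousAt_iff (x := ⟨x, hx⟩)).1 h2
  · rw [ContinuousAt, h0 x hx, Metric.tendsto_nhds]
    intro δ hδ
    -- `φ` is smaller than `δ` off a compact subset of `(0,L)`, whose image is closed and misses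
    -- `x`.
    have h2 := (Metric.tendsto_nhds.1 φ.zero_at_infty') δ hδ
    obtain ⟨K, hK, hKs⟩ := mem_cocompact.1 h2
    have hKc : IsClosed (((↑) : Ioo (0 : ℝ) L → ℝ) '' K) := (hK.image continuous_subtype_val).isClosed
    filter_upwards [hKc.isOpen_compl.mem_nhds (fun ⟨y, _, hy⟩ => hx (hy ▸ y.2))] with y hy
    by_cases hyI : y ∈ Ioo 0 L
    · have h3 := hKs (show (⟨y, hyI⟩ : Ioo (0 : ℝ) L) ∈ Kᶜ from fun hyK => hy ⟨_, hyK, rfl⟩)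
      rw [h1 ⟨y, hyI⟩]
      exact h3
    · rw [h0 y hyI, dist_self]; exact hδ

namespace IsDamageLimit

variable {L κ a₀ a₁ : ℝ} {w : H1 univ} {ε : ℕ → ℝ} {Θ : ℕ → ℝ → ℝ}
  {u : ℕ → H1 (Ioo (0 : ℝ) L)} {μ : Measure (Icc (0 : ℝ) L)}

theorem param_mul_pos (h : IsDamageLimit L κ a₀ a₁ w ε Θ u μ) (n : ℕ) : 0 < ε n * a₀ :=
  mul_pos (h.param n).1 h.damaged_pos

theorem total_compliance_pos (h : IsDamageLimit L κ a₀ a₁ w ε Θ u μ) :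
    0 < μ.real univ / a₀ + L / a₁ :=
  add_pos_of_nonneg_of_pos (div_nonneg measureReal_nonneg h.damaged_pos.le)
    (div_pos h.length_pos h.sound_pos)

theorem tendsto_integral_damage (h : IsDamageLimit L κ a₀ a₁ w ε Θ u μ) {ψ : ℝ → ℝ}
    (hψ : Continuous ψ) :
    Tendsto (fun n => ∫ x in Ioo 0 L, ψ x * ((1 - Θ n x) / ε n)) atTop (𝓝 (∫ x, ψ x ∂μ)) := by
  refine (h.damage ⟨fun x => ψ x, hψ.comp continuous_subtype_val⟩).congr fun n => ?_
  exact integral_lebesgueOn_Icc L (fun x => ψ x * ((1 - Θ n x) / ε n))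

theorem tendsto_gap (h : IsDamageLimit L κ a₀ a₁ w ε Θ u μ) :
    Tendsto (fun n => ε n * complianceGap a₀ a₁ (ε n)) atTop (𝓝 (1 / a₀)) := by
  have h1 : Tendsto (fun n => 1 / a₀ - ε n * (1 / a₁)) atTop (𝓝 (1 / a₀ - 0 * (1 / a₁))) :=
    tendsto_const_nhds.sub (h.param_tendsto.mul_const _)
  rw [zero_mul, sub_zero] at h1
  refine h1.congr fun n => ?_
  have := (h.param n).1.ne'
  have := h.damaged_pos.ne'
  rw [complianceGap]
  field_simp

theorem tendsto_mass (h : IsDamageLimit L κ a₀ a₁ w ε Θ u μ) :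
    Tendsto (fun n => (∫ x in Ioo 0 L, (1 - Θ n x)) / ε n) atTop (𝓝 (μ.real univ)) := by
  have := h.tendsto_integral_damage (ψ := fun _ => 1) continuous_const
  simpa [integral_div] using this

/-- The displacements, as primitives. -/
theorem fn_eq (h : IsDamageLimit L κ a₀ a₁ w ε Θ u μ) {c : ℝ} (hc : H1.HasTrace L w c) (n : ℕ) :
    ∀ᵐ x ∂volume.restrict (Ioo 0 L), H1.fn (u n) x
      = c + H1.jump L univ w / compliance L a₀ a₁ (ε n) (Θ n)
        * (ε n * complianceGap a₀ a₁ (ε n) * (∫ y in (0 : ℝ)..x, (1 - Θ n y) / ε n) + x / a₁) := by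
  have hΘ := (h.state n).volumeFraction
  have h1Θ : IntegrableOn (fun x => (1 - Θ n x) / ε n) (Ioo 0 L) :=
    ((integrable_const 1).sub hΘ.integrable).div_const (ε n)
  have hε := (h.param n).1.ne'
  filter_upwards [((h.state n).dirichlet.trace_eq h.length_pos hc).1,
    ae_restrict_mem measurableSet_Ioo] with x hx hxI
  rw [hx, integral_congr_Ioo hxI
    ((h.state n).weakDeriv_eq h.length_pos (h.param_mul_pos n) (h.param n).2),
    intervalIntegral.integral_const_mul]
  have e : ∫ y in (0 : ℝ)..x, (complianceGap a₀ a₁ (ε n) * (1 - Θ n y) + 1 / a₁)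
      = ∫ y in (0 : ℝ)..x,
        (ε n * complianceGap a₀ a₁ (ε n) * ((1 - Θ n y) / ε n) + 1 / a₁) :=
    intervalIntegral.integral_congr fun y _ => by field_simp
  rw [e, intervalIntegral.integral_add ((intervalIntegrable_of_Ioo hxI h1Θ).const_mul _)
    intervalIntegrable_const, intervalIntegral.integral_const_mul, intervalIntegral.integral_const]
  simp [div_eq_mul_inv]

/-- The partial compliance up to `x` never exceeds the total compliance, so `u - c` stays within
`|Δ|`; this is the dominating constant below. -/
theorem abs_fn_le (h : IsDamageLimit L κ a₀ a₁ w ε Θ u μ) {c : ℝ} (hc : H1.HasTrace L w c)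
    (n : ℕ) :
    ∀ᵐ x ∂volume.restrict (Ioo 0 L), ‖H1.fn (u n) x‖ ≤ |c| + |H1.jump L univ w| := by
  have hL := h.length_pos
  have ha₁ := h.sound_pos
  have hk := complianceGap_pos (h.param_mul_pos n) (h.param n).2
  have hD := compliance_pos hL (h.param_mul_pos n) (h.param n).2 (h.state n).volumeFraction
  have hε := (h.param n).1
  have hnn : ∀ᵐ x ∂volume.restrict (Ioo 0 L), 0 ≤ (1 - Θ n x) / ε n :=
    (h.state n).volumeFraction.2.mono fun x hx => div_nonneg (sub_nonneg.2 hx.2) hε.le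
  have hi : IntegrableOn (fun x => (1 - Θ n x) / ε n) (Ioo 0 L) :=
    ((integrable_const 1).sub (h.state n).volumeFraction.integrable).div_const (ε n)
  filter_upwards [h.fn_eq hc n, ae_restrict_mem measurableSet_Ioo] with x hx hxI
  rw [hx]
  refine (norm_add_le _ _).trans (add_le_add le_rfl ?_)
  have hsub : Ioc 0 x ⊆ Ioo 0 L := fun y hy => ⟨hy.1, hy.2.trans_lt hxI.2⟩
  have h0 : 0 ≤ ∫ y in (0 : ℝ)..x, (1 - Θ n y) / ε n := by
    rw [intervalIntegral.integral_of_le hxI.1.le]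
    exact integral_nonneg_of_ae (ae_restrict_of_ae_restrict_of_subset hsub hnn)
  have h1 : ∫ y in (0 : ℝ)..x, (1 - Θ n y) / ε n ≤ (∫ y in Ioo 0 L, (1 - Θ n y)) / ε n := by
    rw [intervalIntegral.integral_of_le hxI.1.le, ← integral_div]
    exact setIntegral_mono_set hi hnn hsub.eventuallyLE
  have h2 : ε n * complianceGap a₀ a₁ (ε n) * (∫ y in (0 : ℝ)..x, (1 - Θ n y) / ε n) + x / a₁
      ≤ compliance L a₀ a₁ (ε n) (Θ n) := by
    have h3 : ε n * complianceGap a₀ a₁ (ε n) * (∫ y in (0 : ℝ)..x, (1 - Θ n y) / ε n)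
        ≤ ε n * complianceGap a₀ a₁ (ε n) * ((∫ y in Ioo 0 L, (1 - Θ n y)) / ε n) :=
      mul_le_mul_of_nonneg_left h1 (by positivity)
    have h4 : ε n * complianceGap a₀ a₁ (ε n) * ((∫ y in Ioo 0 L, (1 - Θ n y)) / ε n)
        = complianceGap a₀ a₁ (ε n) * ∫ y in Ioo 0 L, (1 - Θ n y) := by field_simp
    have h5 : x / a₁ ≤ L / a₁ := div_le_div_of_nonneg_right hxI.2.le ha₁.le
    rw [compliance]
    linarith
  have h6 : 0 ≤ ε n * complianceGap a₀ a₁ (ε n) * (∫ y in (0 : ℝ)..x, (1 - Θ n y) / ε n)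
      + x / a₁ :=
    add_nonneg (mul_nonneg (by positivity) h0) (div_nonneg hxI.1.le ha₁.le)
  rw [Real.norm_eq_abs, abs_mul, abs_of_nonneg h6, abs_div, abs_of_pos hD, div_mul_eq_mul_div,
    div_le_iff₀ hD]
  exact mul_le_mul_of_nonneg_left h2 (abs_nonneg _)

theorem tendsto_integral_one_sub (h : IsDamageLimit L κ a₀ a₁ w ε Θ u μ) :
    Tendsto (fun n => ∫ x in Ioo 0 L, (1 - Θ n x)) atTop (𝓝 0) := by
  have := h.tendsto_mass.mul h.param_tendsto
  rw [mul_zero] at this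
  exact this.congr fun n => div_mul_cancel₀ _ (h.param n).1.ne'

theorem tendsto_toughness (h : IsDamageLimit L κ a₀ a₁ w ε Θ u μ) :
    Tendsto (fun n => κ / (ε n * complianceGap a₀ a₁ (ε n))) atTop (𝓝 (κ * a₀)) := by
  have := (tendsto_const_nhds (x := κ)).div h.tendsto_gap (one_div_pos.2 h.damaged_pos).ne'
  rwa [one_div, div_inv_eq_mul] at this

theorem tendsto_compliance (h : IsDamageLimit L κ a₀ a₁ w ε Θ u μ) :
    Tendsto (fun n => compliance L a₀ a₁ (ε n) (Θ n)) atTop (𝓝 (μ.real univ / a₀ + L / a₁)) := by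
  have h1 := (h.tendsto_gap.mul h.tendsto_mass).add_const (L / a₁)
  rw [one_div_mul_eq_div] at h1
  refine h1.congr fun n => ?_
  have := (h.param n).1.ne'
  rw [compliance]
  field_simp

theorem tendsto_stress (h : IsDamageLimit L κ a₀ a₁ w ε Θ u μ) :
    Tendsto (fun n => H1.jump L univ w / compliance L a₀ a₁ (ε n) (Θ n)) atTop
      (𝓝 (limitStress L a₀ a₁ (H1.jump L univ w) μ)) :=
  tendsto_const_nhds.div h.tendsto_compliance h.total_compliance_pos.ne'

/-- Bounded damage mass forces `∫ (1 - Θ) → 0`, so the sound phase eventually survives and the yield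
bound passes to the limit. -/
theorem limitStress_mem (h : IsDamageLimit L κ a₀ a₁ w ε Θ u μ) :
    limitStress L a₀ a₁ (H1.jump L univ w) μ ∈ elasticityDomain κ a₀ := by
  have hL := h.length_pos
  have hev : ∀ᶠ n in atTop, (∫ x in Ioo 0 L, (1 - Θ n x)) < L :=
    h.tendsto_integral_one_sub.eventually (gt_mem_nhds hL)
  have hle : H1.jump L univ w ^ 2 ≤ 2 * (κ * a₀) * (μ.real univ / a₀ + L / a₁) ^ 2 := by
    refine ge_of_tendsto ((h.tendsto_toughness.const_mul 2).mul (h.tendsto_compliance.pow 2)) ?_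
    filter_upwards [hev] with n hn
    refine (h.state n).sq_jump_le hL (h.param_mul_pos n) (h.param n).2 ?_
    rw [(h.state n).volumeFraction.integral_one_sub hL] at hn
    linarith
  have hD := h.total_compliance_pos
  rw [elasticityDomain, mem_Icc, ← abs_le]
  refine Real.abs_le_sqrt ?_
  rw [limitStress, div_pow, div_le_iff₀ (by positivity)]
  linarith

theorem tendsto_elastic_strain (h : IsDamageLimit L κ a₀ a₁ w ε Θ u μ) :
    Tendsto (fun n => eLpNorm (fun x => H1.jump L univ w / compliance L a₀ a₁ (ε n) (Θ n)
        * (Θ n x / a₁) - limitStress L a₀ a₁ (H1.jump L univ w) μ / a₁) 2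
      (volume.restrict (Ioo 0 L))) atTop (𝓝 0) := by
  set s : ℕ → ℝ := fun n => H1.jump L univ w / compliance L a₀ a₁ (ε n) (Θ n) with hs
  set σ := limitStress L a₀ a₁ (H1.jump L univ w) μ with hσ
  have hst : Tendsto s atTop (𝓝 σ) := h.tendsto_stress
  have hmem (n : ℕ) : MemLp (fun x => s n * (Θ n x / a₁) - σ / a₁) 2
      (volume.restrict (Ioo 0 L)) := by
    have hΘ := (h.state n).volumeFraction
    have : MemLp (Θ n) 2 (volume.restrict (Ioo 0 L)) :=
      MemLp.of_bound hΘ.1.aestronglyMeasurable 1 (hΘ.2.mono fun x hx => by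
        rw [Real.norm_eq_abs, abs_of_nonneg hx.1]; exact hx.2)
    have h2 : MemLp (fun x => s n / a₁ * Θ n x - σ / a₁) 2 (volume.restrict (Ioo 0 L)) :=
      (this.const_mul _).sub (memLp_const _)
    exact h2.ae_eq (ae_of_all _ fun x => by simp only; ring)
  have hsq : Tendsto (fun n => ∫ x in Ioo 0 L, ‖s n * (Θ n x / a₁) - σ / a₁‖ ^ (2 : ℝ)) atTop
      (𝓝 0) := by
    -- The error is `((s - σ) Θ - σ (1 - Θ)) / a₁`; use `(x - y)² ≤ 2 x² + 2 y²`, together with `Θ²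
    -- ≤ 1` and `(1 - Θ)² ≤ 1 - Θ`.
    have hb : Tendsto (fun n => 2 / a₁ ^ 2 * ((s n - σ) ^ 2 * L
        + σ ^ 2 * ∫ x in Ioo 0 L, (1 - Θ n x))) atTop
        (𝓝 (2 / a₁ ^ 2 * ((σ - σ) ^ 2 * L + σ ^ 2 * 0))) :=
      ((((hst.sub_const σ).pow 2).mul_const L).add
        (h.tendsto_integral_one_sub.const_mul _)).const_mul _
    rw [sub_self, zero_pow two_ne_zero, zero_mul, mul_zero, add_zero, mul_zero] at hb
    refine squeeze_zero (fun n => integral_nonneg fun x => by positivity) (fun n => ?_) hb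
    have hΘ := (h.state n).volumeFraction
    have h1Θ : Integrable (fun x => 1 - Θ n x) (volume.restrict (Ioo 0 L)) :=
      (integrable_const 1).sub hΘ.integrable
    have e : 2 / a₁ ^ 2 * ((s n - σ) ^ 2 * L + σ ^ 2 * ∫ x in Ioo 0 L, (1 - Θ n x))
        = ∫ x in Ioo 0 L, 2 / a₁ ^ 2 * ((s n - σ) ^ 2 + σ ^ 2 * (1 - Θ n x)) := by
      rw [integral_const_mul, integral_add (integrable_const _) (h1Θ.const_mul _),
        integral_const_mul]
      simp [h.length_pos.le, mul_comm]
    rw [e]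
    refine integral_mono_of_nonneg (ae_of_all _ fun x => by positivity)
      (((integrable_const _).add (h1Θ.const_mul _)).const_mul _) ?_
    filter_upwards [hΘ.2] with x hx
    have e2 : s n * (Θ n x / a₁) - σ / a₁ = ((s n - σ) * Θ n x - σ * (1 - Θ n x)) / a₁ := by ring
    simp only [Real.rpow_two, Real.norm_eq_abs, sq_abs]
    rw [e2, div_pow, div_mul_eq_mul_div]
    refine div_le_div_of_nonneg_right ?_ (by positivity)
    have h1 : ((s n - σ) * Θ n x) ^ 2 ≤ (s n - σ) ^ 2 := by
      rw [mul_pow]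
      exact mul_le_of_le_one_right (sq_nonneg _) (pow_le_one₀ hx.1 hx.2)
    have h2 : (σ * (1 - Θ n x)) ^ 2 ≤ σ ^ 2 * (1 - Θ n x) := by
      rw [mul_pow]
      refine mul_le_mul_of_nonneg_left ?_ (sq_nonneg _)
      nlinarith [hx.1, hx.2]
    nlinarith [sq_nonneg ((s n - σ) * Θ n x + σ * (1 - Θ n x))]
  have h3 := ENNReal.tendsto_ofReal (hsq.rpow_const (p := (2 : ℝ)⁻¹) (Or.inr (by norm_num)))
  rw [Real.zero_rpow (by norm_num), ENNReal.ofReal_zero] at h3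
  refine h3.congr fun n => ?_
  rw [(hmem n).eLpNorm_eq_integral_rpow_norm (by norm_num) (by norm_num)]
  simp

variable [IsFiniteMeasure μ]

theorem tendstoWeakStar_plastic_strain (h : IsDamageLimit L κ a₀ a₁ w ε Θ u μ) :
    TendstoWeakStar L (fun n x => H1.jump L univ w / compliance L a₀ a₁ (ε n) (Θ n)
        * ((1 - Θ n x) / (ε n * a₀)))
      ((limitStress L a₀ a₁ (H1.jump L univ w) μ / a₀) • μ.toSignedMeasure) := by
  intro φ
  rw [integral_smul_toSignedMeasure]
  refine ((h.tendsto_stress.div_const a₀).mul (h.damage φ)).congr fun n => ?_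
  rw [← integral_const_mul]
  refine integral_congr_ae (ae_of_all _ fun x => ?_)
  have := (h.param n).1.ne'
  have := h.damaged_pos.ne'
  field_simp

theorem tendsto_integral_weakDeriv (h : IsDamageLimit L κ a₀ a₁ w ε Θ u μ) {ψ : ℝ → ℝ}
    (hψ : Continuous ψ) (hψ0 : ∀ x, x ∉ Ioo 0 L → ψ x = 0) :
    Tendsto (fun n => ∫ x in Ioo 0 L, ψ x * H1.weakDeriv (u n) x) atTop
      (𝓝 (∫ᵛ x : Ioo (0 : ℝ) L, ψ x
        ∂•(limitStrain a₀ a₁ (limitStress L a₀ a₁ (H1.jump L univ w) μ) μ))) := by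
  rw [integral_limitStrain a₀ a₁ _ μ hψ hψ0]
  set σ := limitStress L a₀ a₁ (H1.jump L univ w) μ
  have h1 := h.tendsto_stress.mul (((h.tendsto_gap.mul (h.tendsto_integral_damage hψ))).add_const
    (1 / a₁ * ∫ x in Ioo 0 L, ψ x))
  have e : σ / a₀ * (∫ x, ψ x ∂μ) + σ / a₁ * (∫ x in Ioo 0 L, ψ x)
      = σ * (1 / a₀ * (∫ x, ψ x ∂μ) + 1 / a₁ * ∫ x in Ioo 0 L, ψ x) := by ring
  rw [e]
  refine h1.congr fun n => ?_
  have hψi : IntegrableOn ψ (Ioo 0 L) := hψ.integrableOn_Icc.mono_set Ioo_subset_Icc_self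
  have hΘ := (h.state n).volumeFraction
  have hd : Integrable (fun x => ψ x * ((1 - Θ n x) / ε n)) (volume.restrict (Ioo 0 L)) := by
    obtain ⟨C, hC⟩ := isCompact_Icc.exists_bound_of_continuousOn (hψ.continuousOn (s := Icc 0 L))
    refine (((integrable_const 1).sub hΘ.integrable).div_const (ε n)).bdd_mul
      hψ.aestronglyMeasurable (c := C) ?_
    filter_upwards [ae_restrict_mem measurableSet_Ioo] with x hx using hC x (Ioo_subset_Icc_self hx)
  rw [← integral_const_mul, ← integral_const_mul, ← integral_add (hd.const_mul _)
    (hψi.const_mul _), ← integral_const_mul]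
  refine integral_congr_ae ?_
  filter_upwards [(h.state n).weakDeriv_eq h.length_pos (h.param_mul_pos n) (h.param n).2] with x hx
  have := (h.param n).1.ne'
  rw [hx]
  field_simp

theorem ae_tendsto_fn (h : IsDamageLimit L κ a₀ a₁ w ε Θ u μ) {c : ℝ}
    (hc : H1.HasTrace L w c) :
    ∀ᵐ x ∂volume.restrict (Ioo 0 L), Tendsto (fun n => H1.fn (u n) x) atTop
      (𝓝 (limitDisplacement a₀ a₁ c (limitStress L a₀ a₁ (H1.jump L univ w) μ) μ x)) := by
  have h1 := tendsto_distribution (f := fun n x => (1 - Θ n x) / ε n) (ρ := μ)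
    (fun n => ((integrable_const 1).sub (h.state n).volumeFraction.integrable).div_const (ε n))
    (fun n => (h.state n).volumeFraction.2.mono fun x hx =>
      div_nonneg (sub_nonneg.2 hx.2) (h.param n).1.le)
    (fun ψ hψ => h.tendsto_integral_damage hψ)
  filter_upwards [h1, ae_all_iff.2 fun n => h.fn_eq hc n] with x hx hfn
  have h2 := (h.tendsto_stress.mul ((h.tendsto_gap.mul hx).add_const (x / a₁))).const_add c
  rw [one_div_mul_eq_div] at h2
  exact h2.congr fun n => (hfn n).symm

theorem aestronglyMeasurable_fn (v : H1 (Ioo (0 : ℝ) L)) :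
    AEStronglyMeasurable (H1.fn v) (volume.restrict (Ioo 0 L)) :=
  (Lp.memLp (H1.fstL _ v)).1

/-- The weak derivative relation of `u n` passes to the limit: the left side by dominated
convergence, the right side by weak-* convergence of the strains. -/
theorem limitPair_mem (h : IsDamageLimit L κ a₀ a₁ w ε Θ u μ) {c : ℝ}
    (hc : H1.HasTrace L w c) :
    limitPair a₀ a₁ c (limitStress L a₀ a₁ (H1.jump L univ w) μ) μ ∈ BV L := by
  intro φ hφ
  set σ := limitStress L a₀ a₁ (H1.jump L univ w) μ
  have e : ∫ x in Ioo 0 L, (limitPair a₀ a₁ c σ μ).fst x * deriv φ x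
      = ∫ x in Ioo 0 L, limitDisplacement a₀ a₁ c σ μ x * deriv φ x :=
    integral_congr_ae ((limitPair_fst a₀ a₁ c σ μ).mono fun x hx => by simp only [hx])
  rw [e]
  have h1 : Tendsto (fun n => ∫ x in Ioo 0 L, H1.fn (u n) x * deriv φ x) atTop
      (𝓝 (∫ x in Ioo 0 L, limitDisplacement a₀ a₁ c σ μ x * deriv φ x)) := by
    refine tendsto_integral_of_dominated_convergence
      (fun x => (|c| + |H1.jump L univ w|) * ‖deriv φ x‖)
      (fun n => (aestronglyMeasurable_fn (u n)).mul hφ.continuous_deriv.aestronglyMeasurable)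
      ((memLp_one_iff_integrable.1 (hφ.memLp_deriv 1 _)).norm.const_mul _) (fun n => ?_) ?_
    · filter_upwards [h.abs_fn_le hc n] with x hx
      rw [norm_mul]
      exact mul_le_mul_of_nonneg_right hx (norm_nonneg _)
    · filter_upwards [h.ae_tendsto_fn hc] with x hx using hx.mul_const _
  have h2 := (h.tendsto_integral_weakDeriv hφ.smooth.continuous
    (fun x hx => hφ.eq_zero_of_notMem hx)).neg
  refine tendsto_nhds_unique h1 (h2.congr fun n => ?_)
  have h3 : ∫ x in Ioo 0 L, H1.fn (u n) x * deriv φ x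
    = - ∫ x in Ioo 0 L, H1.weakDeriv (u n) x * φ x := (u n).2 φ hφ
  rw [h3]
  simp only [mul_comm]

theorem tendstoWeakStarBV (h : IsDamageLimit L κ a₀ a₁ w ε Θ u μ) {c : ℝ}
    (hc : H1.HasTrace L w c) :
    TendstoWeakStarBV L u ⟨_, h.limitPair_mem hc⟩ := by
  constructor
  · set σ := limitStress L a₀ a₁ (H1.jump L univ w) μ
    have h1 := tendsto_lintegral_norm_of_dominated_convergence
      (F := fun n => H1.fn (u n)) (f := limitDisplacement a₀ a₁ c σ μ)
      (μ := volume.restrict (Ioo 0 L)) (bound := fun _ => |c| + |H1.jump L univ w|)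
      (fun n => aestronglyMeasurable_fn (u n)) (integrable_const _).hasFiniteIntegral
      (fun n => h.abs_fn_le hc n) (h.ae_tendsto_fn hc)
    refine h1.congr fun n => ?_
    rw [eLpNorm_one_eq_lintegral_enorm]
    refine lintegral_congr_ae ?_
    filter_upwards [limitPair_fst a₀ a₁ c σ μ] with x hx
    rw [hx, ofReal_norm]
  · intro φ
    obtain ⟨ψ, hψ, hψ0, hψφ⟩ := exists_continuous_extension_zero φ
    have h1 := h.tendsto_integral_weakDeriv hψ hψ0
    simp only [hψφ] at h1
    refine h1.congr fun n => ?_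
    rw [← integral_lebesgueOn_Ioo L (fun x => ψ x * H1.weakDeriv (u n) x)]
    simp only [hψφ]

end IsDamageLimit


/-! ### Time regularity of the limit -/

theorem IsDamageLimit.measure_le {L κ a₀ a₁ : ℝ} {w w' : H1 univ} {ε : ℕ → ℝ}
    {Θ Θ' : ℕ → ℝ → ℝ} {u u' : ℕ → H1 (Ioo (0 : ℝ) L)} {μ μ' : Measure (Icc (0 : ℝ) L)}
    [IsFiniteMeasure μ] [IsFiniteMeasure μ'] (h : IsDamageLimit L κ a₀ a₁ w ε Θ u μ)
    (h' : IsDamageLimit L κ a₀ a₁ w' ε Θ' u' μ')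
    (hle : ∀ n, ∀ᵐ x ∂volume.restrict (Ioo 0 L), Θ' n x ≤ Θ n x) : μ ≤ μ' := by
  refine measure_le_of_forall_integral_le fun φ hφ => ?_
  set ψ : ℝ → ℝ := IccExtend h.length_pos.le φ with hψdef
  have hψ : Continuous ψ := φ.continuous.Icc_extend'
  have hψ0 (x : ℝ) : 0 ≤ ψ x := hφ _
  have e (ν : Measure (Icc (0 : ℝ) L)) : ∫ x, φ x ∂ν = ∫ x, ψ x ∂ν :=
    integral_congr_ae (ae_of_all _ fun x => (IccExtend_val h.length_pos.le φ x).symm)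
  obtain ⟨C, hC⟩ := isCompact_Icc.exists_bound_of_continuousOn (hψ.continuousOn (s := Icc 0 L))
  have hi (n : ℕ) {θ : ℝ → ℝ} (hθ : IsVolumeFraction L θ) :
      Integrable (fun x => ψ x * ((1 - θ x) / ε n)) (volume.restrict (Ioo 0 L)) := by
    refine (((integrable_const 1).sub hθ.integrable).div_const (ε n)).bdd_mul
      hψ.aestronglyMeasurable (c := C) ?_
    filter_upwards [ae_restrict_mem measurableSet_Ioo] with x hx using hC x (Ioo_subset_Icc_self hx)
  rw [e, e]
  refine le_of_tendsto_of_tendsto' (h.tendsto_integral_damage hψ) (h'.tendsto_integral_damage hψ)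
    fun n => ?_
  refine integral_mono_ae (hi n (h.state n).volumeFraction) (hi n (h'.state n).volumeFraction) ?_
  filter_upwards [hle n] with x hx
  refine mul_le_mul_of_nonneg_left (div_le_div_of_nonneg_right ?_ (h.param n).1.le) (hψ0 x)
  linarith

/-! ### Increments of the limit objects -/

theorem abs_limitStress_sub_le {L a₀ a₁ Δ Δ' k : ℝ} (hL : 0 < L) (ha₀ : 0 < a₀) (ha₁ : 0 < a₁)
    {μ μ' : Measure (Icc (0 : ℝ) L)} (hk : |limitStress L a₀ a₁ Δ μ| ≤ k) :
    |limitStress L a₀ a₁ Δ' μ' - limitStress L a₀ a₁ Δ μ|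
      ≤ a₁ / L * (|Δ' - Δ| + k / a₀ * |μ'.real univ - μ.real univ|) := by
  have hD : 0 < μ.real univ / a₀ + L / a₁ := by positivity
  have hD' : 0 < μ'.real univ / a₀ + L / a₁ := by positivity
  have hm' : 0 ≤ μ'.real univ := measureReal_nonneg
  have e : limitStress L a₀ a₁ Δ' μ' - limitStress L a₀ a₁ Δ μ
      = (μ'.real univ / a₀ + L / a₁)⁻¹ * ((Δ' - Δ)
        - limitStress L a₀ a₁ Δ μ / a₀ * (μ'.real univ - μ.real univ)) := by
    rw [limitStress, limitStress]
    generalize hA : μ'.real univ / a₀ + L / a₁ = A at *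
    generalize hB : μ.real univ / a₀ + L / a₁ = B at *
    have h1 : (μ'.real univ - μ.real univ) / a₀ = A - B := by rw [← hA, ← hB]; ring
    have h2 : Δ / B / a₀ * (μ'.real univ - μ.real univ) = Δ / B * (A - B) := by rw [← h1]; ring
    rw [h2]
    field_simp
    ring
  -- The sound phase alone keeps the total compliance at least `L / a₁`.
  have hinv : (μ'.real univ / a₀ + L / a₁)⁻¹ ≤ a₁ / L := by
    rw [← inv_div L a₁]
    exact inv_anti₀ (by positivity) (le_add_of_nonneg_left (by positivity))
  rw [e, abs_mul, abs_of_pos (inv_pos.2 hD')]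
  refine mul_le_mul hinv ?_ (abs_nonneg _) (by positivity)
  refine (abs_sub _ _).trans (add_le_add le_rfl ?_)
  rw [abs_mul, abs_div, abs_of_pos ha₀]
  gcongr

theorem abs_limitDisplacement_sub_le {L a₀ a₁ c d σ τ x : ℝ} (ha₀ : 0 < a₀) (ha₁ : 0 < a₁)
    {μ ν : Measure (Icc (0 : ℝ) L)} [IsFiniteMeasure μ] [IsFiniteMeasure ν] (h : μ ≤ ν)
    (hx : x ∈ Ioo 0 L) :
    |limitDisplacement a₀ a₁ d τ ν x - limitDisplacement a₀ a₁ c σ μ x|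
      ≤ |d - c| + |τ| / a₀ * (ν.real univ - μ.real univ)
        + |τ - σ| * (μ.real univ / a₀ + L / a₁) := by
  have hx0 := hx.1
  have hxL := hx.2
  have e : limitDisplacement a₀ a₁ d τ ν x - limitDisplacement a₀ a₁ c σ μ x
      = (d - c) + τ / a₀ * (distribution ν x - distribution μ x)
        + (τ - σ) * (distribution μ x / a₀ + x / a₁) := by
    simp only [limitDisplacement]; ring
  rw [e]
  refine (abs_add_three _ _ _).trans ?_
  rw [abs_mul, abs_mul, abs_div, abs_of_pos ha₀]
  have h1 := abs_distribution_sub_le h x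
  have h2 := distribution_nonneg μ x
  have h3 := distribution_le μ x
  have h4 : 0 ≤ distribution μ x / a₀ + x / a₁ := by positivity
  rw [abs_of_nonneg h4]
  gcongr

theorem norm_limitStrain_sub_le {L a₀ a₁ σ τ : ℝ} (hL : 0 < L) (ha₀ : 0 < a₀) (ha₁ : 0 < a₁)
    {μ ν : Measure (Icc (0 : ℝ) L)} [IsFiniteMeasure μ] [IsFiniteMeasure ν] (h : μ ≤ ν) :
    ‖limitStrain a₀ a₁ τ ν - limitStrain a₀ a₁ σ μ‖
      ≤ |τ| / a₀ * (ν.real univ - μ.real univ)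
        + |τ - σ| * (μ.real univ / a₀ + L / a₁) := by
  have e : limitStrain a₀ a₁ τ ν - limitStrain a₀ a₁ σ μ
      = ((τ / a₀) • (interiorMeasure ν).toSignedMeasure
          - (σ / a₀) • (interiorMeasure μ).toSignedMeasure)
        + ((τ - σ) / a₁) • (lebesgueOn (Ioo 0 L)).toSignedMeasure := by
    simp only [limitStrain]; module
  rw [e]
  refine (norm_add_le _ _).trans ?_
  have h1 := norm_smul_sub_smul_toSignedMeasure_le (τ / a₀) (σ / a₀) (interiorMeasure_mono h)
  have h2 := interiorMeasure_real_sub_le h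
  have h3 := interiorMeasure_real_le μ
  rw [norm_smul_toSignedMeasure, lebesgueOn_Ioo_real_univ hL]
  rw [← sub_div, abs_div, abs_div, abs_of_pos ha₀] at h1
  rw [abs_div, abs_of_pos ha₁]
  have h4 : |τ| / a₀ * ((interiorMeasure ν).real univ - (interiorMeasure μ).real univ)
      ≤ |τ| / a₀ * (ν.real univ - μ.real univ) := by gcongr
  have h5 : |τ - σ| / a₀ * (interiorMeasure μ).real univ ≤ |τ - σ| / a₀ * μ.real univ := by gcongr
  have h6 : |τ - σ| * (μ.real univ / a₀ + L / a₁)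
      = |τ - σ| / a₀ * μ.real univ + |τ - σ| / a₁ * L := by ring
  linarith

/-- The factor `L` comes from integrating the uniform bound on displacements, the `1` from the total
variation of the strains. -/
theorem norm_limitPair_sub_le {L a₀ a₁ c d σ τ : ℝ} (hL : 0 < L) (ha₀ : 0 < a₀) (ha₁ : 0 < a₁)
    {μ ν : Measure (Icc (0 : ℝ) L)} [IsFiniteMeasure μ] [IsFiniteMeasure ν] (h : μ ≤ ν) :
    ‖limitPair a₀ a₁ d τ ν - limitPair a₀ a₁ c σ μ‖
      ≤ (L + 1) * (|d - c| + |τ| / a₀ * (ν.real univ - μ.real univ)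
        + |τ - σ| * (μ.real univ / a₀ + L / a₁)) := by
  have hm := (measureReal_sub_mem_of_le h MeasurableSet.univ).1
  have hnn : 0 ≤ |d - c| + |τ| / a₀ * (ν.real univ - μ.real univ)
        + |τ - σ| * (μ.real univ / a₀ + L / a₁) := by positivity
  rw [WithLp.prod_norm_eq_of_L1, add_one_mul]
  refine add_le_add ?_ ?_
  · have h1 := Lp.norm_le_of_ae_bound (f := (limitPair a₀ a₁ d τ ν - limitPair a₀ a₁ c σ μ).fst) hnn
      (by
        rw [WithLp.sub_fst]
        filter_upwards [Lp.coeFn_sub (limitPair a₀ a₁ d τ ν).fst (limitPair a₀ a₁ c σ μ).fst,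
          limitPair_fst a₀ a₁ d τ ν, limitPair_fst a₀ a₁ c σ μ,
          ae_restrict_mem measurableSet_Ioo] with x h1 h2 h3 hx
        rw [h1, Pi.sub_apply, h2, h3]
        exact abs_limitDisplacement_sub_le ha₀ ha₁ h hx)
    simpa [measureUnivNNReal, ENNReal.coe_toNNReal_eq_toReal, hL.le] using h1
  · refine (norm_limitStrain_sub_le hL ha₀ ha₁ h).trans ?_
    linarith [abs_nonneg (d - c)]

theorem absolutelyContinuousOnInterval_prodMk {X Y : Type*} [PseudoMetricSpace X]
    [PseudoMetricSpace Y] {F : ℝ → X} {G : ℝ → Y} {a b : ℝ}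
    (hF : AbsolutelyContinuousOnInterval F a b) (hG : AbsolutelyContinuousOnInterval G a b) :
    AbsolutelyContinuousOnInterval (fun t => (F t, G t)) a b :=
  absolutelyContinuousOnInterval_of_dist_le hF hG 1 fun s _ t _ => by
    rw [one_mul, Prod.dist_eq]
    exact max_le_add_of_nonneg dist_nonneg dist_nonneg

theorem absolutelyContinuousOnInterval_of_dist_le_of_le {X Y Z : Type*} [PseudoMetricSpace X]
    [PseudoMetricSpace Y] [PseudoMetricSpace Z] {F : ℝ → X} {G : ℝ → Y} {H : ℝ → Z} {T : ℝ}
    (hT : 0 ≤ T)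
    (hG : AbsolutelyContinuousOnInterval G 0 T) (hH : AbsolutelyContinuousOnInterval H 0 T)
    (C : ℝ) (h : ∀ s t, 0 ≤ s → s ≤ t → t ≤ T →
      dist (F t) (F s) ≤ C * (dist (G t) (G s) + dist (H t) (H s))) :
    AbsolutelyContinuousOnInterval F 0 T := by
  refine absolutelyContinuousOnInterval_of_dist_le hG hH C fun s hs t ht => ?_
  rw [uIcc_of_le hT] at hs ht
  rcases le_total s t with hst | hst
  · rw [dist_comm (F s), dist_comm (G s), dist_comm (H s)]
    exact h s t hs.1 hst ht.2
  · exact h t s ht.1 hst hs.2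


/-! ### Growth of the limit damage -/

theorem compliance_growth_of_tendsto {L T κ a₀ a₁ : ℝ} {w : ℝ → H1 univ}
    (hT : 0 ≤ T) (hw : AbsolutelyContinuousOnInterval w 0 T) {ε : ℕ → ℝ} {Θ : ℕ → ℝ → ℝ → ℝ}
    {u : ℕ → ℝ → H1 (Ioo (0 : ℝ) L)}
    (hev : ∀ n, IsDamageEvolution L T κ a₀ a₁ w (ε n) (Θ n) (u n)) {s t : ℝ}
    {μ ν : Measure (Icc (0 : ℝ) L)}
    (hμ : IsDamageLimit L κ a₀ a₁ (w s) ε (fun n => Θ n s) (fun n => u n s) μ)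
    (hν : IsDamageLimit L κ a₀ a₁ (w t) ε (fun n => Θ n t) (fun n => u n t) ν)
    (hs : 0 ≤ s) (hst : s ≤ t) (ht : t ≤ T) :
    κ * a₀ * (μ.real univ / a₀ + L / a₁)
        * ((ν.real univ / a₀ + L / a₁) - (μ.real univ / a₀ + L / a₁))
      ≤ ∫ q in s..t, |H1.jump L univ (w q) * deriv (fun r => H1.jump L univ (w r)) q| :=
  le_of_tendsto' ((hμ.tendsto_toughness.mul hμ.tendsto_compliance).mul
      (hν.tendsto_compliance.sub hμ.tendsto_compliance)) fun n =>
    (hev n).compliance_growth hμ.length_pos hT hw (mul_pos (hμ.param n).1 hμ.damaged_pos)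
      (hμ.param n).2 hs hst ht

theorem damage_growth_of_tendsto {L T κ a₀ a₁ : ℝ} {w : ℝ → H1 univ} (hκ : 0 < κ)
    (hT : 0 ≤ T) (hw : AbsolutelyContinuousOnInterval w 0 T) {ε : ℕ → ℝ} {Θ : ℕ → ℝ → ℝ → ℝ}
    {u : ℕ → ℝ → H1 (Ioo (0 : ℝ) L)}
    (hev : ∀ n, IsDamageEvolution L T κ a₀ a₁ w (ε n) (Θ n) (u n)) {s t : ℝ}
    {μ ν : Measure (Icc (0 : ℝ) L)} [IsFiniteMeasure μ] [IsFiniteMeasure ν]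
    (hμ : IsDamageLimit L κ a₀ a₁ (w s) ε (fun n => Θ n s) (fun n => u n s) μ)
    (hν : IsDamageLimit L κ a₀ a₁ (w t) ε (fun n => Θ n t) (fun n => u n t) ν)
    (hs : 0 ≤ s) (hst : s ≤ t) (ht : t ≤ T) :
    μ ≤ ν ∧ ν.real univ - μ.real univ ≤ a₁ / (κ * L) *
      ∫ q in s..t, |H1.jump L univ (w q) * deriv (fun r => H1.jump L univ (w r)) q| := by
  have hle := hμ.measure_le hν fun n => (hev n).monotone_density s t hs hst ht
  refine ⟨hle, ?_⟩
  have h := compliance_growth_of_tendsto hT hw hev hμ hν hs hst ht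
  have hL := hμ.length_pos
  have ha₀ := hμ.damaged_pos
  have ha₁ := hμ.sound_pos
  have hm := (measureReal_sub_mem_of_le hle MeasurableSet.univ).1
  have hm0 : 0 ≤ μ.real univ := measureReal_nonneg
  have e : κ * a₀ * (μ.real univ / a₀ + L / a₁)
        * ((ν.real univ / a₀ + L / a₁) - (μ.real univ / a₀ + L / a₁))
      = κ * (μ.real univ / a₀ + L / a₁) * (ν.real univ - μ.real univ) := by
    field_simp
    ring
  rw [e] at h
  -- Bounding the compliance at time `s` below by `L / a₁` makes the constant independent of time.
  have h1 : κ * (L / a₁) * (ν.real univ - μ.real univ)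
      ≤ κ * (μ.real univ / a₀ + L / a₁) * (ν.real univ - μ.real univ) := by
    gcongr
    exact le_add_of_nonneg_left (by positivity)
  have h2 := mul_le_mul_of_nonneg_left (h1.trans h) (show 0 ≤ a₁ / (κ * L) by positivity)
  refine le_trans (le_of_eq ?_) h2
  field_simp

theorem limitStress_eq_of_representative {L a₀ a₁ : ℝ} (hL : 0 < L) {w : H1 univ}
    (μ : Measure (Icc (0 : ℝ) L)) {W : ℝ → ℝ} (hW : Continuous W)
    (hWw : W =ᵐ[volume] H1.fn w) :
    limitStress L a₀ a₁ (H1.jump L univ w) μ = (W L - W 0) / (μ.real univ / a₀ + L / a₁) := by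
  obtain ⟨c, hc⟩ := H1.exists_hasTrace hL MeasurableSet.univ (subset_univ _) w
  have h := primitive_data_unique hL hW.continuousOn
    (H1.integrableOn_weakDeriv (subset_univ _) w) (c := c) (by
      filter_upwards [ae_restrict_of_ae hWw, hc] with x h1 h2
      rw [h1, h2])
  rw [limitStress, H1.jump_apply (subset_univ _), h.1, h.2, add_sub_cancel_left]

end BrittleDamage

/-! ### The limit evolution and its absolute continuity -/

theorem mainTheorem3
    (L T κ a₀ a₁ : ℝ) (hL : 0 < L) (hT : 0 < T) (hκ : 0 < κ) (ha₀ : 0 < a₀) (ha₁ : 0 < a₁)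
    -- the boundary displacement `w ∈ AC([0,T]; H¹(ℝ))`
    (w : ℝ → H1 univ) (hw : AbsolutelyContinuousOnInterval w 0 T)
    -- a sequence of quasi-static brittle damage evolutions, for parameters `ε n ↘ 0`
    (ε : ℕ → ℝ) (hε : ∀ n, 0 < ε n ∧ ε n * a₀ < a₁) (hε0 : Tendsto ε atTop (𝓝 0))
    (Θ : ℕ → ℝ → ℝ → ℝ) (uε : ℕ → ℝ → H1 (Ioo (0 : ℝ) L))
    (hev : ∀ n, IsDamageEvolution L T κ a₀ a₁ w (ε n) (Θ n) (uε n))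
    -- the limit damage measure `μ(t)`, along this sequence
    (μ : ℝ → FiniteMeasure (Icc (0 : ℝ) L))
    (hμ : ∀ t ∈ Icc 0 T, ∀ φ : C(Icc (0 : ℝ) L, ℝ),
      Tendsto (fun n => ∫ x, φ x * ((1 - Θ n t x) / ε n) ∂lebesgueOn (Icc (0 : ℝ) L)) atTop
        (𝓝 (∫ x, φ x ∂(μ t : Measure (Icc (0 : ℝ) L))))) :
    ∃ (σε : ℕ → ℝ → ℝ) (σ : ℝ → elasticityDomain κ a₀) (e : ℝ → ℝ) (l : ℝ → ℝ≥0)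
      (p : ℝ → SignedMeasure (Icc (0 : ℝ) L)) (u : ℝ → BV L),
      (∀ t ∈ Icc 0 T,
        -- the stresses `a_ε u_ε'` are homogeneous in space and converge to `σ(t)`
        (∀ n, (fun x => stiffness a₀ a₁ (ε n) (Θ n t x) * H1.weakDeriv (uε n t) x)
          =ᵐ[volume.restrict (Ioo 0 L)] fun _ => σε n t) ∧
        Tendsto (fun n => σε n t) atTop (𝓝 (σ t : ℝ)) ∧
        -- `l(t) = μ(t)([0,L])` and `σ(t) = [w(t)]_0^L / (l(t) / a₀ + L / a₁)`
        l t = (μ t) univ ∧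
        (∀ W : ℝ → ℝ, Continuous W → W =ᵐ[volume] H1.fn (w t) →
          (σ t : ℝ) = (W L - W 0) / (l t / a₀ + L / a₁)) ∧
        -- the elastic strains `e_ε = σ_ε Θ_ε / a₁` converge strongly in `L²` to `e(t) = σ(t) / a₁`
        e t = σ t / a₁ ∧
        Tendsto (fun n => eLpNorm (fun x => σε n t * (Θ n t x / a₁) - e t) 2
          (volume.restrict (Ioo 0 L))) atTop (𝓝 0) ∧
        -- the plastic strains `p_ε = σ_ε (1 - Θ_ε) / (ε a₀)` converge weakly-* in `M([0,L])`
        -- to `p(t) = (σ(t) / a₀) μ(t)`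
        p t = ((σ t : ℝ) / a₀) • (μ t : Measure (Icc (0 : ℝ) L)).toSignedMeasure ∧
        TendstoWeakStar L (fun n x => σε n t * ((1 - Θ n t x) / (ε n * a₀))) (p t) ∧
        -- the displacements converge weakly-* in `BV((0,L))` to `u(t)`
        TendstoWeakStarBV L (fun n => uε n t) (u t)) ∧
      -- `(σ, e, l, μ, p, u) : [0,T] → K × ℝ × ℝ⁺ × M([0,L]) × M([0,L]) × BV((0,L))` is
      -- absolutely continuous
      AbsolutelyContinuousOnInterval
        (fun t => (σ t, e t, l t, (μ t : Measure (Icc (0 : ℝ) L)).toSignedMeasure, p t, u t))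
        0 T := by
  have hdl (t : ℝ) (ht : t ∈ Icc 0 T) : IsDamageLimit L κ a₀ a₁ (w t) ε (fun n => Θ n t)
      (fun n => uε n t) (μ t : Measure (Icc (0 : ℝ) L)) :=
    ⟨hL, ha₀, ha₁, hε, hε0, fun n => (hev n).isOneSidedMinimal ht, hμ t ht⟩
  choose c hc using fun t => H1.exists_hasTrace hL MeasurableSet.univ (subset_univ _) (w t)
  have hk : 0 ≤ √(2 * κ * a₀) := Real.sqrt_nonneg _
  classical
  -- Membership in `K`, and in `BV` for `u`, is known only for times in `[0,T]`; the value `0`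
  -- elsewhere is irrelevant.
  let σ (t : ℝ) : elasticityDomain κ a₀ := if h : t ∈ Icc 0 T then
    ⟨limitStress L a₀ a₁ (H1.jump L univ (w t)) (μ t), (hdl t h).limitStress_mem⟩
    else ⟨0, neg_nonpos.2 hk, hk⟩
  let u (t : ℝ) : BV L := if h : t ∈ Icc 0 T then
    ⟨limitPair a₀ a₁ (c t) (limitStress L a₀ a₁ (H1.jump L univ (w t)) (μ t)) (μ t),
      (hdl t h).limitPair_mem (hc t)⟩ else 0
  have hσ {t : ℝ} (ht : t ∈ Icc 0 T) :
      (σ t : ℝ) = limitStress L a₀ a₁ (H1.jump L univ (w t)) (μ t) := by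
    simp only [σ, dif_pos ht]
  have hu {t : ℝ} (ht : t ∈ Icc 0 T) : u t = ⟨limitPair a₀ a₁ (c t)
      (limitStress L a₀ a₁ (H1.jump L univ (w t)) (μ t)) (μ t),
        (hdl t ht).limitPair_mem (hc t)⟩ := by
    simp only [u, dif_pos ht]
  have hu' {t : ℝ} (ht : t ∈ Icc 0 T) : (u t : WithLp 1 (L1 L × SignedMeasure (Ioo (0 : ℝ) L)))
      = limitPair a₀ a₁ (c t) (σ t) (μ t) := by
    rw [hu ht, hσ ht]
  have hl (t : ℝ) : (((μ t) univ : ℝ≥0) : ℝ) = (μ t : Measure (Icc (0 : ℝ) L)).real univ := rfl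
  refine ⟨fun n t => H1.jump L univ (w t) / compliance L a₀ a₁ (ε n) (Θ n t), σ,
    fun t => σ t / a₁, fun t => (μ t) univ,
    fun t => ((σ t : ℝ) / a₀) • (μ t : Measure (Icc (0 : ℝ) L)).toSignedMeasure, u, ?_, ?_⟩
  · intro t ht
    refine ⟨fun n => ((hev n).isOneSidedMinimal ht).stress_eq hL (mul_pos (hε n).1 ha₀) (hε n).2,
      ?_, rfl, fun W hW hWw => ?_, rfl, ?_, rfl, ?_, ?_⟩
    · rw [hσ ht]
      exact (hdl t ht).tendsto_stress
    · rw [hσ ht, hl]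
      exact limitStress_eq_of_representative hL _ hW hWw
    · simp only [hσ ht]
      exact (hdl t ht).tendsto_elastic_strain
    · simp only [hσ ht]
      exact (hdl t ht).tendstoWeakStar_plastic_strain
    · rw [hu ht]
      exact (hdl t ht).tendstoWeakStarBV (hc t)
  set Δ : ℝ → ℝ := fun t => H1.jump L univ (w t) with hΔ
  have hΔac : AbsolutelyContinuousOnInterval Δ 0 T := absolutelyContinuousOnInterval_clm hw _
  have hVi : IntervalIntegrable (fun q => |Δ q * deriv Δ q|) volume 0 T :=
    (hΔac.intervalIntegrable_deriv.continuousOn_mul hΔac.continuousOn).abs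
  -- All increments below are bounded by those of the two absolutely continuous curves `w` and `V`.
  set V : ℝ → ℝ := fun t => ∫ q in (0 : ℝ)..t, |Δ q * deriv Δ q| with hV
  have hVac : AbsolutelyContinuousOnInterval V 0 T :=
    hVi.absolutelyContinuousOnInterval_intervalIntegral left_mem_uIcc
  obtain ⟨C, hC0, hC⟩ := H1.exists_trace_bound hL (subset_univ (Ioo 0 L))
  set m : ℝ → ℝ := fun t => (μ t : Measure (Icc (0 : ℝ) L)).real univ with hm
  have hm0 (t : ℝ) : 0 ≤ m t := measureReal_nonneg
  set k := √(2 * κ * a₀)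
  have hσk (t : ℝ) : |(σ t : ℝ)| ≤ k := abs_le.2 (σ t).2
  obtain ⟨N, hN0, hμle, hmle⟩ : ∃ N, 0 ≤ N ∧
      (∀ s t, 0 ≤ s → s ≤ t → t ≤ T →
        (μ s : Measure (Icc (0 : ℝ) L)) ≤ (μ t : Measure (Icc (0 : ℝ) L))) ∧
      ∀ s t, 0 ≤ s → s ≤ t → t ≤ T → m t - m s ≤ N * (dist (w t) (w s) + dist (V t) (V s)) := by
    have key (s t : ℝ) (hs : 0 ≤ s) (hst : s ≤ t) (ht : t ≤ T) :=
      damage_growth_of_tendsto hκ hT.le hw hev (hdl s ⟨hs, hst.trans ht⟩)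
        (hdl t ⟨hs.trans hst, ht⟩) hs hst ht
    refine ⟨a₁ / (κ * L), by positivity, fun s t hs hst ht => (key s t hs hst ht).1,
      fun s t hs hst ht => (key s t hs hst ht).2.trans ?_⟩
    gcongr
    have hsub {r : ℝ} (hr : r ∈ Icc 0 T) :
        IntervalIntegrable (fun q => |Δ q * deriv Δ q|) volume 0 r :=
      hVi.mono_set (uIcc_subset_uIcc_left (by rwa [uIcc_of_le hT.le]))
    have e : V t - V s = ∫ q in s..t, |Δ q * deriv Δ q| :=
      intervalIntegral.integral_interval_sub_left (hsub ⟨hs.trans hst, ht⟩)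
        (hsub ⟨hs, hst.trans ht⟩)
    rw [Real.dist_eq, e]
    exact (le_abs_self _).trans (le_add_of_nonneg_left dist_nonneg)
  have hcle (s t : ℝ) : |c t - c s| ≤ C * (dist (w t) (w s) + dist (V t) (V s)) :=
    (hC _ _ ((hc t).sub (subset_univ _) (hc s))).trans (by
      rw [← dist_eq_norm]
      gcongr
      exact le_add_of_nonneg_right dist_nonneg)
  obtain ⟨S, hS0, hσle⟩ : ∃ S, 0 ≤ S ∧ ∀ s t, 0 ≤ s → s ≤ t → t ≤ T →
      |(σ t : ℝ) - σ s| ≤ S * (dist (w t) (w s) + dist (V t) (V s)) := by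
    -- The elongation contributes its operator norm; the change of mass is weighted by the stress
    -- bound `k`.
    refine ⟨a₁ / L * (‖H1.jump L univ‖ + k / a₀ * N), by positivity, fun s t hs hst ht => ?_⟩
    have h1 := hσk s
    rw [hσ ⟨hs, hst.trans ht⟩] at h1
    rw [hσ ⟨hs, hst.trans ht⟩, hσ ⟨hs.trans hst, ht⟩]
    refine (abs_limitStress_sub_le hL ha₀ ha₁ h1).trans ?_
    rw [mul_assoc, add_mul, mul_assoc (k / a₀)]
    have h2 : |H1.jump L univ (w t) - H1.jump L univ (w s)|
        ≤ ‖H1.jump L univ‖ * (dist (w t) (w s) + dist (V t) (V s)) := by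
      rw [← map_sub, dist_eq_norm, ← Real.norm_eq_abs]
      refine ((H1.jump L univ).le_opNorm _).trans ?_
      gcongr
      exact le_add_of_nonneg_right dist_nonneg
    have h3 := hmle s t hs hst ht
    have h4 := (measureReal_sub_mem_of_le (hμle s t hs hst ht) MeasurableSet.univ).1
    rw [abs_of_nonneg h4]
    gcongr
  have hmT {s : ℝ} (hs : 0 ≤ s) (hsT : s ≤ T) : m s ≤ m T :=
    sub_nonneg.1 (measureReal_sub_mem_of_le (hμle s T hs hsT le_rfl) MeasurableSet.univ).1
  refine absolutelyContinuousOnInterval_prodMk ?_ (absolutelyContinuousOnInterval_prodMk ?_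
    (absolutelyContinuousOnInterval_prodMk ?_ (absolutelyContinuousOnInterval_prodMk ?_
    (absolutelyContinuousOnInterval_prodMk ?_ ?_))))
  · exact absolutelyContinuousOnInterval_of_dist_le_of_le hT.le hw hVac S hσle
  · refine absolutelyContinuousOnInterval_of_dist_le_of_le hT.le hw hVac (S / a₁)
      fun s t hs hst ht => ?_
    rw [Real.dist_eq, ← sub_div, abs_div, abs_of_pos ha₁, div_mul_eq_mul_div]
    gcongr
    exact hσle s t hs hst ht
  · refine absolutelyContinuousOnInterval_of_dist_le_of_le hT.le hw hVac N
      fun s t hs hst ht => ?_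
    have h4 := (measureReal_sub_mem_of_le (hμle s t hs hst ht) MeasurableSet.univ).1
    rw [NNReal.dist_eq, hl, hl, abs_of_nonneg h4]
    exact hmle s t hs hst ht
  · refine absolutelyContinuousOnInterval_of_dist_le_of_le hT.le hw hVac N
      fun s t hs hst ht => ?_
    have h1 := norm_smul_sub_smul_toSignedMeasure_le 1 1 (hμle s t hs hst ht)
    rw [one_smul, one_smul, abs_one, one_mul, sub_self, abs_zero, zero_mul, add_zero] at h1
    rw [dist_eq_norm]
    exact h1.trans (hmle s t hs hst ht)
  -- A product estimate: the stress is at most `k`, and the earlier mass is at most the final mass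
  -- `m T`.
  · refine absolutelyContinuousOnInterval_of_dist_le_of_le hT.le hw hVac
      (k / a₀ * N + S / a₀ * m T) fun s t hs hst ht => ?_
    have h1 := norm_smul_sub_smul_toSignedMeasure_le ((σ t : ℝ) / a₀) ((σ s : ℝ) / a₀)
      (hμle s t hs hst ht)
    rw [dist_eq_norm]
    refine h1.trans ?_
    rw [← sub_div, abs_div, abs_div, abs_of_pos ha₀]
    have h2 := hσle s t hs hst ht
    have h3 := hmle s t hs hst ht
    have h4 := (measureReal_sub_mem_of_le (hμle s t hs hst ht) MeasurableSet.univ).1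
    have h5 := hmT hs (hst.trans ht)
    have h6 := hσk t
    set R := dist (w t) (w s) + dist (V t) (V s)
    calc _ ≤ k / a₀ * (N * R) + S * R / a₀ * m T := by gcongr
      _ = _ := by ring
  · refine absolutelyContinuousOnInterval_of_dist_le_of_le hT.le hw hVac
      ((L + 1) * (C + k / a₀ * N + S * (m T / a₀ + L / a₁))) fun s t hs hst ht => ?_
    rw [Subtype.dist_eq, hu' ⟨hs, hst.trans ht⟩, hu' ⟨hs.trans hst, ht⟩, dist_eq_norm]
    refine (norm_limitPair_sub_le hL ha₀ ha₁ (hμle s t hs hst ht)).trans ?_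
    have h1 := hcle s t
    have h2 := hσle s t hs hst ht
    have h3 := hmle s t hs hst ht
    have h4 := (measureReal_sub_mem_of_le (hμle s t hs hst ht) MeasurableSet.univ).1
    have h5 := hmT hs (hst.trans ht)
    have h6 := hσk t
    have h7 := hm0 s
    set R := dist (w t) (w s) + dist (V t) (V s)
    calc _ ≤ (L + 1) * (C * R + k / a₀ * (N * R) + S * R * (m T / a₀ + L / a₁)) := by gcongr
      _ = _ := by ring
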